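/- Let $k$ be a field of characteristic zero. Graded vector spaces are $\mathbb Z$-graded over $k$, $V[n]^p=V^{n+p}$, and the Koszul sign rule is used throughout. Let $\mathfrak g$ be an $L_\infty$-algebra, i.e. a graded vector space with graded symmetric brackets $l_n:S^n(\mathfrak g[1])\to\mathfrak g[1]$, $n\ge 1$, of degree $1$, satisfying the higher Jacobi identities. (Source.) The brackets $l_n$ extend to graded symmetric degree-one multiderivations of the graded commutative algebra $S(\mathfrak g[-1])$ (with degrees taken in $S(\mathfrak g[-1])[2]\supset\mathfrak g[1]$), hence to the completion $\widehat S(\mathfrak g[-1])=\prod_{n\ge0}S^n(\mathfrak g[-1])$; still denoted $l_n: S^n(\widehat S(\mathfrak g[-1])[2])\to \widehat S(\mathfrak g[-1])[2]$, they make $\widehat S(\mathfrak g[-1])[1]$ an $L_\infty$-algebra. (Target.) On $\mathcal B^+=\prod_{m,n\ge1}\mathrm{Hom}(S^m(\mathfrak g[1]),S^n(\mathfrak g[-1]))[2]$ let $[f,g]=f\circ g-(-1)^{|f||g|}g\circ f$ be the big bracket, where $$(f\circ g)(x_1\cdots x_m)=\sum_{\sigma}(-1)^{\varepsilon}f\bigl(x_{\sigma(1)}\cdots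 x_{\sigma(i)}\,g(x_{\sigma(i+1)}\cdots x_{\sigma(m)})_{(1)}\bigr)\,g(x_{\sigma(i+1)}\cdots x_{\sigma(m)})_{(2)},$$ the sum being over all $(i,m-i)$-shuffles $\sigma$, $0\le i\le m$; $(-1)^\varepsilon$ is the Koszul sign of $\sigma$ times $(-1)^{|g|(|x_{\sigma(1)}|+\dots+|x_{\sigma(i)}|)}$, and $a\mapsto a_{(1)}\otimes a_{(2)}$ is the comultiplication of $S(\mathfrak g[-1])$ followed by the projection of the first factor to $\mathfrak g[-1]$. With $d=[l_1+l_2+\cdots,-]$, $\mathcal B^+$ is a dg Lie algebra. For $n\ge1$, $x_1,\dots,x_n\in\widehat S(\mathfrak g[-1])[2]$ and $y=y_1\cdots y_p\in S^p(\mathfrak g[1])$, $p\ge1$, put $$\varphi_n(x_1\odot\dots\odot x_n)(y):=l_{n+p}(x_1\odot\dots\odot x_n\odot y_1\odot\dots\odot y_p).$$ **Theorem.** The maps $\varphi_n:S^n(\widehat S(\mathfrak g[-1])[2])\to\mathcal B^+[1]$ are well defined, of degree zero, and define an $L_\infty$-morphism from the $L_\infty$-algebra $\widehat S(\mathfrak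 g[-1])[1]$ to the dg Lie algebra $\mathcal B^+$, i.e. they are the components of a morphism of dg coalgebras $S(\widehat S(\mathfrak g[-1])[2])\to S(\mathcal B^+[1])$, where the codifferential of $S(\mathcal B^+[1])$ has the components $a\mapsto -da$ and $a\odot b\mapsto(-1)^{|a|}[a,b]$ ($|a|$ the degree in $\mathcal B^+$). Explicitly, for homogeneous $x_i$ and all $n\ge1$, $$-d\varphi_n(x_1\odot\dots\odot x_n)-\frac12\sum_{i=1}^{n-1}\sum_{\sigma\in \mathrm{Sh}_{i,n-i}}(-1)^{|x_\sigma|+|x_{\sigma(1)}|+\dots+|x_{\sigma(i)}|}\bigl[\varphi_i(x_{\sigma(1)}\odot\dots\odot x_{\sigma(i)}),\varphi_{n-i}(x_{\sigma(i+1)}\odot\dots\odot x_{\sigma(n)})\bigr]$$ $$=\sum_{m=1}^n\sum_{\tau\in \mathrm{Sh}_{m,n-m}}(-1)^{|x_\tau|}\varphi_{n-m+1}\bigl(l_m(x_{\tau(1)}\odot\dots\odot x_{\tau(m)})\odot x_{\tau(m+1)}\odot\dots\odot x_{\tau(n)}\bigr),$$ with degrees $|x_i|$ in $\widehat S(\mathfrak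 g[-1])[2]$ and $(-1)^{|x_\sigma|}$ the Koszul sign of $\sigma$. In particular, if $l_n=0$ for $n\ne2$ (a graded Lie algebra), then $\varphi_n=0$ for $n\ge2$, $d\varphi_1=0$, and $[\varphi_1(x),\varphi_1(y)]=\varphi_1([x,y])$, where $[x,y]=(-1)^{|x|}l_2(x\odot y)$, with $|x|$ the degree in $\widehat S(\mathfrak g[-1])[1]$, is the Lie bracket of $\widehat S(\mathfrak g[-1])[1]$. Consequently, let $r\in\lambda\widehat S(\mathfrak g[-1])[1][[\lambda]]$ be an $r_\infty$-matrix, i.e. an element of degree one with $\sum_{n\ge1}\frac1{n!}l_n(r\odot\dots\odot r)=0$. Then $\mu'=\varphi(e^r)=\sum_{n\ge1}\frac1{n!}\varphi_n(r\odot\dots\odot r)$ is a degree-one element of $\lambda\mathcal B^+[[\lambda]]$ with $d\mu'+\frac12[\mu',\mu']=0$, and $\mu=\mu'+l_1+l_2+\cdots\in\mathcal B^+[[\lambda]]$ has degree one and satisfies $[\mu,\mu]=0$, i.e. it is a ($\lambda$-dependent) $L_\infty$-bialgebra structure on $\mathfrak g$ (a triangular $L_\infty$-bialgebra). -/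

import Mathlib

open scoped TensorProduct

noncomputable section

namespace RInf

universe u v w

/-! ### Graded spaces, Koszul signs, `L_∞`-algebras, dg Lie algebras, `L_∞`-morphisms

A graded vector space is a family of subspaces `𝒱 p` (the homogeneous elements of degree `p`) of an
ambient vector space.  As usual, identities with Koszul signs are stated for homogeneous elements.
A linear map out of `S^n (V)` is a multilinear map in `n` variables that is symmetric in the
graded sense. -/

section General

variable {k : Type u} [Field k] {E : Type v} [AddCommGroup E] [Module k E]
  {M : Type w} [AddCommGroup M] [Module k M]

/-- The translation `V[n]`, with `V[n]^p = V^(n+p)`. -/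
def shift (𝒱 : ℤ → Submodule k E) (n : ℤ) : ℤ → Submodule k E := fun p => 𝒱 (n + p)

/-- The Koszul sign of the unshuffle `x₁ ⋯ xₙ ↦ x_S x_{Sᶜ}` for elements of degrees `d`.  The
`(p, n - p)`-shuffles correspond to the subsets `S` of `{1, …, n}` with `p` elements. -/
def koszul {n : ℕ} (d : Fin n → ℤ) (S : Finset (Fin n)) : ℤˣ :=
  ∏ i ∈ S, ∏ j ∈ Sᶜ with j < i, (d i * d j).negOnePow

/-- The subfamily `x_S`, in increasing order of the indices. -/
def sub {n : ℕ} (x : Fin n → E) (S : Finset (Fin n)) : Fin S.card → E :=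
  fun i => x (S.orderEmbOfFin rfl i)

/-- Graded symmetry of a multilinear map: exchanging two neighbours of degrees `p`, `q` produces
the sign `(-1)^(p q)`. -/
def IsGradedSymm (𝒱 : ℤ → Submodule k E) {n : ℕ}
    (F : MultilinearMap k (fun _ : Fin n => E) M) : Prop :=
  ∀ (d : Fin n → ℤ) (x : Fin n → E), (∀ i, x i ∈ 𝒱 (d i)) →
    ∀ i j : Fin n, (i : ℕ) + 1 = j →
      F (x ∘ Equiv.swap i j) = (d i * d j).negOnePow • F x

/-- An `L_∞`-algebra structure on the graded space `V`: brackets `l n : S^n (V[1]) → V[1]`,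
`n ≥ 1`, of degree one that satisfy the higher Jacobi identities (that is, the coderivation of
`S (V[1])` with corestrictions `l n` squares to zero). -/
structure IsLInfinity (𝒱 : ℤ → Submodule k E)
    (l : ∀ n : ℕ, MultilinearMap k (fun _ : Fin n => E) E) : Prop where
  zero : l 0 = 0
  symm : ∀ n, IsGradedSymm (shift 𝒱 1) (l n)
  degree : ∀ (n : ℕ) (d : Fin n → ℤ) (x : Fin n → E), (∀ i, x i ∈ shift 𝒱 1 (d i)) →
    l n x ∈ shift 𝒱 1 (∑ i, d i + 1)
  jacobi : ∀ (n : ℕ) (d : Fin n → ℤ) (x : Fin n → E), (∀ i, x i ∈ shift 𝒱 1 (d i)) →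
    ∑ S : Finset (Fin n), koszul d S •
      l (Sᶜ.card + 1) (Fin.cons (l S.card (sub x S)) (sub x Sᶜ)) = 0

/-- A dg Lie algebra structure on the graded space `ℬ`.  Here `br a b` is the bracket of
elements of degrees `a` and `b`, and `dd a` is the differential on elements of degree `a`. -/
structure IsDGLie (ℬ : ℤ → Submodule k M) (br : ℤ → ℤ → M →ₗ[k] M →ₗ[k] M)
    (dd : ℤ → M →ₗ[k] M) : Prop where
  bracket_mem : ∀ a b f g, f ∈ ℬ a → g ∈ ℬ b → br a b f g ∈ ℬ (a + b)
  d_mem : ∀ a f, f ∈ ℬ a → dd a f ∈ ℬ (a + 1)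
  antisymm : ∀ a b f g, f ∈ ℬ a → g ∈ ℬ b →
    br a b f g = -((a * b).negOnePow • br b a g f)
  jacobi : ∀ a b c f g h, f ∈ ℬ a → g ∈ ℬ b → h ∈ ℬ c →
    br a (b + c) f (br b c g h) =
      br (a + b) c (br a b f g) h + (a * b).negOnePow • br b (a + c) g (br a c f h)
  d_sq : ∀ a f, f ∈ ℬ a → dd (a + 1) (dd a f) = 0
  leibniz : ∀ a b f g, f ∈ ℬ a → g ∈ ℬ b →
    dd (a + b) (br a b f g) =
      br (a + 1) b (dd a f) g + a.negOnePow • br a (b + 1) f (dd b g)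

/-- The maps `φ n : S^n (V[1]) → ℬ[1]`, `n ≥ 1`, are the corestrictions of a morphism of dg
coalgebras `S (V[1]) → S (ℬ[1])`, that is, they define an `L_∞`-morphism from the `L_∞`-algebra
`(V, l)` to the dg Lie algebra `(ℬ, br, dd)`.  The codifferential of `S (ℬ[1])` is the usual one:
its corestrictions are `a ↦ -d a` and `a ⊙ b ↦ (-1)^|a| [a, b]`, where `|a|` is the degree
of `a` in `ℬ`. -/
structure IsLInfinityMorphism (𝒱 : ℤ → Submodule k E)
    (l : ∀ n : ℕ, MultilinearMap k (fun _ : Fin n => E) E)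
    (ℬ : ℤ → Submodule k M) (br : ℤ → ℤ → M →ₗ[k] M →ₗ[k] M) (dd : ℤ → M →ₗ[k] M)
    (φ : ∀ n : ℕ, MultilinearMap k (fun _ : Fin n => E) M) : Prop where
  source : IsLInfinity 𝒱 l
  target : IsDGLie ℬ br dd
  symm : ∀ n, 1 ≤ n → IsGradedSymm (shift 𝒱 1) (φ n)
  degree : ∀ n, 1 ≤ n → ∀ (d : Fin n → ℤ) (x : Fin n → E), (∀ i, x i ∈ shift 𝒱 1 (d i)) →
    φ n x ∈ shift ℬ 1 (∑ i, d i)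
  compat : ∀ n, 1 ≤ n → ∀ (d : Fin n → ℤ) (x : Fin n → E), (∀ i, x i ∈ shift 𝒱 1 (d i)) →
    -dd (1 + ∑ i, d i) (φ n x)
      + (2⁻¹ : k) • ∑ S : Finset (Fin n) with S.Nonempty ∧ Sᶜ.Nonempty,
          koszul d S • (1 + ∑ i ∈ S, d i).negOnePow •
            br (1 + ∑ i ∈ S, d i) (1 + ∑ i ∈ Sᶜ, d i)
              (φ S.card (sub x S)) (φ Sᶜ.card (sub x Sᶜ))
    = ∑ S : Finset (Fin n) with S.Nonempty,
        koszul d S • φ (Sᶜ.card + 1) (Fin.cons (l S.card (sub x S)) (sub x Sᶜ))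

/-- For a formal power series `r = ∑ λ^i r_i` with `r_0 = 0`, the coefficients of
`∑_{n ≥ 1} (1/n!) F_n (r ⊙ ⋯ ⊙ r)`.  (The terms with `n > N` do not contribute to `λ^N`.) -/
def expSeries (F : ∀ n : ℕ, MultilinearMap k (fun _ : Fin n => E) M) (r : ℕ → E) : ℕ → M :=
  fun N => ∑ n ∈ Finset.Icc 1 N, ((n.factorial : k)⁻¹) •
    ∑ ν ∈ Finset.Nat.antidiagonalTuple n N, F n (fun i => r (ν i))

end General

section Graded

variable {k : Type u} [Field k] {g : Type v} [AddCommGroup g] [Module k g]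
  (𝒢 : ℤ → Submodule k g)

/-! ### The graded symmetric algebra `S (g[-1])` -/

/-- The relations `x y = (-1)^(|x| |y|) y x` for homogeneous `x, y ∈ g[-1]`. -/
inductive SymRel : TensorAlgebra k g → TensorAlgebra k g → Prop
  | swap (p q : ℤ) (x y : g) (hx : x ∈ shift 𝒢 (-1) p) (hy : y ∈ shift 𝒢 (-1) q) :
      SymRel (TensorAlgebra.ι k x * TensorAlgebra.ι k y)
        ((p * q).negOnePow • (TensorAlgebra.ι k y * TensorAlgebra.ι k x))

/-- The graded commutative algebra `S (g[-1])`. -/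
def Sym : Type (max u v) := RingQuot (SymRel 𝒢)

instance : Ring (Sym 𝒢) := inferInstanceAs (Ring (RingQuot (SymRel 𝒢)))

instance : Algebra k (Sym 𝒢) := inferInstanceAs (Algebra k (RingQuot (SymRel 𝒢)))

/-- The quotient map from the tensor algebra. -/
def symMk : TensorAlgebra k g →ₐ[k] Sym 𝒢 := RingQuot.mkAlgHom k (SymRel 𝒢)

/-- The inclusion of the generators. -/
def gen : g →ₗ[k] Sym 𝒢 :=
  (symMk 𝒢).toLinearMap ∘ₗ TensorAlgebra.ι k

/-- The elements of degree `p` in `S^n (g[-1])`. -/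
def symPart (n : ℕ) (p : ℤ) : Submodule k (Sym 𝒢) :=
  Submodule.span k {a | ∃ (d : Fin n → ℤ) (x : Fin n → g),
    (∀ i, x i ∈ shift 𝒢 (-1) (d i)) ∧ ∑ i, d i = p ∧ a = (List.ofFn fun i => gen 𝒢 (x i)).prod}

/-- The elements of degree `p` in `S (g[-1])`. -/
def symDeg (p : ℤ) : Submodule k (Sym 𝒢) := ⨆ n, symPart 𝒢 n p

/-- The degree `p` part of `Ŝ (g[-1]) = ∏ₙ S^n (g[-1])`; an element is the sequence of its
components. -/
def hatDeg (p : ℤ) : Submodule k (ℕ → Sym 𝒢) where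
  carrier := {a | ∀ n, a n ∈ symPart 𝒢 n p}
  add_mem' ha hb n := add_mem (ha n) (hb n)
  zero_mem' _ := zero_mem _
  smul_mem' c _ ha n := Submodule.smul_mem _ c (ha n)

/-- The inclusion of `g[-1]` in `Ŝ (g[-1])` (up to translation, of `g[1]` in `Ŝ (g[-1])[2]`). -/
def hatGen : g →ₗ[k] (ℕ → Sym 𝒢) := LinearMap.single k (fun _ : ℕ => Sym 𝒢) 1 ∘ₗ gen 𝒢

theorem gen_swap {p q : ℤ} {x y : g} (hx : x ∈ shift 𝒢 (-1) p) (hy : y ∈ shift 𝒢 (-1) q) :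
    gen 𝒢 x * gen 𝒢 y = (p * q).negOnePow • (gen 𝒢 y * gen 𝒢 x) := by
  have h : symMk 𝒢 _ = symMk 𝒢 _ := RingQuot.mkAlgHom_rel k (SymRel.swap p q x y hx hy)
  simpa [gen, Units.smul_def] using h

/-- The algebra morphism out of `S (g[-1])` that extends a linear map `f` on the generators. -/
def symLift {R : Type*} [Ring R] [Algebra k R] (f : g →ₗ[k] R)
    (hf : ∀ (p q : ℤ) (x y : g), x ∈ shift 𝒢 (-1) p → y ∈ shift 𝒢 (-1) q →
      f x * f y = (p * q).negOnePow • (f y * f x)) : Sym 𝒢 →ₐ[k] R :=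
  RingQuot.liftAlgHom k ⟨TensorAlgebra.lift k f, by
    rintro _ _ ⟨p, q, x, y, hx, hy⟩
    simpa [Units.smul_def] using hf p q x y hx hy⟩

variable [DirectSum.Decomposition 𝒢]

/-- The projection of `g` onto its part of parity `e` with respect to the degree in `g[1]`, or,
what is the same, in `g[-1]`. -/
def par (e : Fin 2) : g →ₗ[k] g :=
  DirectSum.toModule k ℤ g (fun i => if (i + 1) % 2 = (e : ℤ) then (𝒢 i).subtype else 0) ∘ₗ
    (DirectSum.decomposeLinearEquiv 𝒢).toLinearMap

/-- The parity involution `x ↦ (-1)^|x| x` of `g[-1]`. -/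
def parInv : g →ₗ[k] g := par 𝒢 0 - par 𝒢 1

theorem par_of_mem {i : ℤ} {x : g} (hx : x ∈ 𝒢 i) (e : Fin 2) :
    par 𝒢 e x = if (i + 1) % 2 = (e : ℤ) then x else 0 := by
  have h := DirectSum.decompose_of_mem 𝒢 hx
  simp only [par, LinearMap.comp_apply, LinearEquiv.coe_coe,
    DirectSum.decomposeLinearEquiv_apply, h]
  erw [DirectSum.toModule_lof]
  split_ifs <;> simp

theorem par_even {p : ℤ} {x : g} (hx : x ∈ shift 𝒢 (-1) p) (hp : Even p) :
    par 𝒢 0 x = x ∧ par 𝒢 1 x = 0 := by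
  have h := par_of_mem 𝒢 hx
  have : (-1 + p + 1) % 2 = 0 := by rw [Int.even_iff] at hp; omega
  rw [h, h, this]
  simp

theorem par_odd {p : ℤ} {x : g} (hx : x ∈ shift 𝒢 (-1) p) (hp : Odd p) :
    par 𝒢 0 x = 0 ∧ par 𝒢 1 x = x := by
  have h := par_of_mem 𝒢 hx
  have : (-1 + p + 1) % 2 = 1 := by rw [Int.odd_iff] at hp; omega
  rw [h, h, this]
  simp

theorem parInv_mem {p : ℤ} {x : g} (hx : x ∈ shift 𝒢 (-1) p) :
    parInv 𝒢 x = p.negOnePow • x := by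
  rcases Int.even_or_odd p with hp | hp
  · obtain ⟨h0, h1⟩ := par_even 𝒢 hx hp
    simp [parInv, h0, h1, Int.negOnePow_even p hp]
  · obtain ⟨h0, h1⟩ := par_odd 𝒢 hx hp
    simp [parInv, h0, h1, Int.negOnePow_odd p hp, Units.smul_def]

theorem parInv_parInv (x : g) : parInv 𝒢 (parInv 𝒢 x) = x := by
  induction x using DirectSum.Decomposition.inductionOn 𝒢 with
  | zero => simp
  | homogeneous x =>
    rename_i i
    have hx : (x : g) ∈ shift 𝒢 (-1) (i + 1) := by
      simp [shift]
    rw [parInv_mem 𝒢 hx, Units.smul_def, map_zsmul, parInv_mem 𝒢 hx, Units.smul_def, smul_smul]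
    simp
  | add x y hx hy => simp [hx, hy]

/-- The parity involution `a ↦ (-1)^|a| a` of `S (g[-1])`. -/
def symInv : Sym 𝒢 →ₐ[k] Sym 𝒢 :=
  symLift 𝒢 (gen 𝒢 ∘ₗ parInv 𝒢) (by
    intro p q x y hx hy
    simp only [LinearMap.comp_apply, parInv_mem 𝒢 hx, parInv_mem 𝒢 hy, Units.smul_def, map_zsmul,
      smul_mul_assoc, mul_smul_comm]
    rw [gen_swap 𝒢 hx hy, Units.smul_def]
    simp only [smul_smul]
    congr 1
    ring)

/-- Left multiplication by a generator `v` on `g[-1] ⊗ S (g[-1])`, with the Koszul sign: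
`x ⊗ a ↦ (-1)^(|v| |x|) x ⊗ v a`. -/
def tensorMul : g →ₗ[k] Module.End k (g ⊗[k] Sym 𝒢) :=
  let T := TensorProduct.mapBilinear (RingHom.id k) g (Sym 𝒢) g (Sym 𝒢)
  T LinearMap.id ∘ₗ LinearMap.mul k (Sym 𝒢) ∘ₗ gen 𝒢 ∘ₗ par 𝒢 0 +
    T (parInv 𝒢) ∘ₗ LinearMap.mul k (Sym 𝒢) ∘ₗ gen 𝒢 ∘ₗ par 𝒢 1

theorem tensorMul_tmul {p q : ℤ} {v x : g} (hv : v ∈ shift 𝒢 (-1) p)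
    (hx : x ∈ shift 𝒢 (-1) q) (a : Sym 𝒢) :
    tensorMul 𝒢 v (x ⊗ₜ a) = (p * q).negOnePow • (x ⊗ₜ[k] (gen 𝒢 v * a)) := by
  rcases Int.even_or_odd p with hp | hp
  · obtain ⟨h0, h1⟩ := par_even 𝒢 hv hp
    simp [tensorMul, h0, h1, Int.negOnePow_even _ (hp.mul_right q)]
  · obtain ⟨h0, h1⟩ := par_odd 𝒢 hv hp
    have : (p * q).negOnePow = q.negOnePow := by
      rcases Int.even_or_odd q with hq | hq
      · rw [Int.negOnePow_even _ hq, Int.negOnePow_even _ (hq.mul_left p)]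
      · rw [Int.negOnePow_odd _ hq, Int.negOnePow_odd _ (hp.mul hq)]
    simp [tensorMul, h0, h1, this, parInv_mem 𝒢 hx, Units.smul_def, TensorProduct.smul_tmul',
      ← Int.cast_smul_eq_zsmul k]

theorem tensorMul_swap {p q : ℤ} {v w : g} (hv : v ∈ shift 𝒢 (-1) p)
    (hw : w ∈ shift 𝒢 (-1) q) (t : g ⊗[k] Sym 𝒢) :
    tensorMul 𝒢 v (tensorMul 𝒢 w t) = (p * q).negOnePow • tensorMul 𝒢 w (tensorMul 𝒢 v t) := by
  induction t using TensorProduct.induction_on with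
  | zero => simp
  | add s t hs ht => simp only [map_add, hs, ht, smul_add]
  | tmul x a =>
    induction x using DirectSum.Decomposition.inductionOn 𝒢 with
    | zero => simp
    | add x y hx hy => simp only [TensorProduct.add_tmul, map_add, hx, hy, smul_add]
    | homogeneous x =>
      rename_i i
      have hx : (x : g) ∈ shift 𝒢 (-1) (i + 1) := by simp [shift]
      rw [tensorMul_tmul 𝒢 hw hx, tensorMul_tmul 𝒢 hv hx]
      simp only [Units.smul_def, map_zsmul]
      rw [tensorMul_tmul 𝒢 hw hx, tensorMul_tmul 𝒢 hv hx, ← mul_assoc, ← mul_assoc,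
        gen_swap 𝒢 hv hw]
      simp only [Units.smul_def, smul_mul_assoc, ← Int.cast_smul_eq_zsmul k,
        TensorProduct.tmul_smul, smul_smul]
      congr 1
      ring

/-- Auxiliary for `coprod`: the operator `(b, t) ↦ (v b, v ⊗ b + v t)`. -/
def coprodAux : g →ₗ[k] Module.End k (Sym 𝒢 × (g ⊗[k] Sym 𝒢)) where
  toFun v := LinearMap.prod (LinearMap.mul k (Sym 𝒢) (gen 𝒢 v) ∘ₗ LinearMap.fst k _ _)
    (TensorProduct.mk k g (Sym 𝒢) v ∘ₗ LinearMap.fst k _ _ +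
      tensorMul 𝒢 v ∘ₗ LinearMap.snd k _ _)
  map_add' v w := by
    ext <;> simp
  map_smul' c v := by
    ext <;> simp [TensorProduct.smul_tmul']

theorem coprodAux_swap (p q : ℤ) (x y : g) (hx : x ∈ shift 𝒢 (-1) p)
    (hy : y ∈ shift 𝒢 (-1) q) :
    coprodAux 𝒢 x * coprodAux 𝒢 y = (p * q).negOnePow • (coprodAux 𝒢 y * coprodAux 𝒢 x) := by
  refine LinearMap.ext fun ⟨b, t⟩ => ?_
  have e : ((p * q).negOnePow : ℤ) * ((p * q).negOnePow : ℤ) = 1 := by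
    rw [← Units.val_mul]; simp
  have h (v : g) (c : Sym 𝒢 × (g ⊗[k] Sym 𝒢)) :
      coprodAux 𝒢 v c = (gen 𝒢 v * c.1, v ⊗ₜ c.1 + tensorMul 𝒢 v c.2) := rfl
  simp only [Units.smul_def, Module.End.mul_apply, LinearMap.smul_apply, h, map_add]
  rw [tensorMul_swap 𝒢 hx hy, tensorMul_tmul 𝒢 hx hy, tensorMul_tmul 𝒢 hy hx, ← mul_assoc,
    ← mul_assoc, gen_swap 𝒢 hx hy, mul_comm q p]
  refine Prod.ext ?_ ?_
  · simp only [Prod.smul_mk, Units.smul_def, smul_mul_assoc]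
  · simp only [Prod.smul_mk, Units.smul_def, smul_add, smul_smul, e, one_smul]
    abel

/-- The comultiplication of `S (g[-1])` followed by the projection to the cogenerators in the
first tensor factor: `x₁ ⋯ xₙ ↦ ∑ᵢ ± xᵢ ⊗ x₁ ⋯ x̂ᵢ ⋯ xₙ` with Koszul signs.  It is the linear map
`δ` with `δ 1 = 0` and `δ (v a) = v ⊗ a + v δ(a)` for `v ∈ g[-1]`, where `v` acts on
`g[-1] ⊗ S (g[-1])` by `v (x ⊗ a) = (-1)^(|v| |x|) x ⊗ v a`. -/
def coprod : Sym 𝒢 →ₗ[k] g ⊗[k] Sym 𝒢 :=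
  LinearMap.snd k _ _ ∘ₗ LinearMap.applyₗ ((1 : Sym 𝒢), (0 : g ⊗[k] Sym 𝒢)) ∘ₗ
    (symLift 𝒢 (coprodAux 𝒢) (coprodAux_swap 𝒢)).toLinearMap

/-- The pairing `(h, x ⊗ b) ↦ h(x) b`. -/
def pairing : (g →ₗ[k] Sym 𝒢) →ₗ[k] g ⊗[k] Sym 𝒢 →ₗ[k] Sym 𝒢 :=
  LinearMap.mk₂ k (fun h t => TensorProduct.lift (LinearMap.mul k (Sym 𝒢) ∘ₗ h) t)
    (by
      intro h h' t
      induction t using TensorProduct.induction_on with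
      | zero => simp
      | add s t hs ht => rw [map_add, map_add, map_add, hs, ht]; abel
      | tmul x a => simp)
    (by
      intro c h t
      induction t using TensorProduct.induction_on with
      | zero => simp
      | add s t hs ht => rw [map_add, map_add, hs, ht, smul_add]
      | tmul x a => simp)
    (by simp) (by simp)

/-! ### The brackets of `g` extended as multiderivations -/

/-- Multilinear maps from `n` copies of `g[1]` to `S (g[-1])`. -/
abbrev Mult (n : ℕ) : Type (max u v) := MultilinearMap k (fun _ : Fin n => g) (Sym 𝒢)

/-- For homogeneous `x₁, …, xₙ` with degrees `d` in `g[1]`,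
`twist s F (x₁, …, xₙ) = s(d) F (x₁, …, xₙ)`, where the sign `s(d)` depends only on the parities
of the degrees. -/
def twist {n : ℕ} (s : (Fin n → ℤ) → ℤˣ) (F : Mult 𝒢 n) : Mult 𝒢 n :=
  ∑ e : Fin n → Fin 2, s (fun i => ((e i : ℕ) : ℤ)) • F.compLinearMap (fun i => par 𝒢 (e i))

/-- `F (-, x₁, …, xₙ)` as a linear map in the first variable. -/
def firstArg {n : ℕ} (F : Mult 𝒢 (n + 1)) :
    MultilinearMap k (fun _ : Fin n => g) (g →ₗ[k] Sym 𝒢) where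
  toFun x :=
    { toFun := fun y => F.curryLeft y x
      map_add' := by simp
      map_smul' := by simp }
  map_update_add' := by intro _ x i y z; ext; simp [-MultilinearMap.curryLeft_apply]; rfl
  map_update_smul' := by intro _ x i c y; ext; simp [-MultilinearMap.curryLeft_apply]; rfl

/-- Insertion of `a ∈ S (g[-1])` in the first slot of `F`, extended as a derivation in it:
`(x₁, …, xₙ) ↦ F (a, x₁, …, xₙ) = ∑ (-1)^(|a₂| (|x₁| + ⋯ + |xₙ|)) F (a₁, x₁, …, xₙ) a₂`, where
`∑ a₁ ⊗ a₂ = coprod a`. -/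
def insertArg (n : ℕ) : Sym 𝒢 →ₗ[k] Mult 𝒢 (n + 1) →ₗ[k] Mult 𝒢 n :=
  LinearMap.mk₂ k
    (fun a F => ∑ e : Fin n → Fin 2,
      (((pairing 𝒢).flip (LinearMap.lTensor g
        ((symInv 𝒢) ^ (∑ i, (e i : ℕ))).toLinearMap (coprod 𝒢 a))).compMultilinearMap
          (firstArg 𝒢 F)).compLinearMap (fun i => par 𝒢 (e i)))
    (by intro a b F; ext x; simp [Finset.sum_add_distrib])
    (by intro c a F; ext x; simp [Finset.smul_sum])
    (by
      intro a F G; ext x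
      simp only [sum_apply, add_apply, ← Finset.sum_add_distrib]
      refine Finset.sum_congr rfl fun e _ => ?_
      simp only [MultilinearMap.compLinearMap_apply, LinearMap.compMultilinearMap_apply,
        ← map_add]
      rfl)
    (by
      intro c a F; ext x
      simp only [sum_apply, smul_apply, Finset.smul_sum]
      refine Finset.sum_congr rfl fun e _ => ?_
      simp only [MultilinearMap.compLinearMap_apply, LinearMap.compMultilinearMap_apply,
        ← map_smul]
      rfl)

/-- The extension of `F : S^n (g[1]) → S (g[-1])[2]` to a multiderivation of `S (g[-1])`:
`(a, …, c) ↦ ∑ ± F (a₁, …, c₁) a₂ ⋯ c₂`, with Koszul signs. -/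
def ext : ∀ n : ℕ, Mult 𝒢 n →ₗ[k] MultilinearMap k (fun _ : Fin n => Sym 𝒢) (Sym 𝒢)
  | 0 =>
    { toFun := fun F => MultilinearMap.constOfIsEmpty k _ (F Fin.elim0)
      map_add' := fun _ _ => rfl
      map_smul' := fun _ _ => rfl }
  | n + 1 =>
    { toFun := fun F => LinearMap.uncurryLeft (ext n ∘ₗ (insertArg 𝒢 n).flip F)
      map_add' := by intro F G; ext x; simp
      map_smul' := by intro c F; ext x; simp }

variable (l : ∀ n : ℕ, MultilinearMap k (fun _ : Fin n => g) g)

/-- The brackets of `g`, with values in `S (g[-1])`, extended as multiderivations of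
`S (g[-1])`. -/
def symBracket (n : ℕ) : MultilinearMap k (fun _ : Fin n => Sym 𝒢) (Sym 𝒢) :=
  ext 𝒢 n ((gen 𝒢).compMultilinearMap (l n))

/-- The brackets of `Ŝ (g[-1])[1]`, the extension of `symBracket` to the completion: the bracket of
components in `S^(ν₁ + 1), …, S^(νₙ + 1)` lies in `S^(ν₁ + ⋯ + νₙ + 1)`, and the bracket vanishes if
one of the entries is in `S^0`. -/
def hatBracket (n : ℕ) : MultilinearMap k (fun _ : Fin n => ℕ → Sym 𝒢) (ℕ → Sym 𝒢) :=
  MultilinearMap.pi fun q => match q with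
    | 0 => 0
    | q + 1 => ∑ ν ∈ Finset.Nat.antidiagonalTuple n q,
        (symBracket 𝒢 l n).compLinearMap fun i => LinearMap.proj (ν i + 1)

/-- The maps `L n` are graded symmetric multiderivations of degree one of `S (g[-1])` (with
respect to the degree in `S (g[-1])[2]`) which extend the brackets `l n`. -/
structure IsMultiderivationExtension
    (L : ∀ n : ℕ, MultilinearMap k (fun _ : Fin n => Sym 𝒢) (Sym 𝒢)) : Prop where
  extends_bracket : ∀ n x, L n (fun i => gen 𝒢 (x i)) = gen 𝒢 (l n x)
  symm : ∀ n, IsGradedSymm (shift (symDeg 𝒢) 2) (L n)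
  degree : ∀ (n : ℕ) (d : Fin n → ℤ) (a : Fin n → Sym 𝒢),
    (∀ i, a i ∈ shift (symDeg 𝒢) 2 (d i)) → L n a ∈ shift (symDeg 𝒢) 2 (∑ i, d i + 1)
  leibniz : ∀ (n : ℕ) (d : Fin n → ℤ) (a : Fin n → Sym 𝒢) (p : ℤ) (b c : Sym 𝒢),
    (∀ i, a i ∈ shift (symDeg 𝒢) 2 (d i)) → b ∈ symDeg 𝒢 p →
    L (n + 1) (Fin.snoc (α := fun _ => Sym 𝒢) a (b * c)) =
      L (n + 1) (Fin.snoc (α := fun _ => Sym 𝒢) a b) * c +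
      (p * (1 + ∑ i, d i)).negOnePow • (b * L (n + 1) (Fin.snoc (α := fun _ => Sym 𝒢) a c))

/-! ### The big bracket -/

/-- The space that contains `∏_{m, n} Hom (S^m (g[1]), S^n (g[-1]))[2]`; the component with
indices `m, n` of `f` is `f m n`. -/
abbrev Big : Type (max u v) := ∀ m _n : ℕ, Mult 𝒢 m

/-- The elements of degree `e` of `ℬ⁺ = ∏_{m, n ≥ 1} Hom (S^m (g[1]), S^n (g[-1]))[2]`. -/
def bigPlus (e : ℤ) : Submodule k (Big 𝒢) where
  carrier := {f | ∀ m n : ℕ, ((m = 0 ∨ n = 0) → f m n = 0) ∧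
    IsGradedSymm (shift 𝒢 1) (f m n) ∧
    ∀ (d : Fin m → ℤ) (x : Fin m → g), (∀ i, x i ∈ shift 𝒢 1 (d i)) →
      f m n x ∈ symPart 𝒢 n (2 + (∑ i, d i + e))}
  add_mem' := by
    intro f f' hf hf' m n
    refine ⟨fun h => ?_, fun d x hx i j hij => ?_, fun d x hx => ?_⟩
    · simp [(hf m n).1 h, (hf' m n).1 h]
    · simp [(hf m n).2.1 d x hx i j hij, (hf' m n).2.1 d x hx i j hij]
    · exact add_mem ((hf m n).2.2 d x hx) ((hf' m n).2.2 d x hx)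
  zero_mem' := by
    intro m n
    refine ⟨fun h => rfl, fun d x hx i j hij => ?_, fun d x hx => zero_mem _⟩
    simp
  smul_mem' := by
    intro c f hf m n
    refine ⟨fun h => ?_, fun d x hx i j hij => ?_, fun d x hx => ?_⟩
    · simp [(hf m n).1 h]
    · simp [(hf m n).2.1 d x hx i j hij, smul_comm c]
    · exact Submodule.smul_mem _ c ((hf m n).2.2 d x hx)

/-- `x ↦ F (x_S, G (x_{Sᶜ})₁) G (x_{Sᶜ})₂`, where `∑ G₁ ⊗ G₂ = coprod G`. -/
def circTerm {n : ℕ} (S : Finset (Fin n)) :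
    Mult 𝒢 (S.card + 1) →ₗ[k] Mult 𝒢 Sᶜ.card →ₗ[k] Mult 𝒢 n :=
  LinearMap.mk₂ k
    (fun F G => (MultilinearMap.curryFinFinset k (Sym 𝒢) g rfl rfl).symm
      (LinearMap.compMultilinearMap
        { toFun := fun h => (pairing 𝒢 h ∘ₗ coprod 𝒢).compMultilinearMap G
          map_add' := by intro h h'; ext x; simp
          map_smul' := by intro c h; ext x; simp } F.curryRight))
    (by
      intro F F' G; ext x
      have h : ∀ u, (F + F').curryRight u = F.curryRight u + F'.curryRight u := fun _ => rfl
      simp [h])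
    (by
      intro c F G; ext x
      have h : ∀ u, (c • F).curryRight u = c • F.curryRight u := fun _ => rfl
      simp [h])
    (by intro F G G'; ext x; simp)
    (by intro c F G; ext x; simp)

/-- The circle product `f ∘ h` for `h` of degree `e`:
`(f ∘ h)(x₁ ⋯ xₘ) = ∑ ± f (x_S h(x_{Sᶜ})₁) h(x_{Sᶜ})₂`, the sum over all unshuffles, with the Koszul
sign of the unshuffle and the sign of the exchange of `h` and `x_S`. -/
def circ (e : ℤ) : Big 𝒢 →ₗ[k] Big 𝒢 →ₗ[k] Big 𝒢 :=
  LinearMap.mk₂ k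
    (fun f h m n => ∑ S : Finset (Fin m), ∑ ab ∈ Finset.HasAntidiagonal.antidiagonal (n + 1),
      twist 𝒢 (fun d => koszul d S * (e * ∑ i ∈ S, d i).negOnePow)
        (circTerm 𝒢 S (f (S.card + 1) ab.1) (h Sᶜ.card ab.2)))
    (by
      intro f f' h; funext m n; ext x
      simp [twist, Finset.sum_add_distrib])
    (by
      intro c f h; funext m n; ext x
      simp [twist, Finset.smul_sum, smul_comm c])
    (by
      intro f h h'; funext m n; ext x
      simp [twist, Finset.sum_add_distrib])
    (by
      intro c f h; funext m n; ext x
      simp [twist, Finset.smul_sum, smul_comm c])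

/-- The big bracket `[f, h] = f ∘ h - (-1)^(a b) h ∘ f` of `f` of degree `a` and `h` of
degree `b`. -/
def bigBracket (a b : ℤ) : Big 𝒢 →ₗ[k] Big 𝒢 →ₗ[k] Big 𝒢 :=
  LinearMap.mk₂ k (fun f h => circ 𝒢 b f h - (a * b).negOnePow • circ 𝒢 a h f)
    (by intro f f' h; simp only [map_add, LinearMap.add_apply, smul_add]; abel)
    (by intro c f h; simp only [map_smul, LinearMap.smul_apply, smul_sub, smul_comm c])
    (by intro f h h'; simp only [map_add, LinearMap.add_apply, smul_add]; abel)
    (by intro c f h; simp only [map_smul, LinearMap.smul_apply, smul_sub, smul_comm c])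

/-- The element `l₁ + l₂ + ⋯` of `ℬ⁺`. -/
def bigElement : Big 𝒢 := fun m n => if n = 1 then (gen 𝒢).compMultilinearMap (l m) else 0

/-- The differential `[l₁ + l₂ + ⋯, -]` on elements of degree `a`. -/
def bigD (a : ℤ) : Big 𝒢 →ₗ[k] Big 𝒢 := bigBracket 𝒢 1 a (bigElement 𝒢 l)

/-- The maps `φₙ (x₁ ⊙ ⋯ ⊙ xₙ)(y) = l_{n+p} (x₁ ⊙ ⋯ ⊙ xₙ ⊙ N(y))`, `y ∈ S^p (g[1])`, `p ≥ 1`, where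
`N (y₁ ⋯ yₚ) = y₁ ⊙ ⋯ ⊙ yₚ` (and no component for `p = 0`). -/
def phi (n : ℕ) : MultilinearMap k (fun _ : Fin n => ℕ → Sym 𝒢) (Big 𝒢) :=
  MultilinearMap.pi fun p => MultilinearMap.pi fun q =>
    if p = 0 then 0 else
      ((LinearMap.proj q : (ℕ → Sym 𝒢) →ₗ[k] Sym 𝒢).compMultilinearMapₗ k ∘ₗ
        MultilinearMap.compLinearMapₗ (fun _ : Fin p => hatGen 𝒢)).compMultilinearMap
          ((hatBracket 𝒢 l (n + p)).domDomCongr finSumFinEquiv.symm).currySum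

theorem phi_apply (n : ℕ) (x : Fin n → ℕ → Sym 𝒢) (p q : ℕ) (hp : p ≠ 0) (y : Fin p → g) :
    phi 𝒢 l n x p q y =
      hatBracket 𝒢 l (n + p) (Fin.append x (fun i => hatGen 𝒢 (y i))) q := by
  have h : Sum.elim x (fun i => hatGen 𝒢 (y i)) ∘ finSumFinEquiv.symm =
      Fin.append x (fun i => hatGen 𝒢 (y i)) := by
    funext i
    refine Fin.addCases (fun j => ?_) (fun j => ?_) i <;> simp
  rw [← h]
  simp [phi, hp]
  rfl

/-! ### `r_∞`-matrices and `L_∞`-bialgebras -/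

/-- The power series `r = ∑ λ^i r_i` is an `r_∞`-matrix: an element of degree one of
`λ Ŝ (g[-1])[1][[λ]]` with `l₁(r) + (1/2!) l₂(r ⊙ r) + (1/3!) l₃(r ⊙ r ⊙ r) + ⋯ = 0`. -/
def IsRInfinityMatrix (r : ℕ → ℕ → Sym 𝒢) : Prop :=
  r 0 = 0 ∧ (∀ i, r i ∈ shift (hatDeg 𝒢) 1 1) ∧ ∀ N, expSeries (hatBracket 𝒢 l) r N = 0

/-- The power series `μ = ∑ λ^i μ_i` of elements of degree one of `ℬ⁺` satisfies `[μ, μ] = 0`: it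
is an `L_∞`-bialgebra structure, depending on `λ`. -/
def IsLInfinityBialgebra (μ : ℕ → Big 𝒢) : Prop :=
  (∀ i, μ i ∈ bigPlus 𝒢 1) ∧
    ∀ N, ∑ ij ∈ Finset.HasAntidiagonal.antidiagonal N,
      bigBracket 𝒢 1 1 (μ ij.1) (μ ij.2) = 0

/-- The power series `μ' = φ (e^r) = φ₁(r) + (1/2!) φ₂(r ⊙ r) + ⋯`. -/
def transfer (r : ℕ → ℕ → Sym 𝒢) : ℕ → Big 𝒢 := expSeries (phi 𝒢 l) r

end Graded

end RInf

end

/-!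
The proof is a derived bracket argument. Elements of `Ŝ (g[-1])` are maps of arity zero, and they
form an abelian subalgebra of the graded Lie algebra defined by the big bracket on maps of all
arities; inserting `x` into a map is the right adjoint action of `x`. The brackets of `g` assemble
to an element `L = l₁ + l₂ + ⋯` with `[L, L] = 0`, and inserting `x₁, …, xₙ` into `L` gives a map
whose arity-zero part is `lₙ (x₁ ⊙ ⋯ ⊙ xₙ)` and whose part of positive arity is
`φₙ (x₁ ⊙ ⋯ ⊙ xₙ)`. Insert `x₁, …, xₙ` into `[L, L] = 0` by the Leibniz rule: the part of arity zero
is the higher Jacobi identity on `Ŝ (g[-1])`, the part of positive arity says that `φ` is an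
`L_∞`-morphism.

For a power series `r` of degree one, the exponential of the insertion of `r` preserves the bracket,
so the image of `L` still squares to zero. Its arity-zero part is `∑ lₙ (r ⊙ ⋯ ⊙ r) / n!`, which
vanishes for an `r_∞`-matrix; what remains is `φ (e^r) + L`.
-/

open scoped TensorProduct

noncomputable section

namespace RInf

universe u v w

/-! ### Signs and subsets of `Fin n` -/

section Combinatorics

theorem negOnePow_congr {a b : ℤ} (h : Even a ↔ Even b) : a.negOnePow = b.negOnePow := by
  rw [Int.negOnePow_eq_iff, Int.even_sub]
  exact h

/-- The subset `{i + 1 | i ∈ S}` of `{0, …, n}`. -/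
def succSet {n : ℕ} (S : Finset (Fin n)) : Finset (Fin (n + 1)) := S.map (Fin.succEmb n)

/-- The subset `{0} ∪ {i + 1 | i ∈ S}` of `{0, …, n}`. -/
def consSet {n : ℕ} (S : Finset (Fin n)) : Finset (Fin (n + 1)) := insert 0 (succSet S)

variable {n : ℕ} (S : Finset (Fin n))

@[simp] theorem succ_mem_succSet (i : Fin n) : i.succ ∈ succSet S ↔ i ∈ S := by
  simp [succSet]

@[simp] theorem zero_notMem_succSet : (0 : Fin (n + 1)) ∉ succSet S := by
  simp [succSet]

@[simp] theorem succ_mem_consSet (i : Fin n) : i.succ ∈ consSet S ↔ i ∈ S := by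
  simp [consSet]

@[simp] theorem zero_mem_consSet : (0 : Fin (n + 1)) ∈ consSet S := by
  simp [consSet]

@[simp] theorem compl_succSet : (succSet S)ᶜ = consSet Sᶜ := by
  ext i
  refine Fin.cases ?_ (fun i => ?_) i <;> simp

@[simp] theorem compl_consSet : (consSet S)ᶜ = succSet Sᶜ := by
  ext i
  refine Fin.cases ?_ (fun i => ?_) i <;> simp

theorem card_succSet : (succSet S).card = S.card := by simp [succSet]

theorem card_consSet : (consSet S).card = S.card + 1 := by
  rw [consSet, Finset.card_insert_of_notMem (zero_notMem_succSet S), card_succSet]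

theorem eq_succSet_or_consSet (T : Finset (Fin (n + 1))) :
    ∃ S, T = succSet S ∨ T = consSet S := by
  refine ⟨Finset.univ.filter fun i => i.succ ∈ T, ?_⟩
  by_cases h : (0 : Fin (n + 1)) ∈ T
  · right
    ext i
    refine Fin.cases ?_ (fun i => ?_) i <;> simp [h]
  · left
    ext i
    refine Fin.cases ?_ (fun i => ?_) i <;> simp [h]

theorem succSet_injective : Function.Injective (succSet (n := n)) := by
  intro S T h
  ext i
  rw [← succ_mem_succSet, h, succ_mem_succSet]

theorem consSet_injective : Function.Injective (consSet (n := n)) := by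
  intro S T h
  ext i
  rw [← succ_mem_consSet, h, succ_mem_consSet]

theorem sum_finset_fin_succ {A : Type*} [AddCommMonoid A] (Q : Finset (Fin (n + 1)) → A) :
    ∑ T, Q T = ∑ S, Q (consSet S) + ∑ S, Q (succSet S) := by
  rw [← Finset.sum_image (f := Q) (fun _ _ _ _ h => consSet_injective h),
    ← Finset.sum_image (f := Q) (fun _ _ _ _ h => succSet_injective h), ← Finset.sum_union]
  · congr 1
    ext T
    obtain ⟨S, rfl | rfl⟩ := eq_succSet_or_consSet T <;> simp
  · rw [Finset.disjoint_left]
    rintro _ h h'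
    simp only [Finset.mem_image, Finset.mem_univ, true_and] at h h'
    obtain ⟨S, rfl⟩ := h
    obtain ⟨T, hT⟩ := h'
    exact zero_notMem_succSet T (hT ▸ zero_mem_consSet S)

theorem sum_succSet {A : Type*} [AddCommMonoid A] (d : Fin (n + 1) → A) :
    ∑ i ∈ succSet S, d i = ∑ i ∈ S, d i.succ := by
  simp [succSet]

theorem sum_consSet {A : Type*} [AddCommMonoid A] (d : Fin (n + 1) → A) :
    ∑ i ∈ consSet S, d i = d 0 + ∑ i ∈ S, d i.succ := by
  rw [consSet, Finset.sum_insert (zero_notMem_succSet S), sum_succSet]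

theorem koszul_consSet (d : Fin (n + 1) → ℤ) :
    koszul d (consSet S) = koszul (fun i => d i.succ) S := by
  unfold koszul
  rw [compl_consSet, consSet, Finset.prod_insert (zero_notMem_succSet S)]
  rw [Finset.filter_false_of_mem (by simp), Finset.prod_empty, one_mul, succSet,
    Finset.prod_map]
  refine Finset.prod_congr rfl fun i _ => ?_
  rw [succSet, Finset.filter_map, Finset.prod_map]
  simp [Function.comp_def]

theorem prod_negOnePow {ι : Type*} (S : Finset ι) (d : ι → ℤ) :
    ∏ i ∈ S, (d i).negOnePow = (∑ i ∈ S, d i).negOnePow := by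
  classical
  induction S using Finset.induction_on with
  | empty => simp
  | insert i S hi ih => rw [Finset.prod_insert hi, Finset.sum_insert hi, Int.negOnePow_add, ih]

theorem koszul_succSet (d : Fin (n + 1) → ℤ) :
    koszul d (succSet S) =
      koszul (fun i => d i.succ) S * (d 0 * ∑ i ∈ S, d i.succ).negOnePow := by
  unfold koszul
  rw [compl_succSet, consSet, Finset.mul_sum, ← prod_negOnePow, ← Finset.prod_mul_distrib,
    succSet, Finset.prod_map]
  refine Finset.prod_congr rfl fun i _ => ?_
  rw [Finset.filter_insert, if_pos (by simp),
    Finset.prod_insert (fun h => zero_notMem_succSet _ (Finset.mem_filter.1 h).1), succSet,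
    Finset.filter_map, Finset.prod_map, mul_comm]
  simp [Function.comp_def, mul_comm]

theorem koszul_fin_zero (d : Fin 0 → ℤ) (S : Finset (Fin 0)) : koszul d S = 1 := by
  simp [koszul, Finset.eq_empty_of_isEmpty S]

theorem koszul_compl {n : ℕ} (d : Fin n → ℤ) (T : Finset (Fin n)) :
    koszul d Tᶜ = koszul d T * ((∑ i ∈ T, d i) * ∑ i ∈ Tᶜ, d i).negOnePow := by
  induction n with
  | zero => simp [koszul_fin_zero, Finset.eq_empty_of_isEmpty T]
  | succ n ih =>
    obtain ⟨S, rfl | rfl⟩ := eq_succSet_or_consSet T <;>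
    · simp only [compl_succSet, compl_consSet, koszul_succSet, koszul_consSet, sum_consSet,
        sum_succSet, ih, mul_assoc, ← Int.negOnePow_add]
      congr 1
      apply negOnePow_congr
      simp only [Int.even_add, Int.even_mul]
      tauto

theorem koszul_empty (d : Fin n → ℤ) : koszul d ∅ = 1 := by simp [koszul]

theorem koszul_univ (d : Fin n → ℤ) : koszul d Finset.univ = 1 := by simp [koszul]

variable {E : Type*}

theorem apply_sub {M : Type*} (P : ∀ n : ℕ, (Fin n → E) → M) {N : ℕ} (x : Fin n → E)
    (f : Fin N → Fin n) (hf : StrictMono f) (hS : ∀ i, f i ∈ S) (hN : S.card = N) :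
    P S.card (sub x S) = P N (x ∘ f) := by
  subst hN
  rw [Finset.orderEmbOfFin_unique rfl hS hf]
  rfl

theorem apply_sub_succSet {M : Type*} (P : ∀ n : ℕ, (Fin n → E) → M) (x : Fin (n + 1) → E) :
    P (succSet S).card (sub x (succSet S)) = P S.card (sub (fun i => x i.succ) S) := by
  rw [apply_sub (succSet S) P x (fun i => (S.orderEmbOfFin rfl i).succ) _ _ (card_succSet S)]
  · rfl
  · exact fun i j h => Fin.succ_lt_succ_iff.2 ((S.orderEmbOfFin rfl).strictMono h)
  · intro i
    simp

theorem apply_sub_consSet {M : Type*} (P : ∀ n : ℕ, (Fin n → E) → M) (x : Fin (n + 1) → E) :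
    P (consSet S).card (sub x (consSet S)) =
      P (S.card + 1) (Fin.cons (x 0) (sub (fun i => x i.succ) S)) := by
  rw [apply_sub (consSet S) P x (Fin.cons 0 fun i => (S.orderEmbOfFin rfl i).succ) _ _
    (card_consSet S)]
  · congr 1
    funext i
    refine Fin.cases ?_ (fun i => ?_) i <;> simp [sub]
  · intro i j
    refine Fin.cases ?_ (fun i => ?_) i <;> refine Fin.cases ?_ (fun j => ?_) j <;> simp
  · intro i
    refine Fin.cases ?_ (fun i => ?_) i <;> simp

theorem apply_sub_univ {M : Type*} (P : ∀ n : ℕ, (Fin n → E) → M) (x : Fin n → E) :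
    P (Finset.univ : Finset (Fin n)).card (sub x Finset.univ) = P n x := by
  rw [apply_sub Finset.univ P x id strictMono_id (by simp) (by simp)]
  rfl

theorem apply_sub_empty {M : Type*} (P : ∀ n : ℕ, (Fin n → E) → M) (x : Fin n → E) (z : Fin 0 → E) :
    P (∅ : Finset (Fin n)).card (sub x ∅) = P 0 z := by
  rw [apply_sub ∅ P x Fin.elim0 (fun i => i.elim0) (fun i => i.elim0) (by simp)]
  congr 1
  exact Subsingleton.elim _ _

theorem sub_mem_of_mem {k : Type*} [Field k] {E : Type*} [AddCommGroup E] [Module k E]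
    {𝒱 : ℤ → Submodule k E} {d : Fin n → ℤ} {x : Fin n → E} (hx : ∀ i, x i ∈ 𝒱 (d i)) (i) :
    sub x S i ∈ 𝒱 (sub d S i) := hx _

theorem sum_sub (d : Fin n → ℤ) : ∑ i, sub d S i = ∑ i ∈ S, d i := by
  conv_rhs => rw [← Finset.sum_coe_sort]
  exact Fintype.sum_equiv (S.orderIsoOfFin rfl).toEquiv _ _ (fun i => rfl)

end Combinatorics

/-! ### Iterated graded actions -/

section Iter

variable {k : Type*} [Ring k] {E M : Type*} [AddCommGroup M] [Module k M]

/-- The iterated action `x₁, …, xₙ, F ↦ xₙ ⋯ x₁ F` of the operators `act x`. -/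
def iter (act : E → M →ₗ[k] M) : ∀ n : ℕ, (Fin n → E) → M →ₗ[k] M
  | 0, _ => LinearMap.id
  | n + 1, x => iter act n (fun i => x i.succ) ∘ₗ act (x 0)

theorem iter_zero (act : E → M →ₗ[k] M) (x : Fin 0 → E) (F : M) : iter act 0 x F = F := rfl

theorem iter_succ (act : E → M →ₗ[k] M) {n : ℕ} (x : Fin (n + 1) → E) (F : M) :
    iter act (n + 1) x F = iter act n (fun i => x i.succ) (act (x 0) F) := rfl

theorem iter_cons (act : E → M →ₗ[k] M) {n : ℕ} (a : E) (x : Fin n → E) (F : M) :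
    iter act (n + 1) (Fin.cons a x) F = iter act n x (act a F) := by
  simp [iter_succ]

theorem iter_snoc (act : E → M →ₗ[k] M) {n : ℕ} (x : Fin n → E) (a : E) (F : M) :
    iter act (n + 1) (Fin.snoc (α := fun _ => E) x a) F = act a (iter act n x F) := by
  induction n generalizing F with
  | zero => simp [iter_succ, iter_zero, Fin.snoc]
  | succ n ih =>
    have h : Fin.snoc (α := fun _ => E) x a =
        Fin.cons (x 0) (Fin.snoc (α := fun _ => E) (fun i => x i.succ) a) := by
      rw [Fin.cons_snoc_eq_snoc_cons]
      congr 1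
      exact (Fin.cons_self_tail x).symm
    rw [h, iter_cons, ih, iter_succ]

theorem iter_append (act : E → M →ₗ[k] M) {n m : ℕ} (x : Fin n → E) (y : Fin m → E) (F : M) :
    iter act (n + m) (Fin.append x y) F = iter act m y (iter act n x F) := by
  induction m with
  | zero =>
    rw [Subsingleton.elim y Fin.elim0, Fin.append_elim0]
    rfl
  | succ m ih =>
    have h : y = Fin.snoc (α := fun _ => E) (Fin.init y) (y (Fin.last m)) := by simp
    rw [h, iter_snoc, ← ih, Fin.append_snoc]
    exact iter_snoc act _ _ _

variable [AddCommGroup E] [Module k E]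

/-- The operators `act a` for homogeneous `a` commute in the graded sense on the homogeneous
elements of `M`. -/
structure GradedAction (𝒱 : ℤ → Submodule k E) (ℳ : ℤ → Submodule k M)
    (act : E → M →ₗ[k] M) : Prop where
  mem : ∀ {e p a F}, F ∈ ℳ e → a ∈ 𝒱 p → act a F ∈ ℳ (e + p)
  swap : ∀ {e p q a b F}, F ∈ ℳ e → a ∈ 𝒱 p → b ∈ 𝒱 q →
    act b (act a F) = (p * q).negOnePow • act a (act b F)

namespace GradedAction

variable {𝒱 : ℤ → Submodule k E} {ℳ : ℤ → Submodule k M} {act : E → M →ₗ[k] M}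

theorem iter_mem (h : GradedAction 𝒱 ℳ act) {n : ℕ} {d : Fin n → ℤ} {x : Fin n → E}
    (hx : ∀ i, x i ∈ 𝒱 (d i)) {e : ℤ} {F : M} (hF : F ∈ ℳ e) :
    iter act n x F ∈ ℳ (e + ∑ i, d i) := by
  induction n generalizing e F with
  | zero => simpa [iter_zero] using hF
  | succ n ih =>
    rw [Fin.sum_univ_succ, ← add_assoc]
    exact ih (fun i => hx i.succ) (h.mem hF (hx 0))

theorem act_iter (h : GradedAction 𝒱 ℳ act) {n : ℕ} {d : Fin n → ℤ} {x : Fin n → E}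
    (hx : ∀ i, x i ∈ 𝒱 (d i)) {e q : ℤ} {F : M} (hF : F ∈ ℳ e) {b : E} (hb : b ∈ 𝒱 q) :
    act b (iter act n x F) = (q * ∑ i, d i).negOnePow • iter act n x (act b F) := by
  induction n generalizing e F with
  | zero => simp [iter_zero]
  | succ n ih =>
    rw [iter_succ, iter_succ, ih (fun i => hx i.succ) (h.mem hF (hx 0)), h.swap hF (hx 0) hb,
      LinearMap.map_smul_of_tower, smul_smul, ← Int.negOnePow_add, Fin.sum_univ_succ]
    congr 2
    ring

theorem iter_swap (h : GradedAction 𝒱 ℳ act) {n : ℕ} {d : Fin n → ℤ} {x : Fin n → E}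
    (hx : ∀ i, x i ∈ 𝒱 (d i)) {e : ℤ} {F : M} (hF : F ∈ ℳ e) {i j : Fin n}
    (hij : (i : ℕ) + 1 = j) :
    iter act n (x ∘ Equiv.swap i j) F = (d i * d j).negOnePow • iter act n x F := by
  induction n generalizing e F with
  | zero => exact i.elim0
  | succ n ih =>
    obtain ⟨a, x, rfl⟩ : ∃ a x', x = Matrix.vecCons a x' := ⟨_, _, (Matrix.cons_head_tail x).symm⟩
    obtain ⟨j, rfl⟩ : ∃ j', j = Fin.succ j' :=
      ⟨_, (Fin.succ_pred j (by rintro rfl; simp at hij)).symm⟩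
    rcases Fin.eq_zero_or_eq_succ i with rfl | ⟨i, rfl⟩
    · obtain ⟨n, rfl⟩ : ∃ m, n = m + 1 := ⟨n - 1, by have := j.pos; omega⟩
      obtain rfl : j = 0 := Fin.ext (by simpa using hij.symm)
      obtain ⟨b, x, rfl⟩ : ∃ b x', x = Matrix.vecCons b x' := ⟨_, _, (Matrix.cons_head_tail x).symm⟩
      have ha : a ∈ 𝒱 (d 0) := hx 0
      have hb : b ∈ 𝒱 (d 1) := hx 1
      rw [Fin.succ_zero_eq_one, Matrix.cons_cons_comp_swap_zero_one]
      simp only [Matrix.vecCons, iter_cons]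
      rw [h.swap hF hb ha, LinearMap.map_smul_of_tower, mul_comm]
    · rw [← Matrix.cons_swap]
      exact ih (fun i => hx i.succ) (h.mem hF (hx 0)) (by simpa using hij)

end GradedAction

end Iter

/-! ### The graded symmetric algebra -/

section SymmetricAlgebra

variable {k : Type u} [Field k] {g : Type v} [AddCommGroup g] [Module k g]
  {𝒢 : ℤ → Submodule k g}

theorem mem_shift_one {p : ℤ} {y : g} : y ∈ shift 𝒢 1 p ↔ y ∈ shift 𝒢 (-1) (2 + p) := by
  have : (1 : ℤ) + p = -1 + (2 + p) := by ring
  simp only [shift, this]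

theorem one_mem_symPart : (1 : Sym 𝒢) ∈ symPart 𝒢 0 0 :=
  Submodule.subset_span ⟨Fin.elim0, Fin.elim0, fun i => i.elim0, by simp, by simp⟩

theorem gen_mul_mem_symPart {n : ℕ} {p q : ℤ} {v : g} {a : Sym 𝒢} (hv : v ∈ shift 𝒢 (-1) p)
    (ha : a ∈ symPart 𝒢 n q) : gen 𝒢 v * a ∈ symPart 𝒢 (n + 1) (p + q) := by
  suffices h : symPart 𝒢 n q ≤
      (symPart 𝒢 (n + 1) (p + q)).comap (LinearMap.mulLeft k (gen 𝒢 v)) from h ha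
  rw [symPart, Submodule.span_le]
  rintro _ ⟨d, x, hx, rfl, rfl⟩
  refine Submodule.subset_span ⟨Fin.cons p d, Fin.cons v x, Fin.cases ?_ fun i => ?_, ?_, ?_⟩
  · simp [Fin.sum_univ_succ]
  · simp [List.ofFn_succ]
  · simpa using hv
  · simpa using hx i

theorem symPart_induction {C : ∀ (n : ℕ) (p : ℤ) (a : Sym 𝒢), a ∈ symPart 𝒢 n p → Prop}
    (one : C 0 0 1 one_mem_symPart)
    (mul : ∀ n p q v a (hv : v ∈ shift 𝒢 (-1) p) (ha : a ∈ symPart 𝒢 n q), C n q a ha →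
      C (n + 1) (p + q) (gen 𝒢 v * a) (gen_mul_mem_symPart hv ha))
    (zero : ∀ n p, C n p 0 (zero_mem _))
    (add : ∀ n p a b ha hb, C n p a ha → C n p b hb → C n p (a + b) (add_mem ha hb))
    (smul : ∀ n p (c : k) a ha, C n p a ha → C n p (c • a) (Submodule.smul_mem _ c ha))
    {n : ℕ} {p : ℤ} {a : Sym 𝒢} (ha : a ∈ symPart 𝒢 n p) : C n p a ha := by
  have prod (n : ℕ) : ∀ (d : Fin n → ℤ) (x : Fin n → g) (hx : ∀ i, x i ∈ shift 𝒢 (-1) (d i)),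
      C n (∑ i, d i) (List.ofFn fun i => gen 𝒢 (x i)).prod
        (Submodule.subset_span ⟨d, x, hx, rfl, rfl⟩) := by
    induction n with
    | zero => intro d x _; simpa using one
    | succ n ih =>
      intro d x hx
      simp only [List.ofFn_succ, List.prod_cons, Fin.sum_univ_succ]
      exact mul _ _ _ _ _ (hx 0) _ (ih _ _ fun i => hx i.succ)
  induction ha using Submodule.span_induction with
  | mem a ha =>
    obtain ⟨d, x, hx, rfl, rfl⟩ := ha
    exact prod n d x hx
  | zero => exact zero n p
  | add a b ha hb iha ihb => exact add n p a b ha hb iha ihb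
  | smul c a ha ih => exact smul n p c a ha ih

theorem gen_mem_symPart {p : ℤ} {v : g} (hv : v ∈ shift 𝒢 (-1) p) :
    gen 𝒢 v ∈ symPart 𝒢 1 p := by
  simpa using gen_mul_mem_symPart hv one_mem_symPart

theorem mul_mem_symPart {m n : ℕ} {p q : ℤ} {a b : Sym 𝒢} (ha : a ∈ symPart 𝒢 m p)
    (hb : b ∈ symPart 𝒢 n q) : a * b ∈ symPart 𝒢 (m + n) (p + q) := by
  induction ha using symPart_induction with
  | one => simpa using hb
  | mul m p r v a hv _ h =>
    rw [mul_assoc, add_assoc p, add_right_comm m]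
    exact gen_mul_mem_symPart hv h
  | zero => simp
  | add m p a a' _ _ h h' => simpa only [add_mul] using add_mem h h'
  | smul m p c a _ h => simpa only [smul_mul_assoc] using Submodule.smul_mem _ c h

theorem symPart_le_symDeg (n : ℕ) (p : ℤ) : symPart 𝒢 n p ≤ symDeg 𝒢 p :=
  le_iSup (fun n => symPart 𝒢 n p) n

theorem gen_mul_mem_symDeg {p q : ℤ} {v : g} {a : Sym 𝒢} (hv : v ∈ shift 𝒢 (-1) p)
    (ha : a ∈ symDeg 𝒢 q) : gen 𝒢 v * a ∈ symDeg 𝒢 (p + q) := by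
  suffices h : symDeg 𝒢 q ≤ (symDeg 𝒢 (p + q)).comap (LinearMap.mulLeft k (gen 𝒢 v)) from h ha
  exact iSup_le fun n a ha => symPart_le_symDeg _ _ (gen_mul_mem_symPart hv ha)

theorem symDeg_induction {C : ∀ (p : ℤ) (a : Sym 𝒢), a ∈ symDeg 𝒢 p → Prop}
    (one : C 0 1 (symPart_le_symDeg _ _ one_mem_symPart))
    (mul : ∀ p q v a (hv : v ∈ shift 𝒢 (-1) p) (ha : a ∈ symDeg 𝒢 q), C q a ha →
      C (p + q) (gen 𝒢 v * a) (gen_mul_mem_symDeg hv ha))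
    (zero : ∀ p, C p 0 (zero_mem _))
    (add : ∀ p a b ha hb, C p a ha → C p b hb → C p (a + b) (add_mem ha hb))
    (smul : ∀ p (c : k) a ha, C p a ha → C p (c • a) (Submodule.smul_mem _ c ha))
    {p : ℤ} {a : Sym 𝒢} (ha : a ∈ symDeg 𝒢 p) : C p a ha := by
  induction ha using Submodule.iSup_induction' with
  | mem n a ha =>
    induction ha using symPart_induction with
    | one => exact one
    | mul _ p q v a hv ha ih => exact mul p q v a hv (symPart_le_symDeg _ _ ha) ih
    | zero _ p => exact zero p
    | add _ p a b _ _ iha ihb => exact add p a b _ _ iha ihb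
    | smul _ p c a _ ih => exact smul p c a _ ih
  | zero => exact zero p
  | add a b ha hb iha ihb => exact add p a b ha hb iha ihb

theorem mul_mem_symDeg {p q : ℤ} {a b : Sym 𝒢} (ha : a ∈ symDeg 𝒢 p)
    (hb : b ∈ symDeg 𝒢 q) : a * b ∈ symDeg 𝒢 (p + q) := by
  induction ha using symDeg_induction with
  | one => simpa using hb
  | mul p r v a hv _ h =>
    rw [mul_assoc, add_assoc]
    exact gen_mul_mem_symDeg hv h
  | zero => simp
  | add p a a' _ _ h h' => simpa only [add_mul] using add_mem h h'
  | smul p c a _ h => simpa only [smul_mul_assoc] using Submodule.smul_mem _ c h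

theorem gen_mul_comm {p q : ℤ} {v : g} {a : Sym 𝒢} (hv : v ∈ shift 𝒢 (-1) p)
    (ha : a ∈ symDeg 𝒢 q) : gen 𝒢 v * a = (p * q).negOnePow • (a * gen 𝒢 v) := by
  induction ha using symDeg_induction with
  | one => simp
  | mul r q w a hw _ h =>
    rw [← mul_assoc, gen_swap 𝒢 hv hw, smul_mul_assoc, mul_assoc, h, mul_smul_comm, smul_smul,
      ← Int.negOnePow_add, mul_add, mul_assoc]
  | zero => simp
  | add q a b _ _ ha hb => rw [mul_add, add_mul, ha, hb, smul_add]
  | smul q c a _ h => rw [mul_smul_comm, smul_mul_assoc, h, smul_comm]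

theorem symDeg_mul_comm {p q : ℤ} {a b : Sym 𝒢} (ha : a ∈ symDeg 𝒢 p) (hb : b ∈ symDeg 𝒢 q) :
    a * b = (p * q).negOnePow • (b * a) := by
  induction ha using symDeg_induction with
  | one => simp
  | mul r p w a hw _ h =>
    rw [mul_assoc, h, mul_smul_comm, ← mul_assoc, gen_mul_comm hw hb, smul_mul_assoc, smul_smul,
      ← Int.negOnePow_add, mul_assoc, add_mul, add_comm]
  | zero => simp
  | add q a b _ _ ha hb => rw [mul_add, add_mul, ha, hb, smul_add]
  | smul q c a _ h => rw [mul_smul_comm, smul_mul_assoc, h, smul_comm]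

theorem symLift_gen {R : Type*} [Ring R] [Algebra k R] (f : g →ₗ[k] R) (hf) (v : g) :
    symLift 𝒢 f hf (gen 𝒢 v) = f v := by
  refine (RingQuot.liftAlgHom_mkAlgHom_apply k (TensorAlgebra.lift k f) _ _).trans ?_
  simp

theorem sym_induction {C : Sym 𝒢 → Prop} (algebraMap : ∀ c : k, C (algebraMap k (Sym 𝒢) c))
    (gen : ∀ v, C (gen 𝒢 v)) (mul : ∀ a b, C a → C b → C (a * b))
    (add : ∀ a b, C a → C b → C (a + b)) (a : Sym 𝒢) : C a := by
  obtain ⟨t, rfl⟩ : ∃ t, symMk 𝒢 t = a := RingQuot.mkAlgHom_surjective k (SymRel 𝒢) a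
  induction t using TensorAlgebra.induction with
  | algebraMap c => rw [AlgHom.commutes]; exact algebraMap c
  | ι v => exact gen v
  | mul s t hs ht => rw [map_mul]; exact mul _ _ hs ht
  | add s t hs ht => rw [map_add]; exact add _ _ hs ht

theorem pairing_tmul (φ : g →ₗ[k] Sym 𝒢) (x : g) (b : Sym 𝒢) :
    pairing 𝒢 φ (x ⊗ₜ b) = φ x * b := by
  simp [pairing]

/-- The elements of degree `p` of `g[-1] ⊗ P`, for a family of subspaces `P` of `S (g[-1])`. -/
def tens (P : ℤ → Submodule k (Sym 𝒢)) (p : ℤ) : Submodule k (g ⊗[k] Sym 𝒢) :=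
  Submodule.span k {t | ∃ (q r : ℤ) (x : g) (b : Sym 𝒢), x ∈ shift 𝒢 (-1) q ∧ b ∈ P r ∧
    q + r = p ∧ t = x ⊗ₜ b}

theorem tmul_mem_tens {P : ℤ → Submodule k (Sym 𝒢)} {q r : ℤ} {x : g} {b : Sym 𝒢}
    (hx : x ∈ shift 𝒢 (-1) q) (hb : b ∈ P r) : x ⊗ₜ[k] b ∈ tens P (q + r) :=
  Submodule.subset_span ⟨q, r, x, b, hx, hb, rfl, rfl⟩

theorem tens_mono {P Q : ℤ → Submodule k (Sym 𝒢)} (h : ∀ p, P p ≤ Q p) (p : ℤ) :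
    tens P p ≤ tens Q p := by
  refine Submodule.span_mono ?_
  rintro _ ⟨q, r, x, b, hx, hb, e, rfl⟩
  exact ⟨q, r, x, b, hx, h _ hb, e, rfl⟩

/-- A linear map `g[-1] → S (g[-1])` of degree `c` with values in `P`. -/
def HasDegree (P : ℤ → Submodule k (Sym 𝒢)) (c : ℤ) (φ : g →ₗ[k] Sym 𝒢) : Prop :=
  ∀ q x, x ∈ shift 𝒢 (-1) q → φ x ∈ P (q + c)

theorem pairing_mem {P Q R : ℤ → Submodule k (Sym 𝒢)}
    (hmul : ∀ p q a b, a ∈ P p → b ∈ Q q → a * b ∈ R (p + q)) {c p : ℤ} {φ : g →ₗ[k] Sym 𝒢}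
    (hφ : HasDegree P c φ) {t : g ⊗[k] Sym 𝒢} (ht : t ∈ tens Q p) :
    pairing 𝒢 φ t ∈ R (p + c) := by
  suffices h : tens Q p ≤ (R (p + c)).comap (pairing 𝒢 φ) from h ht
  rw [tens, Submodule.span_le]
  rintro _ ⟨q, r, x, b, hx, hb, rfl, rfl⟩
  rw [SetLike.mem_coe, Submodule.mem_comap, pairing_tmul, add_right_comm]
  exact hmul _ _ _ _ (hφ _ _ hx) hb

variable [DirectSum.Decomposition 𝒢]

theorem homogeneous_induction {C : g → Prop} (zero : C 0)
    (hom : ∀ p x, x ∈ shift 𝒢 1 p → C x) (add : ∀ x y, C x → C y → C (x + y)) (x : g) : C x := by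
  induction x using DirectSum.Decomposition.inductionOn 𝒢 with
  | zero => exact zero
  | homogeneous x =>
    rename_i i
    exact hom (i - 1) _ (by simp [shift])
  | add x y hx hy => exact add x y hx hy

theorem coprod_one : coprod 𝒢 1 = 0 := by
  simp [coprod]

theorem symLift_coprodAux_fst (a : Sym 𝒢) (c : Sym 𝒢 × g ⊗[k] Sym 𝒢) :
    (symLift 𝒢 (coprodAux 𝒢) (coprodAux_swap 𝒢) a c).1 = a * c.1 := by
  induction a using sym_induction generalizing c with
  | algebraMap r => simp [Algebra.algebraMap_eq_smul_one]
  | gen v => rw [symLift_gen]; rfl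
  | mul a b ha hb => rw [map_mul, Module.End.mul_apply, ha, hb, mul_assoc]
  | add a b ha hb => rw [map_add, LinearMap.add_apply, Prod.fst_add, ha, hb, add_mul]

theorem coprod_gen_mul (v : g) (a : Sym 𝒢) :
    coprod 𝒢 (gen 𝒢 v * a) = v ⊗ₜ a + tensorMul 𝒢 v (coprod 𝒢 a) := by
  set A := symLift 𝒢 (coprodAux 𝒢) (coprodAux_swap 𝒢)
  calc coprod 𝒢 (gen 𝒢 v * a) = (coprodAux 𝒢 v (A a (1, 0))).2 := by
        rw [← symLift_gen (coprodAux 𝒢) (coprodAux_swap 𝒢) v]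
        simp [coprod, A]
    _ = v ⊗ₜ[k] (A a (1, 0)).1 + tensorMul 𝒢 v (A a (1, 0)).2 := rfl
    _ = v ⊗ₜ a + tensorMul 𝒢 v (coprod 𝒢 a) := by
        rw [symLift_coprodAux_fst, mul_one]
        rfl

theorem coprod_gen (v : g) : coprod 𝒢 (gen 𝒢 v) = v ⊗ₜ 1 := by
  simpa [coprod_one] using coprod_gen_mul v (1 : Sym 𝒢)

theorem tensorMul_mem_tens {P Q : ℤ → Submodule k (Sym 𝒢)} {p q : ℤ} {v : g}
    (hv : v ∈ shift 𝒢 (-1) p) (h : ∀ r b, b ∈ P r → gen 𝒢 v * b ∈ Q (p + r)) {t : g ⊗[k] Sym 𝒢}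
    (ht : t ∈ tens P q) : tensorMul 𝒢 v t ∈ tens Q (p + q) := by
  suffices h : tens P q ≤ (tens Q (p + q)).comap (tensorMul 𝒢 v) from h ht
  rw [tens, Submodule.span_le]
  rintro _ ⟨q, r, x, b, hx, hb, rfl, rfl⟩
  rw [SetLike.mem_coe, Submodule.mem_comap, tensorMul_tmul 𝒢 hv hx, add_left_comm]
  exact Submodule.smul_of_tower_mem _ _ (tmul_mem_tens hx (h _ _ hb))

theorem coprod_eq_zero_of_mem_symPart_zero {p : ℤ} {a : Sym 𝒢} (ha : a ∈ symPart 𝒢 0 p) :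
    coprod 𝒢 a = 0 := by
  suffices h : symPart 𝒢 0 p ≤ LinearMap.ker (coprod 𝒢) from h ha
  rw [symPart, Submodule.span_le]
  rintro _ ⟨d, x, -, -, rfl⟩
  simp [coprod_one]

theorem coprod_mem_tens_symPart {n : ℕ} {p : ℤ} {a : Sym 𝒢} (ha : a ∈ symPart 𝒢 (n + 1) p) :
    coprod 𝒢 a ∈ tens (symPart 𝒢 n) p := by
  generalize hm : n + 1 = m at ha
  induction ha using symPart_induction generalizing n with
  | one => simp at hm
  | mul m p q v a hv ha ih =>
    obtain rfl : n = m := by lia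
    rw [coprod_gen_mul]
    refine add_mem (tmul_mem_tens hv ha) ?_
    cases n with
    | zero => simp [coprod_eq_zero_of_mem_symPart_zero ha]
    | succ n => exact tensorMul_mem_tens hv (fun r b hb => gen_mul_mem_symPart hv hb) (ih rfl)
  | zero => simp
  | add m p a b _ _ iha ihb => simpa only [map_add] using add_mem (iha hm) (ihb hm)
  | smul m p c a _ ih => simpa only [map_smul] using Submodule.smul_mem _ c (ih hm)

theorem coprod_mem_tens_symDeg {p : ℤ} {a : Sym 𝒢} (ha : a ∈ symDeg 𝒢 p) :
    coprod 𝒢 a ∈ tens (symDeg 𝒢) p := by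
  suffices h : symDeg 𝒢 p ≤ (tens (symDeg 𝒢) p).comap (coprod 𝒢) from h ha
  refine iSup_le fun n a ha => ?_
  cases n with
  | zero => simp [coprod_eq_zero_of_mem_symPart_zero ha]
  | succ n => exact tens_mono (symPart_le_symDeg n) _ (coprod_mem_tens_symPart ha)

/-- The extension of a linear map `φ` on the generators to a derivation of `S (g[-1])`. -/
def der (φ : g →ₗ[k] Sym 𝒢) : Sym 𝒢 →ₗ[k] Sym 𝒢 := pairing 𝒢 φ ∘ₗ coprod 𝒢

theorem der_apply (φ : g →ₗ[k] Sym 𝒢) (a : Sym 𝒢) : der φ a = pairing 𝒢 φ (coprod 𝒢 a) := rfl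

theorem der_gen (φ : g →ₗ[k] Sym 𝒢) (v : g) : der φ (gen 𝒢 v) = φ v := by
  rw [der_apply, coprod_gen, pairing_tmul, mul_one]

theorem der_add (φ ψ : g →ₗ[k] Sym 𝒢) (a : Sym 𝒢) : der (φ + ψ) a = der φ a + der ψ a := by
  simp only [der_apply, map_add, LinearMap.add_apply]

theorem der_sub (φ ψ : g →ₗ[k] Sym 𝒢) (a : Sym 𝒢) : der (φ - ψ) a = der φ a - der ψ a := by
  simp only [der_apply, map_sub, LinearMap.sub_apply]

theorem der_units_smul (s : ℤˣ) (φ : g →ₗ[k] Sym 𝒢) (a : Sym 𝒢) :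
    der (s • φ) a = s • der φ a := by
  simp only [der_apply, LinearMap.map_smul_of_tower]
  rfl

theorem der_mem_symPart {m n : ℕ} {c p : ℤ} {φ : g →ₗ[k] Sym 𝒢} {a : Sym 𝒢}
    (hφ : HasDegree (symPart 𝒢 m) c φ) (ha : a ∈ symPart 𝒢 (n + 1) p) :
    der φ a ∈ symPart 𝒢 (m + n) (p + c) :=
  pairing_mem (fun _ _ _ _ => mul_mem_symPart) hφ (coprod_mem_tens_symPart ha)

theorem der_mem_symDeg {c p : ℤ} {φ : g →ₗ[k] Sym 𝒢} {a : Sym 𝒢}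
    (hφ : HasDegree (symDeg 𝒢) c φ) (ha : a ∈ symDeg 𝒢 p) : der φ a ∈ symDeg 𝒢 (p + c) :=
  pairing_mem (fun _ _ _ _ => mul_mem_symDeg) hφ (coprod_mem_tens_symDeg ha)

theorem der_gen_mul {c p : ℤ} {φ : g →ₗ[k] Sym 𝒢} (hφ : HasDegree (symDeg 𝒢) c φ) {v : g}
    (hv : v ∈ shift 𝒢 (-1) p) (a : Sym 𝒢) :
    der φ (gen 𝒢 v * a) = φ v * a + (c * p).negOnePow • (gen 𝒢 v * der φ a) := by
  rw [der_apply, coprod_gen_mul, map_add, pairing_tmul, der_apply]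
  congr 1
  induction coprod 𝒢 a using TensorProduct.induction_on with
  | zero => simp
  | add s t hs ht => simp only [map_add, mul_add, smul_add, hs, ht]
  | tmul x b =>
    induction x using homogeneous_induction (𝒢 := 𝒢) with
    | zero => simp
    | add x y hx hy => simp only [TensorProduct.add_tmul, map_add, mul_add, smul_add, hx, hy]
    | hom q x hx =>
      rw [mem_shift_one] at hx
      rw [tensorMul_tmul 𝒢 hv hx, LinearMap.map_smul_of_tower, pairing_tmul, pairing_tmul,
        ← mul_assoc, ← mul_assoc, gen_mul_comm hv (hφ _ _ hx), smul_mul_assoc, smul_smul,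
        ← Int.negOnePow_add]
      congr 1
      apply negOnePow_congr
      simp only [Int.even_add, Int.even_mul]
      tauto

theorem der_mul {c p : ℤ} {φ : g →ₗ[k] Sym 𝒢} (hφ : HasDegree (symDeg 𝒢) c φ) {a : Sym 𝒢}
    (ha : a ∈ symDeg 𝒢 p) (b : Sym 𝒢) :
    der φ (a * b) = der φ a * b + (c * p).negOnePow • (a * der φ b) := by
  induction ha using symDeg_induction with
  | one => simp [der_apply, coprod_one]
  | mul p q v a hv _ h =>
    rw [mul_assoc, der_gen_mul hφ hv, h, der_gen_mul hφ hv, mul_add, add_mul, smul_add,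
      mul_smul_comm, smul_mul_assoc, smul_smul, ← Int.negOnePow_add, ← mul_add]
    simp only [mul_assoc, add_assoc]
  | zero => simp
  | add p a a' _ _ h h' =>
    rw [add_mul, map_add, h, h', map_add, add_mul, add_mul, smul_add]
    abel
  | smul p r a _ h =>
    simp only [smul_mul_assoc, map_smul, h, smul_add, smul_comm _ r]

theorem HasDegree.der_comp {a b : ℤ} {φ ψ : g →ₗ[k] Sym 𝒢} (hφ : HasDegree (symDeg 𝒢) a φ)
    (hψ : HasDegree (symDeg 𝒢) b ψ) : HasDegree (symDeg 𝒢) (a + b) (der φ ∘ₗ ψ) := by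
  intro q x hx
  rw [add_comm a, ← add_assoc]
  exact der_mem_symDeg hφ (hψ _ _ hx)

theorem der_der {a b p : ℤ} {φ ψ : g →ₗ[k] Sym 𝒢} (hφ : HasDegree (symDeg 𝒢) a φ)
    (hψ : HasDegree (symDeg 𝒢) b ψ) {u : Sym 𝒢} (hu : u ∈ symDeg 𝒢 p) :
    der φ (der ψ u) - (a * b).negOnePow • der ψ (der φ u) =
      der (der φ ∘ₗ ψ - (a * b).negOnePow • (der ψ ∘ₗ φ)) u := by
  have hcomm : HasDegree (symDeg 𝒢) (a + b) (der φ ∘ₗ ψ - (a * b).negOnePow • (der ψ ∘ₗ φ)) :=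
    fun q x hx => sub_mem (hφ.der_comp hψ q x hx)
      (Submodule.smul_of_tower_mem _ (a * b).negOnePow (add_comm b a ▸ hψ.der_comp hφ q x hx))
  induction hu using symDeg_induction with
  | one => simp [der_apply, coprod_one]
  | mul p q v u hv hu h =>
    rw [der_gen_mul hcomm hv, ← h, der_gen_mul hφ hv, der_gen_mul hψ hv]
    simp only [map_add, LinearMap.map_smul_of_tower]
    rw [der_gen_mul hφ hv, der_gen_mul hψ hv, der_mul hφ (hψ _ _ hv), der_mul hψ (hφ _ _ hv)]
    simp only [LinearMap.sub_apply, LinearMap.smul_apply, LinearMap.comp_apply, mul_add, add_mul,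
      Int.negOnePow_add, mul_comm b a, sub_mul, mul_sub, smul_mul_assoc, mul_smul_comm]
    rcases Int.units_eq_one_or (a * b).negOnePow with h1 | h1 <;>
    rcases Int.units_eq_one_or (a * p).negOnePow with h2 | h2 <;>
    rcases Int.units_eq_one_or (b * p).negOnePow with h3 | h3 <;>
    · simp only [h1, h2, h3, one_smul, mul_one, Units.neg_smul, mul_neg, neg_neg]
      abel
  | zero => simp
  | add p u u' _ _ h h' =>
    simp only [map_add, smul_add, ← h, ← h']
    abel
  | smul _ c u _ h => simp only [map_smul, ← h, smul_comm _ c, smul_sub]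

end SymmetricAlgebra

/-! ### Families of multilinear maps and the circle product -/

section Families

variable {k : Type u} [Field k] {g : Type v} [AddCommGroup g] [Module k g]
  (𝒢 : ℤ → Submodule k g)

/-- Families of multilinear maps on `g` with values in `S (g[-1])`, one in each arity. -/
abbrev Fam : Type (max u v) := ∀ m : ℕ, Mult 𝒢 m

variable {𝒢}

/-- Insertion of `y` as the first argument. -/
def contract (y : g) : Fam 𝒢 →ₗ[k] Fam 𝒢 where
  toFun F m := (F (m + 1)).curryLeft y
  map_add' _ _ := rfl
  map_smul' _ _ := rfl

/-- The value of the member of arity zero. -/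
def ev0 : Fam 𝒢 →ₗ[k] Sym 𝒢 where
  toFun F := F 0 Fin.elim0
  map_add' _ _ := rfl
  map_smul' _ _ := rfl

/-- The member of arity one as a linear map. -/
def ev1 : Fam 𝒢 →ₗ[k] g →ₗ[k] Sym 𝒢 where
  toFun F :=
    { toFun := fun y => ev0 (contract y F)
      map_add' := fun y z => congrArg (fun f => f Fin.elim0) (map_add (F 1).curryLeft y z)
      map_smul' := fun c y => congrArg (fun f => f Fin.elim0) (map_smul (F 1).curryLeft c y) }
  map_add' _ _ := rfl
  map_smul' _ _ := rfl

/-- The member of arity two as a bilinear map. -/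
def ev2 (F : Fam 𝒢) : g →ₗ[k] g →ₗ[k] Sym 𝒢 where
  toFun y := ev1 (contract y F)
  map_add' y z := by
    rw [← map_add]
    exact congrArg ev1 (funext fun m => map_add (F (m + 1)).curryLeft y z)
  map_smul' c y := by
    rw [RingHom.id_apply, ← map_smul]
    exact congrArg ev1 (funext fun m => map_smul (F (m + 1)).curryLeft c y)

theorem ev1_apply (F : Fam 𝒢) (y : g) : ev1 F y = ev0 (contract y F) := rfl

theorem contract_apply (F : Fam 𝒢) (y : g) (m : ℕ) (x : Fin m → g) :
    contract y F m x = F (m + 1) (Fin.cons y x) := rfl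

theorem apply_eq_contract (F : Fam 𝒢) (m : ℕ) (x : Fin (m + 1) → g) :
    F (m + 1) x = contract (x 0) F m (fun i => x i.succ) := by
  rw [contract_apply]
  congr 1
  exact (Fin.cons_self_tail x).symm

theorem apply_eq_iter (F : Fam 𝒢) (m : ℕ) (x : Fin m → g) :
    F m x = ev0 (iter contract m x F) := by
  induction m generalizing F with
  | zero => rw [Subsingleton.elim x Fin.elim0]; rfl
  | succ m ih => rw [apply_eq_contract, ih]; rfl

theorem cons_mem {E : Type*} [AddCommGroup E] [Module k E] {𝒱 : ℤ → Submodule k E} {m : ℕ}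
    {p : ℤ} {y : E} (hy : y ∈ 𝒱 p) {d : Fin m → ℤ} {x : Fin m → E} (hx : ∀ i, x i ∈ 𝒱 (d i)) :
    ∀ i, (Fin.cons y x : Fin (m + 1) → E) i ∈ 𝒱 ((Fin.cons p d : Fin (m + 1) → ℤ) i) :=
  Fin.cases (by simpa using hy) fun i => by simpa using hx i

/-- The families of graded symmetric maps of degree `e` with values in `P`. -/
def famHom (P : ℤ → Submodule k (Sym 𝒢)) (e : ℤ) : Submodule k (Fam 𝒢) where
  carrier := {F | ∀ m, IsGradedSymm (shift 𝒢 1) (F m) ∧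
    ∀ (d : Fin m → ℤ) (x : Fin m → g), (∀ i, x i ∈ shift 𝒢 1 (d i)) →
      F m x ∈ P (2 + (∑ i, d i + e))}
  add_mem' := by
    intro f f' hf hf' m
    refine ⟨fun d x hx i j hij => ?_, fun d x hx => ?_⟩
    · simp [(hf m).1 d x hx i j hij, (hf' m).1 d x hx i j hij]
    · exact add_mem ((hf m).2 d x hx) ((hf' m).2 d x hx)
  zero_mem' := by
    intro m
    exact ⟨fun _ _ _ _ _ _ => by simp, fun _ _ _ => zero_mem _⟩
  smul_mem' := by
    intro c f hf m
    refine ⟨fun d x hx i j hij => ?_, fun d x hx => ?_⟩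
    · simp [(hf m).1 d x hx i j hij, smul_comm c]
    · exact Submodule.smul_mem _ c ((hf m).2 d x hx)

theorem famHom_mono {P Q : ℤ → Submodule k (Sym 𝒢)} (h : ∀ p, P p ≤ Q p) (e : ℤ) :
    famHom P e ≤ famHom Q e :=
  fun _ hF m => ⟨(hF m).1, fun d x hx => h _ ((hF m).2 d x hx)⟩

theorem ev0_mem {P : ℤ → Submodule k (Sym 𝒢)} {e : ℤ} {F : Fam 𝒢} (hF : F ∈ famHom P e) :
    ev0 F ∈ P (2 + e) := by
  have := (hF 0).2 Fin.elim0 Fin.elim0 (fun i => i.elim0)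
  rwa [Finset.univ_eq_empty, Finset.sum_empty, zero_add] at this

theorem cons_comp_swap_succ {α : Type*} {m : ℕ} (y : α) (x : Fin m → α) (i j : Fin m) :
    (Fin.cons y x : Fin (m + 1) → α) ∘ Equiv.swap i.succ j.succ =
      Fin.cons y (x ∘ Equiv.swap i j) := by
  funext l
  cases l using Fin.cases with
  | zero => simp [Equiv.swap_apply_of_ne_of_ne (Fin.succ_ne_zero _).symm (Fin.succ_ne_zero _).symm]
  | succ l =>
    have : Equiv.swap i.succ j.succ l.succ = (Equiv.swap i j l).succ :=
      ((Fin.succ_injective m).map_swap i j l).symm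
    simp [this]

theorem cons_cons_comp_swap {α : Type*} {m : ℕ} (y z : α) (x : Fin m → α) :
    (Fin.cons z (Fin.cons y x : Fin (m + 1) → α) : Fin (m + 2) → α) ∘ Equiv.swap 0 (Fin.succ 0) =
      Fin.cons y (Fin.cons z x : Fin (m + 1) → α) := by
  funext l
  cases l using Fin.cases with
  | zero => simp
  | succ l =>
    cases l using Fin.cases with
    | zero => simp [Equiv.swap_apply_right]
    | succ l =>
      rw [Function.comp_apply, Equiv.swap_apply_of_ne_of_ne (Fin.succ_ne_zero _)
        fun h => Fin.succ_ne_zero _ (Fin.succ_injective _ h)]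
      rfl

theorem contract_mem {P : ℤ → Submodule k (Sym 𝒢)} {e p : ℤ} {F : Fam 𝒢} (hF : F ∈ famHom P e)
    {y : g} (hy : y ∈ shift 𝒢 1 p) : contract y F ∈ famHom P (e + p) := by
  refine fun m => ⟨fun d x hx i j hij => ?_, fun d x hx => ?_⟩
  · have hsymm := (hF (m + 1)).1 _ _ (cons_mem hy hx) i.succ j.succ (by simpa using hij)
    rw [contract_apply, contract_apply]
    simpa only [cons_comp_swap_succ, Fin.cons_succ] using hsymm
  · have hdeg := (hF (m + 1)).2 _ _ (cons_mem hy hx)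
    rw [contract_apply]
    convert hdeg using 2
    rw [Fin.sum_univ_succ]
    simp only [Fin.cons_zero, Fin.cons_succ]
    ring

theorem le_famHom {P : ℤ → Submodule k (Sym 𝒢)} {ℳ : ℤ → Submodule k (Fam 𝒢)}
    (h : GradedAction (shift 𝒢 1) ℳ (contract (𝒢 := 𝒢))) (h0 : ∀ e F, F ∈ ℳ e → ev0 F ∈ P (2 + e))
    (e : ℤ) : ℳ e ≤ famHom P e := by
  intro F hF m
  refine ⟨fun d x hx i j hij => ?_, fun d x hx => ?_⟩
  · rw [apply_eq_iter, apply_eq_iter, h.iter_swap hx hF hij, LinearMap.map_smul_of_tower]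
  · rw [apply_eq_iter, add_comm _ e]
    exact h0 _ _ (h.iter_mem hx hF)

theorem ev1_hasDegree {P : ℤ → Submodule k (Sym 𝒢)} {e : ℤ} {F : Fam 𝒢} (hF : F ∈ famHom P e) :
    HasDegree P e (ev1 F) := by
  intro q x hx
  have hx' : x ∈ shift 𝒢 1 (q - 2) := by
    rw [mem_shift_one]
    simpa using hx
  have := ev0_mem (contract_mem hF hx')
  rw [ev1_apply]
  convert this using 2
  ring

variable [DirectSum.Decomposition 𝒢]

theorem mult_ext {m : ℕ} {A : Type*} [AddCommGroup A] [Module k A]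
    {F G : MultilinearMap k (fun _ : Fin m => g) A}
    (h : ∀ (d : Fin m → ℤ) (x : Fin m → g), (∀ i, x i ∈ shift 𝒢 1 (d i)) → F x = G x) :
    F = G := by
  induction m with
  | zero =>
    ext x
    exact h Fin.elim0 x (fun i => i.elim0)
  | succ m ih =>
    have key : ∀ y, F.curryLeft y = G.curryLeft y := by
      intro y
      induction y using homogeneous_induction (𝒢 := 𝒢) with
      | zero => rw [map_zero, map_zero]
      | add y z hy hz => rw [map_add, map_add, hy, hz]
      | hom p y hy =>
        exact ih fun d x hx => h (Fin.cons p d) (Fin.cons y x) (cons_mem hy hx)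
    ext x
    have := congrArg (fun f => f (Fin.tail x)) (key (x 0))
    simpa using this

theorem fam_apply_succ_eq_zero {F : Fam 𝒢} {m : ℕ}
    (h : ∀ p y, y ∈ shift 𝒢 1 p → contract y F m = 0) : F (m + 1) = 0 := by
  refine mult_ext (𝒢 := 𝒢) fun d x hx => ?_
  rw [apply_eq_contract, h _ _ (hx 0)]
  rfl

theorem contract_contract {P : ℤ → Submodule k (Sym 𝒢)} {e p q : ℤ} {F : Fam 𝒢}
    (hF : F ∈ famHom P e) {y z : g} (hy : y ∈ shift 𝒢 1 p) (hz : z ∈ shift 𝒢 1 q) :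
    contract z (contract y F) = (p * q).negOnePow • contract y (contract z F) := by
  funext m
  refine mult_ext (𝒢 := 𝒢) fun d x hx => ?_
  have hsymm := (hF (m + 2)).1 _ _ (cons_mem hz (cons_mem hy hx)) 0 (Fin.succ 0) (by simp)
  rw [cons_cons_comp_swap] at hsymm
  rw [mul_comm]
  exact hsymm

theorem contract_gradedAction (P : ℤ → Submodule k (Sym 𝒢)) :
    GradedAction (shift 𝒢 1) (famHom P) (contract (𝒢 := 𝒢)) where
  mem hF := contract_mem hF
  swap hF := contract_contract hF

theorem sum_par_apply {n : ℕ} (K : (Fin n → Fin 2) → Mult 𝒢 n) {d : Fin n → ℤ} {x : Fin n → g}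
    (hx : ∀ i, x i ∈ shift 𝒢 1 (d i)) :
    (∑ e : Fin n → Fin 2, (K e).compLinearMap (fun i => par 𝒢 (e i))) x =
      K (fun i => if Even (d i) then 0 else 1) x := by
  have hpar (i : Fin n) (e : Fin 2) := par_of_mem 𝒢 (hx i) e
  have h2 (i : Fin n) : (1 + d i + 1) % 2 = d i % 2 := by omega
  simp only [h2] at hpar
  let e0 : Fin n → Fin 2 := fun i => if Even (d i) then 0 else 1
  have he0 (i : Fin n) (e : Fin 2) : d i % 2 = (e : ℤ) ↔ e = e0 i := by
    have : d i % 2 = 0 ∨ d i % 2 = 1 := by omega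
    rcases this with h | h <;> fin_cases e <;> simp [e0, h, Int.even_iff]
  simp only [he0] at hpar
  rw [sum_apply, Finset.sum_eq_single e0]
  · rw [MultilinearMap.compLinearMap_apply]
    congr 1
    funext i
    rw [hpar, if_pos rfl]
  · intro e _ he
    obtain ⟨i, hi⟩ := Function.ne_iff.1 he
    rw [MultilinearMap.compLinearMap_apply]
    apply (K e).map_coord_zero i
    rw [hpar, if_neg hi]
  · simp

theorem twist_apply {n : ℕ} {s : (Fin n → ℤ) → ℤˣ}
    (hs : ∀ d d' : Fin n → ℤ, (∀ i, Even (d i) ↔ Even (d' i)) → s d = s d') (F : Mult 𝒢 n)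
    {d : Fin n → ℤ} {x : Fin n → g} (hx : ∀ i, x i ∈ shift 𝒢 1 (d i)) :
    twist 𝒢 s F x = s d • F x := by
  refine (sum_par_apply (fun e => s (fun i => ((e i : ℕ) : ℤ)) • F) hx).trans ?_
  rw [← hs (fun i => (((if Even (d i) then 0 else 1 : Fin 2) : ℕ) : ℤ)) d]
  · rfl
  · intro i
    split_ifs with h <;> simp [h]

/-- The circle product, for families with values in `S (g[-1])`. -/
def famCirc (e : ℤ) : Fam 𝒢 →ₗ[k] Fam 𝒢 →ₗ[k] Fam 𝒢 :=
  LinearMap.mk₂ k (fun F H m =>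
    ∑ S : Finset (Fin m), twist 𝒢 (fun d => koszul d S * (e * ∑ i ∈ S, d i).negOnePow)
      (circTerm 𝒢 S (F (S.card + 1)) (H Sᶜ.card)))
    (by
      intro f f' h; funext m; ext x
      simp [twist, Finset.sum_add_distrib])
    (by
      intro c f h; funext m; ext x
      simp [twist, Finset.smul_sum, smul_comm c])
    (by
      intro f h h'; funext m; ext x
      simp [twist, Finset.sum_add_distrib])
    (by
      intro c f h; funext m; ext x
      simp [twist, Finset.smul_sum, smul_comm c])

theorem circ_apply (e : ℤ) (f h : Big 𝒢) (m n : ℕ) :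
    circ 𝒢 e f h m n = ∑ ab ∈ Finset.HasAntidiagonal.antidiagonal (n + 1),
      famCirc e (fun m => f m ab.1) (fun m => h m ab.2) m := by
  simp only [famCirc, LinearMap.mk₂_apply]
  rw [Finset.sum_comm]
  rfl

theorem even_sum_congr {ι : Type*} (S : Finset ι) {d d' : ι → ℤ}
    (h : ∀ i, Even (d i) ↔ Even (d' i)) : Even (∑ i ∈ S, d i) ↔ Even (∑ i ∈ S, d' i) := by
  classical
  induction S using Finset.induction_on with
  | empty => simp
  | insert i S hi ih => rw [Finset.sum_insert hi, Finset.sum_insert hi, Int.even_add, Int.even_add,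
      ih, h]

theorem famCirc_apply (e : ℤ) (F H : Fam 𝒢) {m : ℕ} {d : Fin m → ℤ} {x : Fin m → g}
    (hx : ∀ i, x i ∈ shift 𝒢 1 (d i)) :
    famCirc e F H m x = ∑ S : Finset (Fin m), (koszul d S * (e * ∑ i ∈ S, d i).negOnePow) •
      der ((F (S.card + 1)).curryRight (sub x S)) (H Sᶜ.card (sub x Sᶜ)) := by
  rw [famCirc, LinearMap.mk₂_apply, sum_apply]
  refine Finset.sum_congr rfl fun S _ => ?_
  rw [twist_apply _ _ hx]
  · rfl
  · intro d d' h
    congr 1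
    · refine Finset.prod_congr rfl fun i _ => Finset.prod_congr rfl fun j _ => ?_
      apply negOnePow_congr
      rw [Int.even_mul, Int.even_mul, h, h]
    · apply negOnePow_congr
      rw [Int.even_mul, Int.even_mul, even_sum_congr S h]

theorem ev0_famCirc (e : ℤ) (F H : Fam 𝒢) : ev0 (famCirc e F H) = der (ev1 F) (ev0 H) := by
  change famCirc e F H 0 Fin.elim0 = _
  rw [famCirc_apply e F H (d := Fin.elim0) (fun i => i.elim0), Fintype.sum_unique]
  have h1 : (default : Finset (Fin 0)) = ∅ := Subsingleton.elim _ _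
  have h2 : (∅ : Finset (Fin 0))ᶜ = ∅ := Subsingleton.elim _ _
  rw [h1, h2, apply_sub_empty (fun n z => (F (n + 1)).curryRight z) _ Fin.elim0,
    apply_sub_empty (fun n z => H n z) _ Fin.elim0]
  simp only [koszul_fin_zero, Finset.sum_empty, mul_zero, Int.negOnePow_zero, mul_one, one_smul]
  congr 2
  ext y
  change F 1 _ = F 1 _
  congr 1
  funext i
  obtain rfl : i = 0 := Fin.fin_one_eq_zero i
  rfl

theorem contract_famCirc (e : ℤ) (F H : Fam 𝒢) {p : ℤ} {y : g} (hy : y ∈ shift 𝒢 1 p) :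
    contract y (famCirc e F H) =
      (e * p).negOnePow • famCirc e (contract y F) H + famCirc (e + p) F (contract y H) := by
  funext m
  refine mult_ext (𝒢 := 𝒢) fun d x hx => ?_
  have hx' := cons_mem hy hx
  rw [contract_apply, famCirc_apply _ _ _ hx', sum_finset_fin_succ]
  have e1 : ((e * p).negOnePow • famCirc e (contract y F) H + famCirc (e + p) F (contract y H)) m x
    = (e * p).negOnePow • famCirc e (contract y F) H m x +
      famCirc (e + p) F (contract y H) m x := rfl
  rw [e1, famCirc_apply _ _ _ hx, famCirc_apply _ _ _ hx, Finset.smul_sum]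
  congr 1
  · refine Finset.sum_congr rfl fun S _ => ?_
    rw [compl_consSet, apply_sub_consSet S (fun n z => (F (n + 1)).curryRight z),
      apply_sub_succSet _ (fun n z => H n z), koszul_consSet, sum_consSet, smul_smul]
    simp only [Fin.cons_zero, Fin.cons_succ]
    congr 1
    · rw [mul_add, Int.negOnePow_add]
      ac_rfl
    · congr 2
      ext z
      rw [MultilinearMap.curryRight_apply, MultilinearMap.curryRight_apply, contract_apply,
        Fin.cons_snoc_eq_snoc_cons]
  · refine Finset.sum_congr rfl fun S _ => ?_
    rw [compl_succSet, apply_sub_succSet S (fun n z => (F (n + 1)).curryRight z),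
      apply_sub_consSet _ (fun n z => H n z), koszul_succSet, sum_succSet]
    simp only [Fin.cons_zero, Fin.cons_succ]
    congr 1
    rw [add_mul, Int.negOnePow_add]
    ac_rfl

end Families

/-! ### The graded Jacobi identity -/

section FamilyBracket

variable {k : Type u} [Field k] {g : Type v} [AddCommGroup g] [Module k g]
  {𝒢 : ℤ → Submodule k g} [DirectSum.Decomposition 𝒢]

/-- The span of the compositions of total degree `E`. Unlike the set of compositions it is stable
under contractions, which act on a composition by a Leibniz rule. -/
def circSpan (P Q : ℤ → Submodule k (Sym 𝒢)) (E : ℤ) : Submodule k (Fam 𝒢) :=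
  Submodule.span k
    {X | ∃ e e' F H, F ∈ famHom P e ∧ H ∈ famHom Q e' ∧ e + e' = E ∧ X = famCirc e' F H}

theorem famCirc_mem_circSpan {P Q : ℤ → Submodule k (Sym 𝒢)} {e e' : ℤ} {F H : Fam 𝒢}
    (hF : F ∈ famHom P e) (hH : H ∈ famHom Q e') : famCirc e' F H ∈ circSpan P Q (e + e') :=
  Submodule.subset_span ⟨e, e', F, H, hF, hH, rfl, rfl⟩

theorem contract_famCirc_mem_circSpan {P Q : ℤ → Submodule k (Sym 𝒢)} {e e' p : ℤ} {F H : Fam 𝒢}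
    (hF : F ∈ famHom P e) (hH : H ∈ famHom Q e') {y : g} (hy : y ∈ shift 𝒢 1 p) :
    contract y (famCirc e' F H) ∈ circSpan P Q (e + e' + p) := by
  rw [contract_famCirc _ _ _ hy]
  refine add_mem (Submodule.smul_of_tower_mem _ _ ?_) ?_
  · rw [add_right_comm]
    exact famCirc_mem_circSpan (contract_mem hF hy) hH
  · rw [add_assoc]
    exact famCirc_mem_circSpan hF (contract_mem hH hy)

theorem contract_contract_famCirc {P Q : ℤ → Submodule k (Sym 𝒢)} {e e' p q : ℤ} {F H : Fam 𝒢}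
    (hF : F ∈ famHom P e) (hH : H ∈ famHom Q e') {y z : g} (hy : y ∈ shift 𝒢 1 p)
    (hz : z ∈ shift 𝒢 1 q) :
    contract z (contract y (famCirc e' F H)) =
      (p * q).negOnePow • contract y (contract z (famCirc e' F H)) := by
  simp only [contract_famCirc _ _ _ hy, contract_famCirc _ _ _ hz, map_add,
    LinearMap.map_smul_of_tower, contract_contract hF hy hz, contract_contract hH hy hz,
    LinearMap.smul_apply, add_right_comm e' q p, smul_add, add_mul, Int.negOnePow_add, mul_comm q p]
  rcases Int.units_eq_one_or (e' * p).negOnePow with h1 | h1 <;>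
  rcases Int.units_eq_one_or (e' * q).negOnePow with h2 | h2 <;>
  rcases Int.units_eq_one_or (p * q).negOnePow with h3 | h3 <;>
  · simp only [h1, h2, h3, one_smul, mul_one, Units.neg_smul, mul_neg, neg_neg]
    abel

theorem circSpan_gradedAction (P Q : ℤ → Submodule k (Sym 𝒢)) :
    GradedAction (shift 𝒢 1) (circSpan P Q) (contract (𝒢 := 𝒢)) where
  mem {E p y X} hX hy := by
    suffices h : circSpan P Q E ≤ (circSpan P Q (E + p)).comap (contract y) from h hX
    rw [circSpan, Submodule.span_le]
    rintro _ ⟨e, e', F, H, hF, hH, rfl, rfl⟩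
    exact contract_famCirc_mem_circSpan hF hH hy
  swap {E p q y z X} hX hy hz := by
    refine LinearMap.eqOn_span (f := contract z ∘ₗ contract y)
      (g := (p * q).negOnePow • contract y ∘ₗ contract z) ?_ hX
    rintro _ ⟨e, e', F, H, hF, hH, rfl, rfl⟩
    exact contract_contract_famCirc hF hH hy hz

theorem famCirc_mem {P Q R : ℤ → Submodule k (Sym 𝒢)}
    (hder : ∀ c p φ a, HasDegree P c φ → a ∈ Q p → der φ a ∈ R (p + c)) {e e' : ℤ} {F H : Fam 𝒢}
    (hF : F ∈ famHom P e) (hH : H ∈ famHom Q e') : famCirc e' F H ∈ famHom R (e + e') := by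
  refine le_famHom (circSpan_gradedAction P Q) (fun E X hX => ?_) _ (famCirc_mem_circSpan hF hH)
  suffices h : circSpan P Q E ≤ (R (2 + E)).comap ev0 from h hX
  rw [circSpan, Submodule.span_le]
  rintro _ ⟨e, e', F, H, hF, hH, rfl, rfl⟩
  rw [SetLike.mem_coe, Submodule.mem_comap, ev0_famCirc, add_comm e e', ← add_assoc]
  exact hder _ _ _ _ (ev1_hasDegree hF) (ev0_mem hH)

/-- The big bracket, for families with values in `S (g[-1])`. -/
def famBr (a b : ℤ) : Fam 𝒢 →ₗ[k] Fam 𝒢 →ₗ[k] Fam 𝒢 :=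
  LinearMap.mk₂ k (fun F G => famCirc b F G - (a * b).negOnePow • famCirc a G F)
    (by intro f f' h; simp only [map_add, LinearMap.add_apply, smul_add]; abel)
    (by intro c f h; simp only [map_smul, LinearMap.smul_apply, smul_sub, smul_comm c])
    (by intro f h h'; simp only [map_add, LinearMap.add_apply, smul_add]; abel)
    (by intro c f h; simp only [map_smul, LinearMap.smul_apply, smul_sub, smul_comm c])

theorem famBr_apply (a b : ℤ) (F G : Fam 𝒢) :
    famBr a b F G = famCirc b F G - (a * b).negOnePow • famCirc a G F := rfl

theorem famBr_mem {e e' : ℤ} {F H : Fam 𝒢} (hF : F ∈ famHom (symDeg 𝒢) e)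
    (hH : H ∈ famHom (symDeg 𝒢) e') : famBr e e' F H ∈ famHom (symDeg 𝒢) (e + e') := by
  have hder : ∀ c p φ a, HasDegree (symDeg 𝒢) c φ → a ∈ symDeg 𝒢 p → der φ a ∈ symDeg 𝒢 (p + c) :=
    fun _ _ _ _ => der_mem_symDeg
  rw [famBr_apply]
  refine sub_mem (famCirc_mem hder hF hH) (Submodule.smul_of_tower_mem _ _ ?_)
  rw [add_comm]
  exact famCirc_mem hder hH hF

theorem famBr_antisymm (a b : ℤ) (F G : Fam 𝒢) :
    famBr a b F G = -((a * b).negOnePow • famBr b a G F) := by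
  rw [famBr_apply, famBr_apply, mul_comm b a]
  rcases Int.units_eq_one_or (a * b).negOnePow with h1 | h1 <;>
  · simp only [h1, one_smul, Units.neg_smul]
    abel

theorem contract_famBr (a b : ℤ) (F H : Fam 𝒢) {p : ℤ} {y : g} (hy : y ∈ shift 𝒢 1 p) :
    contract y (famBr a b F H) =
      (b * p).negOnePow • famBr (a + p) b (contract y F) H + famBr a (b + p) F (contract y H) := by
  simp only [famBr_apply, map_sub, LinearMap.map_smul_of_tower, contract_famCirc _ _ _ hy, mul_add,
    add_mul, Int.negOnePow_add, mul_comm p b]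
  rcases Int.units_eq_one_or (a * b).negOnePow with h1 | h1 <;>
  rcases Int.units_eq_one_or (a * p).negOnePow with h2 | h2 <;>
  rcases Int.units_eq_one_or (b * p).negOnePow with h3 | h3 <;>
  · simp only [h1, h2, h3, one_smul, mul_one, Units.neg_smul, mul_neg, neg_neg]
    abel

/-- The Jacobiator of the big bracket. -/
def famJac (a b c : ℤ) (F G H : Fam 𝒢) : Fam 𝒢 :=
  famBr a (b + c) F (famBr b c G H) - famBr (a + b) c (famBr a b F G) H -
    (a * b).negOnePow • famBr b (a + c) G (famBr a c F H)

theorem contract_famJac (a b c : ℤ) (F G H : Fam 𝒢) {p : ℤ} {y : g} (hy : y ∈ shift 𝒢 1 p) :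
    contract y (famJac a b c F G H) =
      ((b + c) * p).negOnePow • famJac (a + p) b c (contract y F) G H +
      (c * p).negOnePow • famJac a (b + p) c F (contract y G) H +
      famJac a b (c + p) F G (contract y H) := by
  simp only [famJac, map_sub, LinearMap.map_smul_of_tower, contract_famBr _ _ _ _ hy, map_add,
    LinearMap.smul_apply, LinearMap.add_apply, smul_add, smul_sub]
  rw [show a + p + b = a + b + p by ring, show b + p + c = b + c + p by ring,
    show b + (c + p) = b + c + p by ring, show a + (b + p) = a + b + p by ring,
    show a + p + c = a + c + p by ring, show a + (c + p) = a + c + p by ring]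
  simp only [mul_add, add_mul, Int.negOnePow_add, mul_comm p b]
  rcases Int.units_eq_one_or (a * b).negOnePow with h1 | h1 <;>
  rcases Int.units_eq_one_or (a * p).negOnePow with h2 | h2 <;>
  rcases Int.units_eq_one_or (b * p).negOnePow with h3 | h3 <;>
  rcases Int.units_eq_one_or (c * p).negOnePow with h4 | h4 <;>
  · simp only [h1, h2, h3, h4, one_smul, mul_one, Units.neg_smul, mul_neg, neg_neg]
    abel

variable (𝒢) in
/-- The map `x ↦ (-1)^(b |x|) x` on `g`. -/
def parPow (b : ℤ) : g →ₗ[k] g := if Even b then LinearMap.id else parInv 𝒢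

theorem parPow_of_mem (b : ℤ) {p : ℤ} {x : g} (hx : x ∈ shift 𝒢 (-1) p) :
    parPow 𝒢 b x = (b * p).negOnePow • x := by
  unfold parPow
  split_ifs with h
  · rw [Int.negOnePow_even _ (h.mul_right p), one_smul]
    rfl
  · rw [parInv_mem 𝒢 hx]
    congr 1
    apply negOnePow_congr
    simp [Int.even_mul, h]

/-- The map `s ↦ (y ↦ ∑ (-1)^(b |y|) F (y, s₁) s₂)`. -/
def doubleInsert (b : ℤ) (F : Fam 𝒢) : g ⊗[k] Sym 𝒢 →ₗ[k] g →ₗ[k] Sym 𝒢 :=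
  LinearMap.lcomp k (Sym 𝒢) (ev2 F ∘ₗ parPow 𝒢 b) ∘ₗ (pairing 𝒢).flip

theorem doubleInsert_apply (b : ℤ) (F : Fam 𝒢) (s : g ⊗[k] Sym 𝒢) (y : g) :
    doubleInsert b F s y = pairing 𝒢 (ev2 F (parPow 𝒢 b y)) s := rfl

theorem pairing_doubleInsert_tmul_symm {e q r q' r' : ℤ} {F : Fam 𝒢}
    (hF : F ∈ famHom (symDeg 𝒢) e) {x y : g} {u w : Sym 𝒢} (hx : x ∈ shift 𝒢 (-1) q)
    (hu : u ∈ symDeg 𝒢 r) (hy : y ∈ shift 𝒢 (-1) q') (hw : w ∈ symDeg 𝒢 r') :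
    pairing 𝒢 (doubleInsert (q + r - 2) F (x ⊗ₜ u)) (y ⊗ₜ w) =
      ((q + r - 2) * (q' + r' - 2)).negOnePow •
        pairing 𝒢 (doubleInsert (q' + r' - 2) F (y ⊗ₜ w)) (x ⊗ₜ u) := by
  have hx' : x ∈ shift 𝒢 1 (q - 2) := by rw [mem_shift_one]; simpa using hx
  have hy' : y ∈ shift 𝒢 1 (q' - 2) := by rw [mem_shift_one]; simpa using hy
  have hev2 (x y : g) : ev2 F y x = ev0 (contract x (contract y F)) := rfl
  simp only [pairing_tmul, doubleInsert_apply, parPow_of_mem _ hy, parPow_of_mem _ hx,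
    LinearMap.map_smul_of_tower, LinearMap.smul_apply, smul_mul_assoc, mul_assoc, hev2,
    contract_contract hF hy' hx']
  rw [symDeg_mul_comm hu hw, mul_smul_comm, smul_smul, smul_smul, smul_smul]
  congr 1
  simp only [← Int.negOnePow_add]
  apply negOnePow_congr
  simp only [Int.even_add, Int.even_mul, Int.even_sub, even_two]
  by_cases h1 : Even q <;> by_cases h2 : Even r <;> by_cases h3 : Even q' <;>
    by_cases h4 : Even r' <;> simp [h1, h2, h3, h4]

theorem pairing_doubleInsert_symm {e b c : ℤ} {F : Fam 𝒢} (hF : F ∈ famHom (symDeg 𝒢) e)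
    {s t : g ⊗[k] Sym 𝒢} (hs : s ∈ tens (symDeg 𝒢) (2 + b)) (ht : t ∈ tens (symDeg 𝒢) (2 + c)) :
    pairing 𝒢 (doubleInsert b F s) t =
      (b * c).negOnePow • pairing 𝒢 (doubleInsert c F t) s := by
  refine LinearMap.eqOn_span (f := (pairing 𝒢 ∘ₗ doubleInsert b F).flip t)
    (g := (b * c).negOnePow • pairing 𝒢 (doubleInsert c F t)) ?_ hs
  rintro _ ⟨q, r, x, u, hx, hu, hqr, rfl⟩
  refine LinearMap.eqOn_span (f := pairing 𝒢 (doubleInsert b F (x ⊗ₜ u)))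
    (g := (b * c).negOnePow • (pairing 𝒢 ∘ₗ doubleInsert c F).flip (x ⊗ₜ u)) ?_ ht
  rintro _ ⟨q', r', y, w, hy, hw, hqr', rfl⟩
  obtain rfl : b = q + r - 2 := by omega
  obtain rfl : c = q' + r' - 2 := by omega
  exact pairing_doubleInsert_tmul_symm hF hx hu hy hw

theorem ev1_famCirc (b : ℤ) (F G : Fam 𝒢) :
    ev1 (famCirc b F G) = doubleInsert b F (coprod 𝒢 (ev0 G)) + der (ev1 F) ∘ₗ ev1 G := by
  ext y
  induction y using homogeneous_induction (𝒢 := 𝒢) with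
  | zero => simp
  | add y z hy hz => rw [map_add, map_add, hy, hz]
  | hom p y hy =>
    have hy' := mem_shift_one.1 hy
    have hs : (b * (2 + p)).negOnePow = (b * p).negOnePow := by
      apply negOnePow_congr
      simp [Int.even_mul, Int.even_add]
    rw [LinearMap.add_apply, doubleInsert_apply, parPow_of_mem b hy', LinearMap.map_smul_of_tower,
      LinearMap.map_smul_of_tower, LinearMap.smul_apply, ev1_apply, contract_famCirc _ _ _ hy,
      map_add, LinearMap.map_smul_of_tower, ev0_famCirc, ev0_famCirc, hs]
    rfl

theorem ev0_associator {a b c : ℤ} {F G H : Fam 𝒢} (hF : F ∈ famHom (symDeg 𝒢) a)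
    (hG : G ∈ famHom (symDeg 𝒢) b) (hH : H ∈ famHom (symDeg 𝒢) c) :
    der (ev1 F) (der (ev1 G) (ev0 H)) - (a * b).negOnePow • der (ev1 G) (der (ev1 F) (ev0 H)) =
      der (ev1 (famCirc b F G)) (ev0 H) - (a * b).negOnePow • der (ev1 (famCirc a G F)) (ev0 H) -
      pairing 𝒢 (doubleInsert b F (coprod 𝒢 (ev0 G))) (coprod 𝒢 (ev0 H)) +
      (a * b).negOnePow •
        pairing 𝒢 (doubleInsert a G (coprod 𝒢 (ev0 F))) (coprod 𝒢 (ev0 H)) := by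
  rw [der_der (ev1_hasDegree hF) (ev1_hasDegree hG) (ev0_mem hH), der_sub, der_units_smul,
    ev1_famCirc, ev1_famCirc, der_add, der_add, smul_add, ← der_apply, ← der_apply]
  abel

-- The associators of the circle product consist of terms that insert two maps into a third one; by
-- symmetry of double insertion these cancel in pairs.
theorem ev0_famJac {a b c : ℤ} {F G H : Fam 𝒢} (hF : F ∈ famHom (symDeg 𝒢) a)
    (hG : G ∈ famHom (symDeg 𝒢) b) (hH : H ∈ famHom (symDeg 𝒢) c) :
    ev0 (famJac a b c F G H) = 0 := by
  have assocFGH := ev0_associator hF hG hH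
  have assocFHG := ev0_associator hF hH hG
  have assocGHF := ev0_associator hG hH hF
  have tF := coprod_mem_tens_symDeg (ev0_mem hF)
  have tG := coprod_mem_tens_symDeg (ev0_mem hG)
  have tH := coprod_mem_tens_symDeg (ev0_mem hH)
  rw [pairing_doubleInsert_symm hF tG tH, pairing_doubleInsert_symm hG tF tH] at assocFGH
  rw [pairing_doubleInsert_symm hH tF tG] at assocFHG
  simp only [famJac, famBr_apply, map_sub, LinearMap.map_smul_of_tower, ev0_famCirc,
    LinearMap.sub_apply, LinearMap.smul_apply, mul_add, add_mul, Int.negOnePow_add, mul_comm b a]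
  rcases Int.units_eq_one_or (a * b).negOnePow with h1 | h1 <;>
  rcases Int.units_eq_one_or (a * c).negOnePow with h2 | h2 <;>
  rcases Int.units_eq_one_or (b * c).negOnePow with h3 | h3 <;>
  · simp only [h1, h2, h3, one_smul, mul_one, Units.neg_smul, mul_neg, neg_neg]
      at assocFGH assocFHG assocGHF ⊢
    first
      | linear_combination (norm := module) assocFGH - assocFHG + assocGHF
      | linear_combination (norm := module) assocFGH + assocFHG + assocGHF
      | linear_combination (norm := module) assocFGH - assocFHG - assocGHF
      | linear_combination (norm := module) assocFGH + assocFHG - assocGHF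

theorem famJac_eq_zero {a b c : ℤ} {F G H : Fam 𝒢} (hF : F ∈ famHom (symDeg 𝒢) a)
    (hG : G ∈ famHom (symDeg 𝒢) b) (hH : H ∈ famHom (symDeg 𝒢) c) :
    famJac a b c F G H = 0 := by
  funext m
  induction m generalizing a b c F G H with
  | zero =>
    ext x
    rw [Subsingleton.elim x Fin.elim0]
    exact ev0_famJac hF hG hH
  | succ m ih =>
    refine fam_apply_succ_eq_zero fun p y hy => ?_
    rw [contract_famJac _ _ _ _ _ _ hy]
    simp only [Pi.add_apply, Pi.smul_apply, ih (contract_mem hF hy) hG hH,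
      ih hF (contract_mem hG hy) hH, ih hF hG (contract_mem hH hy)]
    simp

end FamilyBracket

/-! ### Derived brackets in a graded Lie algebra -/

section Derived

variable {k : Type*} [Field k] {E M : Type*} [AddCommGroup E] [Module k E] [AddCommGroup M]
  [Module k M]

/-- A graded Lie algebra structure on the graded space `ℬ`. -/
structure IsGradedLie (ℬ : ℤ → Submodule k M) (br : ℤ → ℤ → M →ₗ[k] M →ₗ[k] M) : Prop where
  bracket_mem : ∀ {a b f g}, f ∈ ℬ a → g ∈ ℬ b → br a b f g ∈ ℬ (a + b)
  antisymm : ∀ a b f g, br a b f g = -((a * b).negOnePow • br b a g f)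
  jacobi : ∀ {a b c f g h}, f ∈ ℬ a → g ∈ ℬ b → h ∈ ℬ c →
    br a (b + c) f (br b c g h) =
      br (a + b) c (br a b f g) h + (a * b).negOnePow • br b (a + c) g (br a c f h)

/-- The right adjoint action of the elements `emb a`, which commute with each other. -/
structure IsDerivedAction (ℬ : ℤ → Submodule k M) (br : ℤ → ℤ → M →ₗ[k] M →ₗ[k] M)
    (𝒱 : ℤ → Submodule k E) (emb : E → M) (act : E → M →ₗ[k] M) : Prop where
  lie : IsGradedLie ℬ br
  emb_mem : ∀ {p a}, a ∈ 𝒱 p → emb a ∈ ℬ p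
  act_eq : ∀ {e p F a}, F ∈ ℬ e → a ∈ 𝒱 p → act a F = br e p F (emb a)
  act_emb : ∀ {p q a b}, a ∈ 𝒱 p → b ∈ 𝒱 q → act b (emb a) = 0

namespace IsDerivedAction

variable {ℬ : ℤ → Submodule k M} {br : ℤ → ℤ → M →ₗ[k] M →ₗ[k] M} {𝒱 : ℤ → Submodule k E}
  {emb : E → M} {act : E → M →ₗ[k] M}

theorem act_mem (h : IsDerivedAction ℬ br 𝒱 emb act) {e p : ℤ} {F : M} {a : E} (hF : F ∈ ℬ e)
    (ha : a ∈ 𝒱 p) : act a F ∈ ℬ (e + p) := by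
  rw [h.act_eq hF ha]
  exact h.lie.bracket_mem hF (h.emb_mem ha)

theorem gradedAction (h : IsDerivedAction ℬ br 𝒱 emb act) : GradedAction 𝒱 ℬ act where
  mem := h.act_mem
  swap := by
    intro e p q a b F hF ha hb
    have hj := h.lie.jacobi hF (h.emb_mem ha) (h.emb_mem hb)
    rw [← h.act_eq (h.emb_mem ha) hb, h.act_emb ha hb, map_zero,
      h.lie.antisymm p (e + q), ← h.act_eq hF ha, ← h.act_eq hF hb,
      ← h.act_eq (h.act_mem hF ha) hb, ← h.act_eq (h.act_mem hF hb) ha, smul_neg, smul_smul,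
      ← sub_eq_add_neg, eq_comm, sub_eq_zero] at hj
    rw [hj, ← Int.negOnePow_add]
    congr 1
    apply negOnePow_congr
    simp only [Int.even_add, Int.even_mul]
    tauto

theorem act_br (h : IsDerivedAction ℬ br 𝒱 emb act) {a b p : ℤ} {F G : M} {c : E} (hF : F ∈ ℬ a)
    (hG : G ∈ ℬ b) (hc : c ∈ 𝒱 p) :
    act c (br a b F G) =
      (b * p).negOnePow • br (a + p) b (act c F) G + br a (b + p) F (act c G) := by
  have hj := h.lie.jacobi hF hG (h.emb_mem hc)
  rw [h.lie.antisymm b (a + p), ← h.act_eq hF hc, ← h.act_eq hG hc,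
    ← h.act_eq (h.lie.bracket_mem hF hG) hc, smul_neg, smul_smul, ← Int.negOnePow_add] at hj
  rw [hj]
  have : (a * b + b * (a + p)).negOnePow = (b * p).negOnePow := by
    apply negOnePow_congr
    simp only [Int.even_add, Int.even_mul]
    tauto
  rw [this]
  abel

theorem iter_br (h : IsDerivedAction ℬ br 𝒱 emb act) {n : ℕ} {d : Fin n → ℤ} {x : Fin n → E}
    (hx : ∀ i, x i ∈ 𝒱 (d i)) {a b : ℤ} {F G : M} (hF : F ∈ ℬ a) (hG : G ∈ ℬ b) :
    iter act n x (br a b F G) =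
      ∑ S : Finset (Fin n), (koszul d S * (b * ∑ i ∈ S, d i).negOnePow) •
        br (a + ∑ i ∈ S, d i) (b + ∑ i ∈ Sᶜ, d i)
          (iter act S.card (sub x S) F)
          (iter act Sᶜ.card (sub x Sᶜ) G) := by
  induction n generalizing a b F G with
  | zero =>
    rw [Fintype.sum_unique]
    have h1 : (default : Finset (Fin 0)) = ∅ := Subsingleton.elim _ _
    have h2 : (∅ : Finset (Fin 0))ᶜ = ∅ := Subsingleton.elim _ _
    rw [h1, h2]
    simp only [koszul_fin_zero, Finset.sum_empty, mul_zero, Int.negOnePow_zero, mul_one, add_zero,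
      Finset.card_empty, one_smul]
    rfl
  | succ n ih =>
    have hx' : ∀ i : Fin n, x i.succ ∈ 𝒱 (d i.succ) := fun i => hx i.succ
    rw [sum_finset_fin_succ, iter_succ, h.act_br hF hG (hx 0), map_add, LinearMap.map_smul_of_tower,
      ih hx' (h.act_mem hF (hx 0)) hG, ih hx' hF (h.act_mem hG (hx 0)), Finset.smul_sum]
    congr 1
    · refine Finset.sum_congr rfl fun S _ => ?_
      rw [compl_consSet, apply_sub_consSet S (fun n z => iter act n z F),
        apply_sub_succSet _ (fun n z => iter act n z G), koszul_consSet,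
        sum_consSet, sum_succSet, iter_cons, smul_smul, mul_add, Int.negOnePow_add, ← add_assoc]
      congr 1
      ac_rfl
    · refine Finset.sum_congr rfl fun S _ => ?_
      rw [compl_succSet, apply_sub_succSet S (fun n z => iter act n z F),
        apply_sub_consSet _ (fun n z => iter act n z G), koszul_succSet,
        sum_consSet, sum_succSet, iter_cons, add_mul, Int.negOnePow_add, ← add_assoc]
      congr 1
      ac_rfl

theorem br_add_emb (h : IsDerivedAction ℬ br 𝒱 emb act) {a b : ℤ} {F G : M} {u v : E}
    (hF : F ∈ ℬ a) (hG : G ∈ ℬ b) (hu : u ∈ 𝒱 a) (hv : v ∈ 𝒱 b) :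
    br a b (F + emb u) (G + emb v) = br a b F G + act v (F + emb u) -
      (a * b).negOnePow • act u (G + emb v) := by
  have hcomm : br a b (emb u) (emb v) = 0 := by rw [← h.act_eq (h.emb_mem hu) hv, h.act_emb hu hv]
  rw [map_add, LinearMap.map_add₂, LinearMap.map_add₂, hcomm, h.lie.antisymm a b (emb u),
    ← h.act_eq hF hv, ← h.act_eq hG hu, map_add, map_add, h.act_emb hu hv, h.act_emb hv hu,
    add_zero, add_zero]
  abel

section MaurerCartan

variable {l : M} {φ : ∀ n : ℕ, (Fin n → E) → M} {L : ∀ n : ℕ, (Fin n → E) → E} {n : ℕ}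
  {d : Fin n → ℤ} {x : Fin n → E}

theorem br_iter_iter (h : IsDerivedAction ℬ br 𝒱 emb act) (hl : l ∈ ℬ 1)
    (hL : ∀ {n : ℕ} {d : Fin n → ℤ} {x : Fin n → E}, (∀ i, x i ∈ 𝒱 (d i)) →
      L n x ∈ 𝒱 (1 + ∑ i, d i))
    (hdec : ∀ (n : ℕ) (x : Fin n → E), iter act n x l = φ n x + emb (L n x))
    (hx : ∀ i, x i ∈ 𝒱 (d i)) (S : Finset (Fin n)) :
    (koszul d S * (∑ i ∈ S, d i).negOnePow) • br (1 + ∑ i ∈ S, d i) (1 + ∑ i ∈ Sᶜ, d i)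
        (iter act S.card (sub x S) l) (iter act Sᶜ.card (sub x Sᶜ) l) =
      (koszul d S * (∑ i ∈ S, d i).negOnePow) • br (1 + ∑ i ∈ S, d i) (1 + ∑ i ∈ Sᶜ, d i)
        (φ S.card (sub x S)) (φ Sᶜ.card (sub x Sᶜ)) +
      koszul d Sᶜ • iter act (S.card + 1) (Fin.cons (L Sᶜ.card (sub x Sᶜ)) (sub x S)) l +
      koszul d S • iter act (Sᶜ.card + 1) (Fin.cons (L S.card (sub x S)) (sub x Sᶜ)) l := by
  have hLS (S : Finset (Fin n)) : L S.card (sub x S) ∈ 𝒱 (1 + ∑ i ∈ S, d i) :=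
    sum_sub S d ▸ hL (sub_mem_of_mem S hx)
  have hφS (S : Finset (Fin n)) : φ S.card (sub x S) ∈ ℬ (1 + ∑ i ∈ S, d i) := by
    rw [eq_sub_of_add_eq (hdec _ _).symm]
    exact sub_mem (sum_sub S d ▸ h.gradedAction.iter_mem (sub_mem_of_mem S hx) hl)
      (h.emb_mem (hLS S))
  have hact (S T : Finset (Fin n)) : act (L S.card (sub x S)) (iter act T.card (sub x T) l) =
      ((1 + ∑ i ∈ S, d i) * ∑ i ∈ T, d i).negOnePow •
        iter act (T.card + 1) (Fin.cons (L S.card (sub x S)) (sub x T)) l := by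
    rw [h.gradedAction.act_iter (sub_mem_of_mem T hx) hl (hLS S), sum_sub, iter_cons]
  have sign_compl : (∑ i ∈ S, d i).negOnePow * ((1 + ∑ i ∈ Sᶜ, d i) * ∑ i ∈ S, d i).negOnePow =
      ((∑ i ∈ S, d i) * ∑ i ∈ Sᶜ, d i).negOnePow := by
    rw [← Int.negOnePow_add]
    apply negOnePow_congr
    simp only [Int.even_add, Int.even_mul, Int.not_even_one]
    tauto
  have sign_self : (∑ i ∈ S, d i).negOnePow *
      (-((1 + ∑ i ∈ S, d i) * (1 + ∑ i ∈ Sᶜ, d i)).negOnePow *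
        ((1 + ∑ i ∈ S, d i) * ∑ i ∈ Sᶜ, d i).negOnePow) = 1 := by
    rw [← Int.negOnePow_succ, ← Int.negOnePow_add, ← Int.negOnePow_add]
    apply Int.negOnePow_even
    simp only [Int.even_add, Int.even_mul, Int.not_even_one]
    tauto
  rw [hdec, hdec, h.br_add_emb (hφS S) (hφS Sᶜ) (hLS S) (hLS Sᶜ), ← hdec, ← hdec, hact, hact,
    koszul_compl, sub_eq_add_neg, ← Units.neg_smul, smul_add, smul_add, smul_smul, smul_smul,
    smul_smul, mul_assoc, sign_compl, mul_assoc, mul_assoc, sign_self, mul_one]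

theorem derived_identity (h : IsDerivedAction ℬ br 𝒱 emb act) (hl : l ∈ ℬ 1)
    (hll : br 1 1 l l = 0)
    (hL : ∀ {n : ℕ} {d : Fin n → ℤ} {x : Fin n → E}, (∀ i, x i ∈ 𝒱 (d i)) →
      L n x ∈ 𝒱 (1 + ∑ i, d i))
    (hdec : ∀ (n : ℕ) (x : Fin n → E), iter act n x l = φ n x + emb (L n x))
    (hx : ∀ i, x i ∈ 𝒱 (d i)) :
    ∑ S : Finset (Fin n), (koszul d S * (∑ i ∈ S, d i).negOnePow) •
        br (1 + ∑ i ∈ S, d i) (1 + ∑ i ∈ Sᶜ, d i) (φ S.card (sub x S)) (φ Sᶜ.card (sub x Sᶜ)) +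
      (2 : ℤ) • ∑ S : Finset (Fin n), koszul d S • iter act (Sᶜ.card + 1)
        (Fin.cons (L S.card (sub x S)) (sub x Sᶜ)) l = 0 := by
  have expansion := h.iter_br hx hl hl
  simp only [hll, map_zero, one_mul, h.br_iter_iter hl hL hdec hx, Finset.sum_add_distrib]
    at expansion
  have reindex : ∑ S : Finset (Fin n), koszul d Sᶜ • iter act (S.card + 1)
        (Fin.cons (L Sᶜ.card (sub x Sᶜ)) (sub x S)) l =
      ∑ S : Finset (Fin n), koszul d S • iter act (Sᶜ.card + 1)
        (Fin.cons (L S.card (sub x S)) (sub x Sᶜ)) l := by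
    rw [← Equiv.sum_comp (compl_involutive (α := Finset (Fin n))).toPerm]
    refine Finset.sum_congr rfl fun S _ => ?_
    rw [Function.Involutive.coe_toPerm, compl_compl]
  rw [expansion, reindex, two_zsmul, add_assoc]

end MaurerCartan

end IsDerivedAction

end Derived

/-! ### Insertion of elements of the symmetric algebra -/

section Insertion

variable {k : Type u} [Field k] {g : Type v} [AddCommGroup g] [Module k g]
  {𝒢 : ℤ → Submodule k g}

/-- An element of `S (g[-1])` as a family, concentrated in arity zero. -/
def famEmb (u : Sym 𝒢) : Fam 𝒢
  | 0 => MultilinearMap.constOfIsEmpty k _ u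
  | _ + 1 => 0

theorem ev0_famEmb (u : Sym 𝒢) : ev0 (famEmb u) = u := rfl

theorem contract_famEmb (u : Sym 𝒢) (y : g) : contract y (famEmb u) = 0 := rfl

theorem famEmb_mem {P : ℤ → Submodule k (Sym 𝒢)} {p : ℤ} {u : Sym 𝒢} (hu : u ∈ P (2 + p)) :
    famEmb u ∈ famHom P p := by
  intro m
  rcases m with _ | m
  · refine ⟨fun _ _ _ i => i.elim0, fun _ _ _ => ?_⟩
    rw [Finset.univ_eq_empty, Finset.sum_empty, zero_add]
    exact hu
  · refine ⟨fun _ _ _ _ _ _ => ?_, fun _ _ _ => zero_mem _⟩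
    simp [famEmb]

variable [DirectSum.Decomposition 𝒢]

theorem symInv_gen (v : g) : symInv 𝒢 (gen 𝒢 v) = gen 𝒢 (parInv 𝒢 v) := symLift_gen _ _ v

theorem symInv_of_mem_symDeg {r : ℤ} {b : Sym 𝒢} (hb : b ∈ symDeg 𝒢 r) :
    symInv 𝒢 b = r.negOnePow • b := by
  induction hb using symDeg_induction with
  | one => simp
  | mul p q v a hv _ ih =>
    rw [map_mul, ih, symInv_gen, parInv_mem 𝒢 hv, LinearMap.map_smul_of_tower, smul_mul_assoc,
      mul_smul_comm, smul_smul, Int.negOnePow_add]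
  | zero p => simp
  | add p a b _ _ iha ihb => rw [map_add, iha, ihb, smul_add]
  | smul p c a _ ih => rw [map_smul, ih, smul_comm]

theorem symInv_pow_of_mem_symDeg {r : ℤ} {b : Sym 𝒢} (hb : b ∈ symDeg 𝒢 r) (N : ℕ) :
    ((symInv 𝒢) ^ N) b = (N * r).negOnePow • b := by
  induction N with
  | zero => simp
  | succ N ih =>
    rw [pow_succ, AlgHom.mul_apply, symInv_of_mem_symDeg hb, Units.smul_def, map_zsmul,
      ← Units.smul_def, ih, smul_smul, ← Int.negOnePow_add]
    congr 2
    push_cast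
    ring

/-- The number of odd entries of `d`. -/
def oddCount {n : ℕ} (d : Fin n → ℤ) : ℕ := ∑ i, if Even (d i) then 0 else 1

theorem even_oddCount {n : ℕ} (d : Fin n → ℤ) : Even (oddCount d : ℤ) ↔ Even (∑ i, d i) := by
  rw [oddCount, Nat.cast_sum]
  refine even_sum_congr _ fun i => ?_
  split_ifs with h <;> simp [h]

theorem insertArg_apply {n : ℕ} (a : Sym 𝒢) (F : Mult 𝒢 (n + 1)) {d : Fin n → ℤ} {x : Fin n → g}
    (hx : ∀ i, x i ∈ shift 𝒢 1 (d i)) :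
    insertArg 𝒢 n a F x = pairing 𝒢 (firstArg 𝒢 F x)
      (LinearMap.lTensor g ((symInv 𝒢) ^ oddCount d).toLinearMap (coprod 𝒢 a)) := by
  refine (sum_par_apply (fun e => ((pairing 𝒢).flip (LinearMap.lTensor g
    ((symInv 𝒢) ^ (∑ i, (e i : ℕ))).toLinearMap (coprod 𝒢 a))).compMultilinearMap
      (firstArg 𝒢 F)) hx).trans ?_
  have h : ∑ i, (((if Even (d i) then 0 else 1 : Fin 2)) : ℕ) = oddCount d :=
    Finset.sum_congr rfl fun i _ => by split_ifs <;> rfl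
  rw [h]
  rfl

/-- Insertion of `u` as the first argument, as a derivation in it. -/
def ins (u : Sym 𝒢) : Fam 𝒢 →ₗ[k] Fam 𝒢 where
  toFun F m := insertArg 𝒢 m u (F (m + 1))
  map_add' F G := funext fun m => map_add (insertArg 𝒢 m u) (F (m + 1)) (G (m + 1))
  map_smul' c F := funext fun m => map_smul (insertArg 𝒢 m u) c (F (m + 1))

theorem ins_gen (v : g) (F : Fam 𝒢) : ins (gen 𝒢 v) F = contract v F := by
  funext m
  refine mult_ext (𝒢 := 𝒢) fun d x hx => ?_
  refine (insertArg_apply _ _ hx).trans ?_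
  rw [coprod_gen, LinearMap.lTensor_tmul, pairing_tmul, AlgHom.toLinearMap_apply, map_one, mul_one]
  rfl

theorem ev0_ins (u : Sym 𝒢) (F : Fam 𝒢) : ev0 (ins u F) = der (ev1 F) u := by
  refine (insertArg_apply u (F 1) (d := Fin.elim0) (fun i => i.elim0)).trans ?_
  rw [der_apply, oddCount, Finset.univ_eq_empty, Finset.sum_empty, pow_zero]
  congr 1
  exact LinearMap.lTensor_id_apply _ _ _

theorem pairing_firstArg_cons {e q r t : ℤ} {F : Fam 𝒢} (hF : F ∈ famHom (symDeg 𝒢) e)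
    {y z : g} {b : Sym 𝒢} (hy : y ∈ shift 𝒢 1 q) (hz : z ∈ shift 𝒢 (-1) r) (hb : b ∈ symDeg 𝒢 t)
    {m : ℕ} (d : Fin m → ℤ) (x : Fin m → g) :
    pairing 𝒢 (firstArg 𝒢 (F (m + 2)) (Fin.cons y x)) (LinearMap.lTensor g
        ((symInv 𝒢) ^ oddCount (Fin.cons q d : Fin (m + 1) → ℤ)).toLinearMap (z ⊗ₜ b)) =
      ((r + t - 2) * q).negOnePow • pairing 𝒢 (firstArg 𝒢 (contract y F (m + 1)) x)
        (LinearMap.lTensor g ((symInv 𝒢) ^ oddCount d).toLinearMap (z ⊗ₜ b)) := by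
  have hz' : z ∈ shift 𝒢 1 (r - 2) := by rw [mem_shift_one]; simpa using hz
  have hswap : firstArg 𝒢 (F (m + 2)) (Fin.cons y x) z =
      ((r - 2) * q).negOnePow • firstArg 𝒢 (contract y F (m + 1)) x z :=
    congrFun (congrArg DFunLike.coe (congrFun (contract_contract hF hz' hy) m)) x
  rw [LinearMap.lTensor_tmul, LinearMap.lTensor_tmul, pairing_tmul, pairing_tmul,
    AlgHom.toLinearMap_apply, AlgHom.toLinearMap_apply, symInv_pow_of_mem_symDeg hb,
    symInv_pow_of_mem_symDeg hb, hswap, smul_mul_assoc, mul_smul_comm, mul_smul_comm, smul_smul,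
    smul_smul, ← Int.negOnePow_add, ← Int.negOnePow_add]
  congr 1
  apply negOnePow_congr
  simp only [Int.even_add, Int.even_mul, Int.even_sub, even_two, even_oddCount,
    Fin.sum_univ_succ, Fin.cons_zero, Fin.cons_succ]
  tauto

theorem contract_ins {e p q : ℤ} {u : Sym 𝒢} (hu : u ∈ symDeg 𝒢 (2 + p)) {F : Fam 𝒢}
    (hF : F ∈ famHom (symDeg 𝒢) e) {y : g} (hy : y ∈ shift 𝒢 1 q) :
    contract y (ins u F) = (p * q).negOnePow • ins u (contract y F) := by
  funext m
  refine mult_ext (𝒢 := 𝒢) fun d x hx => ?_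
  refine (insertArg_apply u (F (m + 2)) (cons_mem hy hx)).trans ?_
  refine Eq.trans ?_
    (congrArg ((p * q).negOnePow • ·) (insertArg_apply u (contract y F (m + 1)) hx).symm)
  refine LinearMap.eqOn_span
    (f := pairing 𝒢 (firstArg 𝒢 (F (m + 2)) (Fin.cons y x)) ∘ₗ LinearMap.lTensor g
      ((symInv 𝒢) ^ oddCount (Fin.cons q d : Fin (m + 1) → ℤ)).toLinearMap)
    (g := (p * q).negOnePow • pairing 𝒢 (firstArg 𝒢 (contract y F (m + 1)) x) ∘ₗ
      LinearMap.lTensor g ((symInv 𝒢) ^ oddCount d).toLinearMap) ?_ (coprod_mem_tens_symDeg hu)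
  rintro _ ⟨r, t, z, b, hz, hb, hrt, rfl⟩
  obtain rfl : p = r + t - 2 := by omega
  exact pairing_firstArg_cons hF hy hz hb d x

theorem famCirc_famEmb_left (e : ℤ) (u : Sym 𝒢) (F : Fam 𝒢) : famCirc e (famEmb u) F = 0 := by
  funext m
  induction m generalizing e F with
  | zero =>
    ext x
    rw [Subsingleton.elim x Fin.elim0]
    refine (ev0_famCirc e (famEmb u) F).trans ?_
    have : ev1 (famEmb u) = 0 := rfl
    simp [this, der_apply]
  | succ m ih =>
    refine fam_apply_succ_eq_zero fun p y hy => ?_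
    rw [contract_famCirc _ _ _ hy, contract_famEmb, map_zero, LinearMap.zero_apply, smul_zero,
      zero_add, ih]
    rfl

theorem ins_eq_famCirc {e p : ℤ} {u : Sym 𝒢} (hu : u ∈ symDeg 𝒢 (2 + p)) {F : Fam 𝒢}
    (hF : F ∈ famHom (symDeg 𝒢) e) : ins u F = famCirc p F (famEmb u) := by
  suffices h : ins u F - famCirc p F (famEmb u) = 0 from sub_eq_zero.1 h
  funext m
  induction m generalizing e F with
  | zero =>
    ext x
    rw [Subsingleton.elim x Fin.elim0]
    change ev0 (ins u F - famCirc p F (famEmb u)) = 0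
    rw [map_sub, ev0_ins, ev0_famCirc, ev0_famEmb, sub_self]
  | succ m ih =>
    refine fam_apply_succ_eq_zero fun q y hy => ?_
    rw [map_sub, contract_ins hu hF hy, contract_famCirc _ _ _ hy, contract_famEmb, map_zero,
      add_zero]
    have h : ins u (contract y F) m = famCirc p (contract y F) (famEmb u) m :=
      sub_eq_zero.1 (ih (contract_mem hF hy))
    change (p * q).negOnePow • ins u (contract y F) m -
      (p * q).negOnePow • famCirc p (contract y F) (famEmb u) m = 0
    rw [h, sub_self]

theorem ins_eq_famBr {e p : ℤ} {u : Sym 𝒢} (hu : u ∈ symDeg 𝒢 (2 + p)) {F : Fam 𝒢}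
    (hF : F ∈ famHom (symDeg 𝒢) e) : ins u F = famBr e p F (famEmb u) := by
  rw [famBr_apply, famCirc_famEmb_left, smul_zero, sub_zero, ins_eq_famCirc hu hF]

theorem ins_famEmb (u w : Sym 𝒢) : ins u (famEmb w) = 0 :=
  funext fun m => map_zero (insertArg 𝒢 m u)

theorem famBr_isGradedLie : IsGradedLie (famHom (symDeg 𝒢)) (famBr (𝒢 := 𝒢)) where
  bracket_mem := famBr_mem
  antisymm := famBr_antisymm
  jacobi hF hG hH := by
    have hJac := famJac_eq_zero hF hG hH
    rwa [famJac, sub_sub, sub_eq_zero] at hJac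

theorem ins_isDerivedAction :
    IsDerivedAction (famHom (symDeg 𝒢)) (famBr (𝒢 := 𝒢)) (shift (symDeg 𝒢) 2) famEmb ins where
  lie := famBr_isGradedLie
  emb_mem hu := famEmb_mem hu
  act_eq hF hu := ins_eq_famBr hu hF
  act_emb _ _ := ins_famEmb _ _

theorem ext_eq_iter (F : Fam 𝒢) (n : ℕ) (u : Fin n → Sym 𝒢) :
    ext 𝒢 n (F n) u = ev0 (iter ins n u F) := by
  induction n generalizing F with
  | zero => rfl
  | succ n ih => exact ih (ins (u 0) F) (fun i => u i.succ)

end Insertion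

/-! ### The graded Lie algebra of the big bracket -/

section BigBracket

open Finset.HasAntidiagonal

theorem sum_antidiagonal_assoc {A : Type*} [AddCommMonoid A] (F : ℕ → ℕ → ℕ → A) (n : ℕ) :
    ∑ p ∈ antidiagonal n, ∑ q ∈ antidiagonal p.2, F p.1 q.1 q.2 =
      ∑ p ∈ antidiagonal n, ∑ q ∈ antidiagonal p.1, F q.1 q.2 p.2 := by
  rw [Finset.sum_sigma', Finset.sum_sigma']
  refine Finset.sum_nbij' (fun x => ⟨(x.1.1 + x.2.1, x.2.2), (x.1.1, x.2.1)⟩)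
    (fun x => ⟨(x.2.1, x.2.2 + x.1.2), (x.2.2, x.1.2)⟩) ?_ ?_ ?_ ?_ ?_
  all_goals
    rintro ⟨⟨i, r⟩, j, l⟩ h
    grind [mem_antidiagonal]

theorem sum_antidiagonal_left_comm {A : Type*} [AddCommMonoid A] (F : ℕ → ℕ → ℕ → A) (n : ℕ) :
    ∑ p ∈ antidiagonal n, ∑ q ∈ antidiagonal p.2, F q.1 p.1 q.2 =
      ∑ p ∈ antidiagonal n, ∑ q ∈ antidiagonal p.2, F p.1 q.1 q.2 := by
  rw [sum_antidiagonal_assoc, sum_antidiagonal_assoc (fun i j l => F j i l)]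
  refine Finset.sum_congr rfl fun p _ => ?_
  rw [← Finset.Nat.sum_antidiagonal_swap]
  rfl

variable {k : Type u} [Field k] {g : Type v} [AddCommGroup g] [Module k g]
  {𝒢 : ℤ → Submodule k g}

/-- The components of `f` with values in `S^n (g[-1])`. -/
def slice (n : ℕ) : Big 𝒢 →ₗ[k] Fam 𝒢 where
  toFun f m := f m n
  map_add' _ _ := rfl
  map_smul' _ _ := rfl

theorem big_ext {f h : Big 𝒢} (H : ∀ n, slice n f = slice n h) : f = h :=
  funext fun m => funext fun n => congrFun (H n) m

/-- The elements of degree `e` of `∏_{m ≥ 0, n ≥ 1} Hom (S^m (g[1]), S^n (g[-1]))[2]`. -/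
def bigHom (e : ℤ) : Submodule k (Big 𝒢) where
  carrier := {f | slice 0 f = 0 ∧ ∀ n, slice n f ∈ famHom (symPart 𝒢 n) e}
  add_mem' := fun hf hh => ⟨by rw [map_add, hf.1, hh.1, add_zero], fun n => by
    rw [map_add]; exact add_mem (hf.2 n) (hh.2 n)⟩
  zero_mem' := ⟨map_zero _, fun n => by rw [map_zero]; exact zero_mem _⟩
  smul_mem' := fun c f hf => ⟨by rw [map_smul, hf.1, smul_zero], fun n => by
    rw [map_smul]; exact Submodule.smul_mem _ c (hf.2 n)⟩

theorem slice_mem_symDeg {e : ℤ} {f : Big 𝒢} (hf : f ∈ bigHom e) (n : ℕ) :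
    slice n f ∈ famHom (symDeg 𝒢) e :=
  famHom_mono (symPart_le_symDeg n) e (hf.2 n)

theorem mem_bigPlus_iff {e : ℤ} {f : Big 𝒢} :
    f ∈ bigPlus 𝒢 e ↔ f ∈ bigHom e ∧ ∀ n, f 0 n = 0 := by
  constructor
  · intro hf
    exact ⟨⟨funext fun m => (hf m 0).1 (Or.inr rfl), fun n m => ⟨(hf m n).2.1, (hf m n).2.2⟩⟩,
      fun n => (hf 0 n).1 (Or.inl rfl)⟩
  · rintro ⟨hf, h0⟩ m n
    refine ⟨?_, (hf.2 n m).1, (hf.2 n m).2⟩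
    rintro (rfl | rfl)
    · exact h0 n
    · exact congrFun hf.1 m

/-- An element of `Ŝ (g[-1])`, without its component in `S^0`, as an element concentrated in
arity zero. -/
def bigEmb (a : ℕ → Sym 𝒢) : Big 𝒢 := fun m n => if n = 0 then 0 else famEmb (a n) m

theorem slice_zero_bigEmb (a : ℕ → Sym 𝒢) : slice 0 (bigEmb a) = 0 := rfl

theorem slice_succ_bigEmb (a : ℕ → Sym 𝒢) (n : ℕ) :
    slice (n + 1) (bigEmb a) = famEmb (a (n + 1)) := rfl

variable (𝒢) in
/-- The grading of `Ŝ (g[-1])[2]`. -/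
abbrev hatShift : ℤ → Submodule k (ℕ → Sym 𝒢) := shift (shift (hatDeg 𝒢) 1) 1

theorem mem_hatShift {p : ℤ} {a : ℕ → Sym 𝒢} :
    a ∈ hatShift 𝒢 p ↔ ∀ n, a n ∈ symPart 𝒢 n (2 + p) := by
  rw [show 2 + p = 1 + (1 + p) by ring]
  rfl

theorem bigEmb_mem {p : ℤ} {a : ℕ → Sym 𝒢} (ha : a ∈ hatShift 𝒢 p) : bigEmb a ∈ bigHom p := by
  rw [mem_hatShift] at ha
  refine ⟨slice_zero_bigEmb a, fun n => ?_⟩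
  rcases n with _ | n
  · rw [slice_zero_bigEmb]
    exact zero_mem _
  · rw [slice_succ_bigEmb]
    exact famEmb_mem (ha _)

variable [DirectSum.Decomposition 𝒢]

theorem slice_circ (e : ℤ) (f h : Big 𝒢) (n : ℕ) :
    slice n (circ 𝒢 e f h) =
      ∑ ij ∈ antidiagonal (n + 1), famCirc e (slice ij.1 f) (slice ij.2 h) := by
  funext m
  rw [Finset.sum_apply]
  exact circ_apply e f h m n

theorem slice_circ_succ (e : ℤ) {f h : Big 𝒢} (hf : slice 0 f = 0) (hh : slice 0 h = 0) (n : ℕ) :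
    slice (n + 1) (circ 𝒢 e f h) =
      ∑ ij ∈ antidiagonal n, famCirc e (slice (ij.1 + 1) f) (slice (ij.2 + 1) h) := by
  rw [slice_circ, Finset.Nat.sum_antidiagonal_succ, Finset.Nat.sum_antidiagonal_succ', hf, hh]
  simp

theorem slice_circ_zero (e : ℤ) {f h : Big 𝒢} (hf : slice 0 f = 0) (hh : slice 0 h = 0) :
    slice 0 (circ 𝒢 e f h) = 0 := by
  rw [slice_circ, Finset.Nat.sum_antidiagonal_succ, Finset.Nat.antidiagonal_zero,
    Finset.sum_singleton, hf, hh]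
  simp

theorem bigBracket_apply (a b : ℤ) (f h : Big 𝒢) :
    bigBracket 𝒢 a b f h = circ 𝒢 b f h - (a * b).negOnePow • circ 𝒢 a h f := rfl

theorem slice_bigBracket_succ (a b : ℤ) {f h : Big 𝒢} (hf : slice 0 f = 0) (hh : slice 0 h = 0)
    (n : ℕ) :
    slice (n + 1) (bigBracket 𝒢 a b f h) =
      ∑ ij ∈ antidiagonal n, famBr a b (slice (ij.1 + 1) f) (slice (ij.2 + 1) h) := by
  rw [bigBracket_apply, map_sub, LinearMap.map_smul_of_tower, slice_circ_succ _ hf hh,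
    slice_circ_succ _ hh hf,
    ← Finset.Nat.sum_antidiagonal_swap (n := n) (f := fun ij : ℕ × ℕ =>
      famCirc a (slice (ij.1 + 1) h) (slice (ij.2 + 1) f)), Finset.smul_sum,
    ← Finset.sum_sub_distrib]
  rfl

theorem slice_bigBracket_zero (a b : ℤ) {f h : Big 𝒢} (hf : slice 0 f = 0) (hh : slice 0 h = 0) :
    slice 0 (bigBracket 𝒢 a b f h) = 0 := by
  rw [bigBracket_apply, map_sub, LinearMap.map_smul_of_tower, slice_circ_zero _ hf hh,
    slice_circ_zero _ hh hf, smul_zero, sub_zero]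

theorem circ_mem {a b : ℤ} {f h : Big 𝒢} (hf : f ∈ bigHom a) (hh : h ∈ bigHom b) :
    circ 𝒢 b f h ∈ bigHom (a + b) := by
  refine ⟨slice_circ_zero _ hf.1 hh.1, fun n => ?_⟩
  rcases n with _ | n
  · rw [slice_circ_zero _ hf.1 hh.1]
    exact zero_mem _
  · rw [slice_circ_succ _ hf.1 hh.1]
    refine Submodule.sum_mem _ fun ij hij => ?_
    rw [mem_antidiagonal] at hij
    refine famCirc_mem (P := symPart 𝒢 (ij.1 + 1)) (Q := symPart 𝒢 (ij.2 + 1))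
      (fun c p φ u hφ hu => ?_) (hf.2 _) (hh.2 _)
    have := der_mem_symPart hφ hu
    rwa [add_right_comm, hij] at this

theorem bigBracket_mem {a b : ℤ} {f h : Big 𝒢} (hf : f ∈ bigHom a) (hh : h ∈ bigHom b) :
    bigBracket 𝒢 a b f h ∈ bigHom (a + b) := by
  rw [bigBracket_apply]
  refine sub_mem (circ_mem hf hh) (Submodule.smul_of_tower_mem _ _ ?_)
  rw [add_comm]
  exact circ_mem hh hf

theorem bigBracket_antisymm (a b : ℤ) (f h : Big 𝒢) :
    bigBracket 𝒢 a b f h = -((a * b).negOnePow • bigBracket 𝒢 b a h f) := by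
  rw [bigBracket_apply, bigBracket_apply, mul_comm b a]
  rcases Int.units_eq_one_or (a * b).negOnePow with h1 | h1 <;>
  · simp only [h1, one_smul, Units.neg_smul]
    abel

theorem bigBracket_jacobi {a b c : ℤ} {f h j : Big 𝒢} (hf : f ∈ bigHom a) (hh : h ∈ bigHom b)
    (hj : j ∈ bigHom c) :
    bigBracket 𝒢 a (b + c) f (bigBracket 𝒢 b c h j) =
      bigBracket 𝒢 (a + b) c (bigBracket 𝒢 a b f h) j +
        (a * b).negOnePow • bigBracket 𝒢 b (a + c) h (bigBracket 𝒢 a c f j) := by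
  have hhj := bigBracket_mem hh hj
  have hfh := bigBracket_mem hf hh
  have hfj := bigBracket_mem hf hj
  refine big_ext fun n => ?_
  rcases n with _ | n
  · rw [map_add, LinearMap.map_smul_of_tower, slice_bigBracket_zero _ _ hf.1 hhj.1,
      slice_bigBracket_zero _ _ hfh.1 hj.1, slice_bigBracket_zero _ _ hh.1 hfj.1, smul_zero,
      add_zero]
  · rw [map_add, LinearMap.map_smul_of_tower, slice_bigBracket_succ _ _ hf.1 hhj.1,
      slice_bigBracket_succ _ _ hfh.1 hj.1, slice_bigBracket_succ _ _ hh.1 hfj.1]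
    simp only [slice_bigBracket_succ _ _ hf.1 hh.1, slice_bigBracket_succ _ _ hf.1 hj.1,
      slice_bigBracket_succ _ _ hh.1 hj.1, map_sum, LinearMap.sum_apply]
    rw [← sum_antidiagonal_assoc (fun x y z => famBr (a + b) c
        (famBr a b (slice (x + 1) f) (slice (y + 1) h)) (slice (z + 1) j)),
      sum_antidiagonal_left_comm (fun x y z => famBr b (a + c) (slice (y + 1) h)
        (famBr a c (slice (x + 1) f) (slice (z + 1) j))), Finset.smul_sum,
      ← Finset.sum_add_distrib]
    refine Finset.sum_congr rfl fun p _ => ?_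
    rw [Finset.smul_sum, ← Finset.sum_add_distrib]
    refine Finset.sum_congr rfl fun q _ => ?_
    exact famBr_isGradedLie.jacobi (slice_mem_symDeg hf _) (slice_mem_symDeg hh _)
      (slice_mem_symDeg hj _)

theorem bigBracket_isGradedLie : IsGradedLie (bigHom (𝒢 := 𝒢)) (bigBracket 𝒢) where
  bracket_mem := bigBracket_mem
  antisymm := bigBracket_antisymm
  jacobi := bigBracket_jacobi

/-- Insertion of an element of `Ŝ (g[-1])` as the first argument, as a derivation in it. -/
def bigIns (a : ℕ → Sym 𝒢) : Big 𝒢 →ₗ[k] Big 𝒢 where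
  toFun f m n := match n with
    | 0 => 0
    | n + 1 => ∑ ij ∈ antidiagonal n, ins (a (ij.2 + 1)) (slice (ij.1 + 1) f) m
  map_add' f h := by
    funext m n
    rcases n with _ | n
    · simp
    · simp [Finset.sum_add_distrib]
  map_smul' c f := by
    funext m n
    rcases n with _ | n
    · simp
    · simp [Finset.smul_sum]

theorem slice_zero_bigIns (a : ℕ → Sym 𝒢) (f : Big 𝒢) : slice 0 (bigIns a f) = 0 := rfl

theorem slice_succ_bigIns (a : ℕ → Sym 𝒢) (f : Big 𝒢) (n : ℕ) :
    slice (n + 1) (bigIns a f) =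
      ∑ ij ∈ antidiagonal n, ins (a (ij.2 + 1)) (slice (ij.1 + 1) f) := by
  funext m
  rw [Finset.sum_apply]
  rfl

theorem bigIns_eq_bigBracket {e p : ℤ} {f : Big 𝒢} {a : ℕ → Sym 𝒢} (hf : f ∈ bigHom e)
    (ha : a ∈ hatShift 𝒢 p) : bigIns a f = bigBracket 𝒢 e p f (bigEmb a) := by
  rw [mem_hatShift] at ha
  refine big_ext fun n => ?_
  rcases n with _ | n
  · rw [slice_bigBracket_zero _ _ hf.1 (slice_zero_bigEmb a), slice_zero_bigIns]
  · rw [slice_bigBracket_succ _ _ hf.1 (slice_zero_bigEmb a), slice_succ_bigIns]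
    refine Finset.sum_congr rfl fun ij _ => ?_
    rw [slice_succ_bigEmb]
    exact ins_eq_famBr (symPart_le_symDeg _ _ (ha _)) (slice_mem_symDeg hf _)

theorem bigIns_bigEmb (a b : ℕ → Sym 𝒢) : bigIns b (bigEmb a) = 0 := by
  refine big_ext fun n => ?_
  rcases n with _ | n
  · rfl
  · rw [slice_succ_bigIns, map_zero]
    refine Finset.sum_eq_zero fun ij _ => ?_
    rw [slice_succ_bigEmb, ins_famEmb]

theorem bigIns_isDerivedAction :
    IsDerivedAction (bigHom (𝒢 := 𝒢)) (bigBracket 𝒢) (hatShift 𝒢) bigEmb bigIns where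
  lie := bigBracket_isGradedLie
  emb_mem := bigEmb_mem
  act_eq := bigIns_eq_bigBracket
  act_emb _ _ := bigIns_bigEmb _ _

end BigBracket

/-! ### The brackets as derived brackets -/

section Brackets

open Finset.HasAntidiagonal Finset.Nat

theorem sum_antidiagonal_eq_single_left {A : Type*} [AddCommMonoid A] {F : ℕ × ℕ → A}
    (hF : ∀ i j, F (i + 1, j) = 0) (n : ℕ) : ∑ p ∈ antidiagonal n, F p = F (0, n) := by
  rcases n with _ | n
  · simp
  · simp [Finset.Nat.sum_antidiagonal_succ, hF]

theorem sum_antidiagonal_eq_single_right {A : Type*} [AddCommMonoid A] {F : ℕ × ℕ → A}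
    (hF : ∀ i j, F (i, j + 1) = 0) (n : ℕ) : ∑ p ∈ antidiagonal n, F p = F (n, 0) := by
  rcases n with _ | n
  · simp
  · simp [Finset.Nat.sum_antidiagonal_succ', hF]

theorem sum_antidiagonalTuple_succ {A : Type*} [AddCommMonoid A] (n q : ℕ)
    (G : (Fin (n + 1) → ℕ) → A) :
    ∑ ν ∈ antidiagonalTuple (n + 1) q, G ν =
      ∑ p ∈ antidiagonal q, ∑ ν ∈ antidiagonalTuple n p.2, G (Fin.cons p.1 ν) := by
  rw [Finset.sum_sigma']
  refine Finset.sum_nbij' (fun ν => ⟨(ν 0, ∑ i : Fin n, ν i.succ), fun i => ν i.succ⟩)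
    (fun x => Fin.cons x.1.1 x.2) ?_ ?_ ?_ ?_ ?_
  · intro ν h
    rw [mem_antidiagonalTuple, Fin.sum_univ_succ] at h
    simp [mem_antidiagonalTuple, h]
  · rintro ⟨⟨i, r⟩, ν⟩ h
    simp only [Finset.mem_sigma, mem_antidiagonal, mem_antidiagonalTuple] at h ⊢
    simp [Fin.sum_univ_succ, h]
  · intro ν _
    exact Fin.cons_self_tail ν
  · rintro ⟨⟨i, r⟩, ν⟩ h
    simp only [Finset.mem_sigma, mem_antidiagonal, mem_antidiagonalTuple] at h
    obtain ⟨-, rfl⟩ := h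
    simp
  · intro ν _
    exact congrArg G (Fin.cons_self_tail ν).symm

variable {k : Type u} [Field k] {g : Type v} [AddCommGroup g] [Module k g]
  {𝒢 : ℤ → Submodule k g} (l : ∀ n : ℕ, MultilinearMap k (fun _ : Fin n => g) g)

variable (𝒢) in
/-- The brackets of `g`, with values in `S (g[-1])`. -/
def famL : Fam 𝒢 := fun m => (gen 𝒢).compMultilinearMap (l m)

theorem slice_bigElement_of_ne {n : ℕ} (hn : n ≠ 1) : slice n (bigElement 𝒢 l) = 0 := by
  funext m
  exact if_neg hn

variable {l}

theorem famL_mem (hl : IsLInfinity 𝒢 l) : famL 𝒢 l ∈ famHom (symPart 𝒢 1) 1 := by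
  intro m
  refine ⟨fun d x hx i j hij => ?_, fun d x hx => ?_⟩
  · change gen 𝒢 (l m _) = _ • gen 𝒢 (l m x)
    rw [hl.symm m d x hx i j hij, LinearMap.map_smul_of_tower]
  · exact gen_mem_symPart (mem_shift_one.1 (hl.degree m d x hx))

theorem bigElement_mem (hl : IsLInfinity 𝒢 l) : bigElement 𝒢 l ∈ bigHom 1 := by
  refine ⟨slice_bigElement_of_ne l zero_ne_one, fun n => ?_⟩
  by_cases hn : n = 1
  · subst hn
    exact famL_mem hl
  · rw [slice_bigElement_of_ne l hn]
    exact zero_mem _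

theorem bigElement_mem_bigPlus (hl : IsLInfinity 𝒢 l) : bigElement 𝒢 l ∈ bigPlus 𝒢 1 := by
  refine mem_bigPlus_iff.2 ⟨bigElement_mem hl, fun n => ?_⟩
  unfold bigElement
  split_ifs
  · rw [hl.zero]
    ext
    simp
  · rfl

variable [DirectSum.Decomposition 𝒢]

theorem ev0_iter_bigIns (n : ℕ) (x : Fin n → ℕ → Sym 𝒢) (f : Big 𝒢) (q : ℕ) :
    ev0 (slice (q + 1) (iter bigIns n x f)) =
      ∑ p ∈ antidiagonal q, ∑ ν ∈ antidiagonalTuple n p.2,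
        ext 𝒢 n (f n (p.1 + 1)) (fun i => x i (ν i + 1)) := by
  induction n generalizing f q with
  | zero =>
    rw [sum_antidiagonal_eq_single_right fun _ _ => by simp, antidiagonalTuple_zero_zero,
      Finset.sum_singleton]
    rfl
  | succ n ih =>
    rw [iter_succ, ih]
    simp only [sum_antidiagonalTuple_succ n]
    rw [sum_antidiagonal_assoc (fun a b c => ∑ ν ∈ antidiagonalTuple n c,
      ext 𝒢 (n + 1) (f (n + 1) (a + 1))
        (fun i => x i ((Fin.cons b ν : Fin (n + 1) → ℕ) i + 1)))]
    refine Finset.sum_congr rfl fun p _ => ?_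
    rw [Finset.sum_comm]
    refine Finset.sum_congr rfl fun ν _ => ?_
    have h : bigIns (x 0) f n (p.1 + 1) =
      ∑ ij ∈ antidiagonal p.1, insertArg 𝒢 n (x 0 (ij.2 + 1)) (f (n + 1) (ij.1 + 1)) := rfl
    rw [h, map_sum, sum_apply]
    rfl

theorem slice_zero_iter_bigIns (n : ℕ) (x : Fin n → ℕ → Sym 𝒢) {f : Big 𝒢} (hf : slice 0 f = 0) :
    slice 0 (iter bigIns n x f) = 0 := by
  induction n generalizing f with
  | zero => exact hf
  | succ n ih => exact ih _ (slice_zero_bigIns _ _)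

theorem slice_bigIns_hatGen (y : g) (f : Big 𝒢) (n : ℕ) :
    slice (n + 1) (bigIns (hatGen 𝒢 y) f) = contract y (slice (n + 1) f) := by
  have hone : hatGen 𝒢 y (0 + 1) = gen 𝒢 y := by simp [hatGen]
  rw [slice_succ_bigIns, sum_antidiagonal_eq_single_right, hone, ins_gen]
  intro i j
  have hzero : hatGen 𝒢 y (j + 1 + 1) = 0 := by simp [hatGen]
  rw [hzero]
  funext m
  exact LinearMap.map_zero₂ (insertArg 𝒢 m) _

theorem slice_iter_bigIns_hatGen (m : ℕ) (y : Fin m → g) (f : Big 𝒢) (q : ℕ) :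
    slice (q + 1) (iter bigIns m (fun i => hatGen 𝒢 (y i)) f) =
      iter contract m y (slice (q + 1) f) := by
  induction m generalizing f with
  | zero => rfl
  | succ m ih =>
    refine (ih (fun i => y i.succ) _).trans ?_
    rw [slice_bigIns_hatGen]
    rfl

variable (l)

theorem hatBracket_eq_ev0 (n : ℕ) (x : Fin n → ℕ → Sym 𝒢) (q : ℕ) :
    hatBracket 𝒢 l n x q =
      ev0 (slice q (iter bigIns n x (bigElement 𝒢 l))) := by
  rcases q with _ | q
  · rw [slice_zero_iter_bigIns n x (slice_bigElement_of_ne l zero_ne_one), map_zero]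
    rfl
  · have hsum : hatBracket 𝒢 l n x (q + 1) = (∑ ν ∈ antidiagonalTuple n q,
        (symBracket 𝒢 l n).compLinearMap fun i => LinearMap.proj (ν i + 1)) x := rfl
    have hzero (i : ℕ) : bigElement 𝒢 l n (i + 1 + 1) = 0 := if_neg (by omega)
    rw [ev0_iter_bigIns, sum_antidiagonal_eq_single_left fun i j => by simp [hzero], hsum,
      sum_apply]
    rfl

theorem iter_bigIns_apply (n : ℕ) (x : Fin n → ℕ → Sym 𝒢) (m q : ℕ) (y : Fin m → g) :
    iter bigIns n x (bigElement 𝒢 l) m q y =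
      hatBracket 𝒢 l (n + m) (Fin.append x (fun i => hatGen 𝒢 (y i))) q := by
  rcases q with _ | q
  · exact congrArg (· m y)
      (slice_zero_iter_bigIns n x (slice_bigElement_of_ne (𝒢 := 𝒢) l zero_ne_one))
  · rw [hatBracket_eq_ev0, iter_append, slice_iter_bigIns_hatGen, ← apply_eq_iter]
    rfl

theorem phi_zero_apply (n : ℕ) (x : Fin n → ℕ → Sym 𝒢) (q : ℕ) : phi 𝒢 l n x 0 q = 0 := by
  simp [phi]

theorem phi_succ_apply (n : ℕ) (x : Fin n → ℕ → Sym 𝒢) (m q : ℕ) :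
    phi 𝒢 l n x (m + 1) q = iter bigIns n x (bigElement 𝒢 l) (m + 1) q := by
  ext y
  rw [phi_apply 𝒢 l n x (m + 1) q (Nat.succ_ne_zero m), iter_bigIns_apply]

theorem iter_bigIns_eq (n : ℕ) (x : Fin n → ℕ → Sym 𝒢) :
    iter bigIns n x (bigElement 𝒢 l) =
      phi 𝒢 l n x + bigEmb (hatBracket 𝒢 l n x) := by
  funext m q
  rcases m with _ | m
  · rw [Pi.add_apply, Pi.add_apply, phi_zero_apply, zero_add]
    ext y
    rw [Subsingleton.elim y Fin.elim0]
    change ev0 (slice q (iter bigIns n x (bigElement 𝒢 l))) = _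
    rw [← hatBracket_eq_ev0]
    rcases q with _ | q <;> rfl
  · rw [Pi.add_apply, Pi.add_apply, phi_succ_apply]
    have hzero : bigEmb (hatBracket 𝒢 l n x) (m + 1) q = 0 := by simp [bigEmb, famEmb]
    rw [hzero, add_zero]

variable {l}

theorem famL_snoc (hl : IsLInfinity 𝒢 l)
    {n : ℕ} {d : Fin n → ℤ} {x : Fin n → g} (hx : ∀ i, x i ∈ shift 𝒢 1 (d i))
    {q : ℤ} {y : g} (hy : y ∈ shift 𝒢 1 q) :
    famL 𝒢 l (n + 1) (Fin.snoc (α := fun _ => g) x y) =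
      (q * ∑ i, d i).negOnePow • famL 𝒢 l (n + 1) (Fin.cons y x) := by
  rw [apply_eq_iter, apply_eq_iter, iter_snoc, iter_cons,
    (contract_gradedAction _).act_iter hx (famL_mem hl) hy, LinearMap.map_smul_of_tower]

theorem famCirc_famL (hl : IsLInfinity 𝒢 l) : famCirc 1 (famL 𝒢 l) (famL 𝒢 l) = 0 := by
  funext m
  refine mult_ext (𝒢 := 𝒢) fun d x hx => ?_
  have hj := congrArg (gen 𝒢) (hl.jacobi m d x hx)
  rw [map_zero, map_sum, ← Equiv.sum_comp (compl_involutive (α := Finset (Fin m))).toPerm] at hj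
  rw [famCirc_apply _ _ _ hx]
  refine Eq.trans (Finset.sum_congr rfl fun S _ => ?_) hj
  rw [Function.Involutive.coe_toPerm, compl_compl]
  have hv := hl.degree _ _ _ (sub_mem_of_mem Sᶜ hx)
  have hL : famL 𝒢 l Sᶜ.card (sub x Sᶜ) = gen 𝒢 (l Sᶜ.card (sub x Sᶜ)) := rfl
  rw [hL, der_gen, MultilinearMap.curryRight_apply, famL_snoc hl (sub_mem_of_mem S hx) hv,
    smul_smul, LinearMap.map_smul_of_tower, koszul_compl, sum_sub, sum_sub]
  congr 1
  rw [mul_assoc, ← Int.negOnePow_add]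
  congr 1
  apply negOnePow_congr
  simp only [Int.even_add, Int.even_mul, Int.not_even_one]
  tauto

theorem circ_bigElement (hl : IsLInfinity 𝒢 l) :
    circ 𝒢 1 (bigElement 𝒢 l) (bigElement 𝒢 l) = 0 := by
  have h0 := slice_bigElement_of_ne (𝒢 := 𝒢) l zero_ne_one
  refine big_ext fun n => ?_
  rcases n with _ | n
  · rw [slice_circ_zero _ h0 h0, map_zero]
  · rw [slice_circ_succ _ h0 h0, map_zero]
    refine Finset.sum_eq_zero fun ij _ => ?_
    by_cases h1 : ij.1 = 0
    · by_cases h2 : ij.2 = 0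
      · rw [h1, h2]
        exact famCirc_famL hl
      · rw [slice_bigElement_of_ne l (n := ij.2 + 1) (by omega), map_zero]
    · rw [slice_bigElement_of_ne l (n := ij.1 + 1) (by omega), map_zero, LinearMap.zero_apply]

theorem bigBracket_bigElement (hl : IsLInfinity 𝒢 l) :
    bigBracket 𝒢 1 1 (bigElement 𝒢 l) (bigElement 𝒢 l) = 0 := by
  rw [bigBracket_apply, circ_bigElement hl, smul_zero, sub_zero]

end Brackets

/-! ### The multiderivations of the symmetric algebra -/

section Morphism

open Finset.HasAntidiagonal

variable {k : Type u} [Field k] {g : Type v} [AddCommGroup g] [Module k g]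
  {𝒢 : ℤ → Submodule k g} [DirectSum.Decomposition 𝒢]
  {l : ∀ n : ℕ, MultilinearMap k (fun _ : Fin n => g) g}

theorem symBracket_eq_ev0 (n : ℕ) (u : Fin n → Sym 𝒢) :
    symBracket 𝒢 l n u = ev0 (iter ins n u (famL 𝒢 l)) :=
  ext_eq_iter (famL 𝒢 l) n u

theorem iter_ins_gen (n : ℕ) (x : Fin n → g) (F : Fam 𝒢) :
    iter ins n (fun i => gen 𝒢 (x i)) F = iter contract n x F := by
  induction n generalizing F with
  | zero => rfl
  | succ n ih =>
    refine (ih (fun i => x i.succ) _).trans ?_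
    rw [ins_gen]
    rfl

theorem symBracket_isMultiderivationExtension (hl : IsLInfinity 𝒢 l) :
    IsMultiderivationExtension 𝒢 l (symBracket 𝒢 l) := by
  have hL : famL 𝒢 l ∈ famHom (symDeg 𝒢) 1 :=
    famHom_mono (symPart_le_symDeg 1) 1 (famL_mem hl)
  refine ⟨fun n x => ?_, fun n d x hx i j hij => ?_, fun n d a ha => ?_,
    fun n d a p b c ha hb => ?_⟩
  · rw [symBracket_eq_ev0, iter_ins_gen, ← apply_eq_iter]
    rfl
  · rw [symBracket_eq_ev0, symBracket_eq_ev0,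
      ins_isDerivedAction.gradedAction.iter_swap hx hL hij, LinearMap.map_smul_of_tower]
  · rw [symBracket_eq_ev0, add_comm _ (1 : ℤ)]
    exact ev0_mem (ins_isDerivedAction.gradedAction.iter_mem ha hL)
  · have hd := ev1_hasDegree (ins_isDerivedAction.gradedAction.iter_mem ha hL)
    simp only [symBracket_eq_ev0, iter_snoc, ev0_ins]
    rw [der_mul hd hb, mul_comm p]

/-! ### The components of the morphism -/

theorem hatBracket_eq_zero {n : ℕ} (h : l n = 0) : hatBracket 𝒢 l n = 0 := by
  have h0 : symBracket 𝒢 l n = 0 := by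
    have hgen : (gen 𝒢).compMultilinearMap (l n) = 0 := by
      rw [h]
      ext
      simp
    rw [symBracket, hgen, map_zero]
  refine MultilinearMap.ext fun x => funext fun q => ?_
  rcases q with _ | q
  · rfl
  · have hsum : hatBracket 𝒢 l n x (q + 1) = (∑ ν ∈ Finset.Nat.antidiagonalTuple n q,
        (symBracket 𝒢 l n).compLinearMap fun i => LinearMap.proj (ν i + 1)) x := rfl
    rw [hsum, sum_apply]
    exact Finset.sum_eq_zero fun ν _ => by rw [h0]; rfl

theorem iter_bigIns_mem (hl : IsLInfinity 𝒢 l) {n : ℕ} {d : Fin n → ℤ} {x : Fin n → ℕ → Sym 𝒢}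
    (hx : ∀ i, x i ∈ hatShift 𝒢 (d i)) :
    iter bigIns n x (bigElement 𝒢 l) ∈ bigHom (1 + ∑ i, d i) :=
  bigIns_isDerivedAction.gradedAction.iter_mem hx (bigElement_mem hl)

theorem hatBracket_mem (hl : IsLInfinity 𝒢 l) {n : ℕ} {d : Fin n → ℤ} {x : Fin n → ℕ → Sym 𝒢}
    (hx : ∀ i, x i ∈ hatShift 𝒢 (d i)) : hatBracket 𝒢 l n x ∈ hatShift 𝒢 (1 + ∑ i, d i) := by
  refine mem_hatShift.2 fun q => ?_
  rw [hatBracket_eq_ev0]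
  exact ev0_mem ((iter_bigIns_mem hl hx).2 q)

theorem phi_mem (hl : IsLInfinity 𝒢 l) {n : ℕ} {d : Fin n → ℤ} {x : Fin n → ℕ → Sym 𝒢}
    (hx : ∀ i, x i ∈ hatShift 𝒢 (d i)) : phi 𝒢 l n x ∈ bigPlus 𝒢 (1 + ∑ i, d i) := by
  have h := iter_bigIns_mem hl hx
  refine mem_bigPlus_iff.2 ⟨⟨funext fun m => ?_, fun q m => ?_⟩, phi_zero_apply l n x⟩
  · change phi 𝒢 l n x m 0 = 0
    rcases m with _ | m
    · exact phi_zero_apply l n x 0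
    · rw [phi_succ_apply]
      exact congrFun h.1 (m + 1)
  · have hs : slice q (phi 𝒢 l n x) m = phi 𝒢 l n x m q := rfl
    rw [hs]
    rcases m with _ | m
    · rw [phi_zero_apply]
      exact (zero_mem (famHom (symPart 𝒢 q) (1 + ∑ i, d i))) 0
    · rw [phi_succ_apply]
      exact h.2 q (m + 1)

theorem phi_zero (hl : IsLInfinity 𝒢 l) (x : Fin 0 → ℕ → Sym 𝒢) :
    phi 𝒢 l 0 x = bigElement 𝒢 l := by
  funext m q
  rcases m with _ | m
  · rw [phi_zero_apply, (mem_bigPlus_iff.1 (bigElement_mem_bigPlus hl)).2]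
  · rw [phi_succ_apply]
    rfl

theorem phi_isGradedSymm (hl : IsLInfinity 𝒢 l) (n : ℕ) :
    IsGradedSymm (hatShift 𝒢) (phi 𝒢 l n) := by
  intro d x hx i j hij
  funext m q
  change _ = (d i * d j).negOnePow • phi 𝒢 l n x m q
  rcases m with _ | m
  · rw [phi_zero_apply, phi_zero_apply, smul_zero]
  · rw [phi_succ_apply, phi_succ_apply,
      bigIns_isDerivedAction.gradedAction.iter_swap hx (bigElement_mem hl) hij]
    rfl

theorem hatBracket_isGradedSymm (hl : IsLInfinity 𝒢 l) (n : ℕ) :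
    IsGradedSymm (hatShift 𝒢) (hatBracket 𝒢 l n) := by
  intro d x hx i j hij
  funext q
  change _ = (d i * d j).negOnePow • hatBracket 𝒢 l n x q
  rw [hatBracket_eq_ev0, hatBracket_eq_ev0,
    bigIns_isDerivedAction.gradedAction.iter_swap hx (bigElement_mem hl) hij,
    LinearMap.map_smul_of_tower, LinearMap.map_smul_of_tower]

/-! ### The dg Lie algebra of the big bracket -/

theorem circ_zero_apply (e : ℤ) (f : Big 𝒢) {h : Big 𝒢} (hh : ∀ n, h 0 n = 0) (n : ℕ) :
    circ 𝒢 e f h 0 n = 0 := by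
  ext x
  rw [Subsingleton.elim x Fin.elim0]
  change ev0 (slice n (circ 𝒢 e f h)) = 0
  rw [slice_circ, map_sum]
  refine Finset.sum_eq_zero fun ij _ => ?_
  have h0 : ev0 (slice ij.2 h) = 0 := by
    change h 0 ij.2 Fin.elim0 = 0
    rw [hh]
    rfl
  rw [ev0_famCirc, h0, map_zero]

theorem bigBracket_mem_bigPlus {a b : ℤ} {f h : Big 𝒢} (hf : f ∈ bigPlus 𝒢 a)
    (hh : h ∈ bigPlus 𝒢 b) : bigBracket 𝒢 a b f h ∈ bigPlus 𝒢 (a + b) := by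
  rw [mem_bigPlus_iff] at hf hh ⊢
  refine ⟨bigBracket_mem hf.1 hh.1, fun n => ?_⟩
  change circ 𝒢 b f h 0 n - (a * b).negOnePow • circ 𝒢 a h f 0 n = 0
  rw [circ_zero_apply b f hh.2, circ_zero_apply a h hf.2, smul_zero, sub_zero]

theorem bigPlus_isDGLie [NeZero (2 : k)] (hl : IsLInfinity 𝒢 l) :
    IsDGLie (bigPlus 𝒢) (bigBracket 𝒢) (bigD 𝒢 l) := by
  have hL := bigElement_mem hl
  refine ⟨fun a b f h hf hh => bigBracket_mem_bigPlus hf hh, fun a f hf => ?_,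
    fun a b f h _ _ => bigBracket_antisymm a b f h, fun a b c f h j hf hh hj => ?_,
    fun a f hf => ?_, fun a b f h hf hh => ?_⟩
  · rw [add_comm a]
    exact bigBracket_mem_bigPlus (bigElement_mem_bigPlus hl) hf
  · rw [mem_bigPlus_iff] at hf hh hj
    exact bigBracket_jacobi hf.1 hh.1 hj.1
  · rw [mem_bigPlus_iff] at hf
    have hj := bigBracket_jacobi hL hL hf.1
    rw [bigBracket_bigElement hl, map_zero, LinearMap.zero_apply, zero_add, mul_one,
      Int.negOnePow_one, Units.neg_smul, one_smul, eq_neg_iff_add_eq_zero, ← two_smul k,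
      smul_eq_zero_iff_right two_ne_zero] at hj
    rw [add_comm a]
    exact hj
  · rw [mem_bigPlus_iff] at hf hh
    have hj := bigBracket_jacobi hL hf.1 hh.1
    rw [one_mul] at hj
    rw [add_comm a 1, add_comm b 1]
    exact hj

/-! ### The morphism -/

variable (𝒢 l) in
/-- The summand indexed by `S` of the sum of brackets in the morphism identity: the signed bracket
of the components of `φ` on the entries of `x` in `S` and on the remaining ones. -/
def phiBracketTerm {n : ℕ} (d : Fin n → ℤ) (x : Fin n → ℕ → Sym 𝒢) (S : Finset (Fin n)) : Big 𝒢 :=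
  (koszul d S * (∑ i ∈ S, d i).negOnePow) •
    bigBracket 𝒢 (1 + ∑ i ∈ S, d i) (1 + ∑ i ∈ Sᶜ, d i)
      (phi 𝒢 l S.card (sub x S)) (phi 𝒢 l Sᶜ.card (sub x Sᶜ))

variable {n : ℕ} {d : Fin n → ℤ} {x : Fin n → ℕ → Sym 𝒢}

theorem phiBracketTerm_zero_apply (hl : IsLInfinity 𝒢 l) (hx : ∀ i, x i ∈ hatShift 𝒢 (d i))
    (S : Finset (Fin n)) (q : ℕ) : phiBracketTerm 𝒢 l d x S 0 q = 0 := by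
  have hS := bigBracket_mem_bigPlus (phi_mem hl (sub_mem_of_mem S hx))
    (phi_mem hl (sub_mem_of_mem Sᶜ hx))
  rw [sum_sub, sum_sub, mem_bigPlus_iff] at hS
  exact (congrArg ((koszul d S * (∑ i ∈ S, d i).negOnePow) • ·) (hS.2 q)).trans (smul_zero _)

theorem phiBracketTerm_empty (hl : IsLInfinity 𝒢 l) (d : Fin n → ℤ) (x : Fin n → ℕ → Sym 𝒢) :
    phiBracketTerm 𝒢 l d x ∅ = bigD 𝒢 l (1 + ∑ i, d i) (phi 𝒢 l n x) := by
  rw [phiBracketTerm, apply_sub_empty (fun n z => phi 𝒢 l n z) x Fin.elim0, Finset.compl_empty,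
    apply_sub_univ (fun n z => phi 𝒢 l n z), phi_zero hl, koszul_empty, Finset.sum_empty,
    add_zero, Int.negOnePow_zero, mul_one, one_smul]
  rfl

theorem phiBracketTerm_univ (hl : IsLInfinity 𝒢 l) (d : Fin n → ℤ) (x : Fin n → ℕ → Sym 𝒢) :
    phiBracketTerm 𝒢 l d x Finset.univ = bigD 𝒢 l (1 + ∑ i, d i) (phi 𝒢 l n x) := by
  rw [phiBracketTerm, apply_sub_univ (fun n z => phi 𝒢 l n z), Finset.compl_univ,
    apply_sub_empty (fun n z => phi 𝒢 l n z) x Fin.elim0, phi_zero hl, koszul_univ,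
    Finset.sum_empty, add_zero, one_mul, bigBracket_antisymm, smul_neg, smul_smul,
    ← Units.neg_smul, ← Int.negOnePow_add, ← Int.negOnePow_succ, Int.negOnePow_even, one_smul]
  · rfl
  · simp only [Int.even_add, Int.even_mul, Int.not_even_one]
    tauto

theorem sum_phiBracketTerm_add_iter_bigIns (hl : IsLInfinity 𝒢 l)
    (hx : ∀ i, x i ∈ hatShift 𝒢 (d i)) :
    ∑ S : Finset (Fin n), phiBracketTerm 𝒢 l d x S +
      (2 : ℤ) • ∑ S : Finset (Fin n), koszul d S • iter bigIns (Sᶜ.card + 1)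
        (Fin.cons (hatBracket 𝒢 l S.card (sub x S)) (sub x Sᶜ)) (bigElement 𝒢 l) = 0 :=
  bigIns_isDerivedAction.derived_identity (φ := fun n x => phi 𝒢 l n x)
    (L := fun n x => hatBracket 𝒢 l n x) (bigElement_mem hl) (bigBracket_bigElement hl)
    (fun hx => hatBracket_mem hl hx) (iter_bigIns_eq l) hx

theorem hatBracket_jacobi [NeZero (2 : k)] (hl : IsLInfinity 𝒢 l)
    (hx : ∀ i, x i ∈ hatShift 𝒢 (d i)) :
    ∑ S : Finset (Fin n), koszul d S • hatBracket 𝒢 l (Sᶜ.card + 1)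
      (Fin.cons (hatBracket 𝒢 l S.card (sub x S)) (sub x Sᶜ)) = 0 := by
  funext q
  have h := congrArg (fun f => ev0 (slice q f)) (sum_phiBracketTerm_add_iter_bigIns hl hx)
  have hterm (S : Finset (Fin n)) : ev0 (slice q (phiBracketTerm 𝒢 l d x S)) = 0 :=
    congrArg (· Fin.elim0) (phiBracketTerm_zero_apply hl hx S q)
  simp only [map_add, map_sum, LinearMap.map_smul_of_tower, map_zsmul, map_zero, hterm,
    Finset.sum_const_zero, zero_add, ← hatBracket_eq_ev0] at h
  rw [← Int.cast_smul_eq_zsmul k, Int.cast_ofNat, smul_eq_zero_iff_right two_ne_zero] at h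
  rw [Finset.sum_apply]
  exact h

theorem hatBracket_isLInfinity [NeZero (2 : k)] (hl : IsLInfinity 𝒢 l) :
    IsLInfinity (shift (hatDeg 𝒢) 1) (hatBracket 𝒢 l) where
  zero := hatBracket_eq_zero hl.zero
  symm := hatBracket_isGradedSymm hl
  degree := fun n d x hx => by
    rw [add_comm _ (1 : ℤ)]
    exact hatBracket_mem hl hx
  jacobi := fun _ _ _ hx => hatBracket_jacobi hl hx

theorem sum_phiBracketTerm_add_phi (hl : IsLInfinity 𝒢 l) (hx : ∀ i, x i ∈ hatShift 𝒢 (d i)) :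
    ∑ S : Finset (Fin n), phiBracketTerm 𝒢 l d x S +
      (2 : ℤ) • ∑ S : Finset (Fin n), koszul d S • phi 𝒢 l (Sᶜ.card + 1)
        (Fin.cons (hatBracket 𝒢 l S.card (sub x S)) (sub x Sᶜ)) = 0 := by
  funext m q
  rcases m with _ | m
  · simp only [Pi.add_apply, Pi.smul_apply, Finset.sum_apply, Pi.zero_apply,
      phiBracketTerm_zero_apply hl hx, Finset.sum_const_zero, zero_add]
    rw [Finset.sum_eq_zero, smul_zero]
    intro S _
    exact (congrArg (koszul d S • ·) (phi_zero_apply l _ _ q)).trans (smul_zero _)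
  · have h := congrFun (congrFun (sum_phiBracketTerm_add_iter_bigIns hl hx) (m + 1)) q
    simp only [Pi.add_apply, Pi.smul_apply, Finset.sum_apply] at h ⊢
    refine Eq.trans ?_ h
    congr 2
    refine Finset.sum_congr rfl fun S _ => ?_
    exact congrArg (koszul d S • ·) (phi_succ_apply l _ _ m q)

theorem sum_phi_cons_hatBracket_eq_sum_nonempty (hl : IsLInfinity 𝒢 l) (d : Fin n → ℤ)
    (x : Fin n → ℕ → Sym 𝒢) :
    ∑ S : Finset (Fin n), koszul d S • phi 𝒢 l (Sᶜ.card + 1)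
        (Fin.cons (hatBracket 𝒢 l S.card (sub x S)) (sub x Sᶜ)) =
      ∑ S : Finset (Fin n) with S.Nonempty, koszul d S • phi 𝒢 l (Sᶜ.card + 1)
        (Fin.cons (hatBracket 𝒢 l S.card (sub x S)) (sub x Sᶜ)) := by
  refine (Finset.sum_filter_of_ne fun S _ hS => ?_).symm
  rw [Finset.nonempty_iff_ne_empty]
  rintro rfl
  have hbracket : hatBracket 𝒢 l (∅ : Finset (Fin n)).card (sub x ∅) = 0 := by
    rw [hatBracket_eq_zero (by rw [Finset.card_empty, hl.zero])]
    rfl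
  rw [hbracket, (phi 𝒢 l _).map_coord_zero 0 rfl, smul_zero] at hS
  exact hS rfl

theorem sum_finset_eq_add_sum_proper {α A : Type*} [Fintype α] [DecidableEq α] [Nonempty α]
    [AddCommMonoid A] (T : Finset α → A) :
    ∑ S : Finset α, T S =
      T ∅ + T Finset.univ + ∑ S : Finset α with S.Nonempty ∧ Sᶜ.Nonempty, T S := by
  have hfilter : (Finset.univ : Finset (Finset α)).filter
      (fun S => ¬(S.Nonempty ∧ Sᶜ.Nonempty)) = {∅, Finset.univ} := by
    ext S
    simp only [Finset.mem_filter, Finset.mem_univ, true_and, Finset.mem_insert,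
      Finset.mem_singleton, not_and_or, Finset.not_nonempty_iff_eq_empty,
      Finset.compl_eq_empty_iff]
  rw [← Finset.sum_filter_add_sum_filter_not Finset.univ
    (fun S : Finset α => S.Nonempty ∧ Sᶜ.Nonempty), hfilter,
    Finset.sum_pair Finset.univ_nonempty.ne_empty.symm, add_comm]

theorem phi_compat [NeZero (2 : k)] (hl : IsLInfinity 𝒢 l) (hn : 1 ≤ n)
    (hx : ∀ i, x i ∈ hatShift 𝒢 (d i)) :
    -bigD 𝒢 l (1 + ∑ i, d i) (phi 𝒢 l n x)
      + (2⁻¹ : k) • ∑ S : Finset (Fin n) with S.Nonempty ∧ Sᶜ.Nonempty,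
          koszul d S • (1 + ∑ i ∈ S, d i).negOnePow •
            bigBracket 𝒢 (1 + ∑ i ∈ S, d i) (1 + ∑ i ∈ Sᶜ, d i)
              (phi 𝒢 l S.card (sub x S)) (phi 𝒢 l Sᶜ.card (sub x Sᶜ))
    = ∑ S : Finset (Fin n) with S.Nonempty,
        koszul d S • phi 𝒢 l (Sᶜ.card + 1)
          (Fin.cons (hatBracket 𝒢 l S.card (sub x S)) (sub x Sᶜ)) := by
  have : Nonempty (Fin n) := ⟨⟨0, hn⟩⟩
  have hterm (S : Finset (Fin n)) : koszul d S • (1 + ∑ i ∈ S, d i).negOnePow •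
      bigBracket 𝒢 (1 + ∑ i ∈ S, d i) (1 + ∑ i ∈ Sᶜ, d i)
        (phi 𝒢 l S.card (sub x S)) (phi 𝒢 l Sᶜ.card (sub x Sᶜ)) =
      -phiBracketTerm 𝒢 l d x S := by
    rw [phiBracketTerm, smul_smul, ← Units.neg_smul, add_comm (1 : ℤ), Int.negOnePow_succ, mul_neg]
  have identity := sum_phiBracketTerm_add_phi hl hx
  rw [sum_finset_eq_add_sum_proper, phiBracketTerm_empty hl, phiBracketTerm_univ hl, ← two_zsmul,
    sum_phi_cons_hatBracket_eq_sum_nonempty hl, ← Int.cast_smul_eq_zsmul k,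
    ← Int.cast_smul_eq_zsmul k, Int.cast_ofNat, add_right_comm, ← smul_add,
    ← eq_neg_iff_add_eq_zero] at identity
  rw [Finset.sum_congr rfl fun S _ => hterm S, Finset.sum_neg_distrib, ← identity, smul_smul,
    inv_mul_cancel₀ two_ne_zero, one_smul, neg_add_cancel_left]

theorem phi_isLInfinityMorphism [NeZero (2 : k)] (hl : IsLInfinity 𝒢 l) :
    IsLInfinityMorphism (shift (hatDeg 𝒢) 1) (hatBracket 𝒢 l) (bigPlus 𝒢) (bigBracket 𝒢)
      (bigD 𝒢 l) (phi 𝒢 l) where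
  source := hatBracket_isLInfinity hl
  target := bigPlus_isDGLie hl
  symm := fun n _ => phi_isGradedSymm hl n
  degree := fun _ _ _ _ hx => phi_mem hl hx
  compat := fun _ hn _ _ hx => phi_compat hl hn hx

end Morphism

/-! ### Exponentials of the derived action -/

section Exponential

open Finset.HasAntidiagonal

theorem sum_antidiagonal_succ_smul {R A : Type*} [Semiring R] [AddCommMonoid A] [Module R A]
    (B : ℕ → ℕ → A) (n : ℕ) :
    ∑ p ∈ antidiagonal n, (((p.1 + 1 : ℕ) : R) • B (p.1 + 1) p.2 +
        ((p.2 + 1 : ℕ) : R) • B p.1 (p.2 + 1)) =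
      ((n + 1 : ℕ) : R) • ∑ p ∈ antidiagonal (n + 1), B p.1 p.2 := by
  have hleft : ∑ p ∈ antidiagonal n, ((p.1 + 1 : ℕ) : R) • B (p.1 + 1) p.2 =
      ∑ p ∈ antidiagonal (n + 1), (p.1 : R) • B p.1 p.2 := by
    rw [Finset.Nat.sum_antidiagonal_succ]
    simp
  have hright : ∑ p ∈ antidiagonal n, ((p.2 + 1 : ℕ) : R) • B p.1 (p.2 + 1) =
      ∑ p ∈ antidiagonal (n + 1), (p.2 : R) • B p.1 p.2 := by
    rw [Finset.Nat.sum_antidiagonal_succ']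
    simp
  rw [Finset.sum_add_distrib, hleft, hright, ← Finset.sum_add_distrib, Finset.smul_sum]
  refine Finset.sum_congr rfl fun p hp => ?_
  rw [mem_antidiagonal] at hp
  rw [← add_smul, ← Nat.cast_add, hp]

variable {k : Type*} [Field k] {E M : Type*} [AddCommGroup M] [Module k M]

/-- The action of the power series `r` on power series with coefficients in `M`. -/
def seriesAct (act : E → M →ₗ[k] M) (r : ℕ → E) : (ℕ → M) →ₗ[k] (ℕ → M) where
  toFun F N := ∑ ij ∈ antidiagonal N, act (r ij.1) (F ij.2)
  map_add' F G := by
    funext N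
    simp [Finset.sum_add_distrib]
  map_smul' c F := by
    funext N
    simp [Finset.smul_sum]

/-- The bracket of degree one elements extended to power series. -/
def seriesBr (br : ℤ → ℤ → M →ₗ[k] M →ₗ[k] M) : (ℕ → M) →ₗ[k] (ℕ → M) →ₗ[k] (ℕ → M) :=
  LinearMap.mk₂ k (fun F G N => ∑ ij ∈ antidiagonal N, br 1 1 (F ij.1) (G ij.2))
    (by intro F F' G; funext N; simp [Finset.sum_add_distrib])
    (by intro c F G; funext N; simp [Finset.smul_sum])
    (by intro F G G'; funext N; simp [Finset.sum_add_distrib])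
    (by intro c F G; funext N; simp [Finset.smul_sum])

theorem seriesAct_apply (act : E → M →ₗ[k] M) (r : ℕ → E) (F : ℕ → M) (N : ℕ) :
    seriesAct act r F N = ∑ ij ∈ antidiagonal N, act (r ij.1) (F ij.2) := rfl

theorem seriesBr_apply (br : ℤ → ℤ → M →ₗ[k] M →ₗ[k] M) (F G : ℕ → M) (N : ℕ) :
    seriesBr br F G N = ∑ ij ∈ antidiagonal N, br 1 1 (F ij.1) (G ij.2) := rfl

theorem seriesBr_comm {br : ℤ → ℤ → M →ₗ[k] M →ₗ[k] M} (hbr : ∀ f h, br 1 1 f h = br 1 1 h f)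
    (F G : ℕ → M) : seriesBr br F G = seriesBr br G F := by
  funext N
  rw [seriesBr_apply, seriesBr_apply, ← Finset.Nat.sum_antidiagonal_swap]
  exact Finset.sum_congr rfl fun _ _ => hbr _ _

theorem seriesBr_single_left (br : ℤ → ℤ → M →ₗ[k] M →ₗ[k] M) (l : M) (F : ℕ → M) (N : ℕ) :
    seriesBr br (Pi.single 0 l) F N = br 1 1 l (F N) := by
  rw [seriesBr_apply, sum_antidiagonal_eq_single_left fun _ _ => by simp, Pi.single_eq_same]

theorem seriesAct_iterate_apply (act : E → M →ₗ[k] M) (r : ℕ → E) (n : ℕ) (F : ℕ → M) (N : ℕ) :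
    (seriesAct act r)^[n] F N = ∑ p ∈ antidiagonal N, ∑ ν ∈ Finset.Nat.antidiagonalTuple n p.1,
      iter act n (fun i => r (ν i)) (F p.2) := by
  induction n generalizing F with
  | zero =>
    rw [sum_antidiagonal_eq_single_left fun _ _ => by simp, Finset.Nat.antidiagonalTuple_zero_zero,
      Finset.sum_singleton]
    rfl
  | succ n ih =>
    rw [Function.iterate_succ_apply, ih]
    simp only [seriesAct_apply, map_sum, sum_antidiagonalTuple_succ n]
    have hcomm (p : ℕ × ℕ) : ∑ ν ∈ Finset.Nat.antidiagonalTuple n p.1, ∑ q ∈ antidiagonal p.2,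
        iter act n (fun i => r (ν i)) (act (r q.1) (F q.2)) =
      ∑ q ∈ antidiagonal p.2, ∑ ν ∈ Finset.Nat.antidiagonalTuple n p.1,
        iter act n (fun i => r (ν i)) (act (r q.1) (F q.2)) := Finset.sum_comm
    rw [Finset.sum_congr rfl fun p _ => hcomm p, sum_antidiagonal_assoc (fun a b c =>
      ∑ ν ∈ Finset.Nat.antidiagonalTuple n a,
        iter act n (fun i => r (ν i)) (act (r b) (F c)))]
    refine Finset.sum_congr rfl fun p _ => ?_
    rw [← Finset.Nat.sum_antidiagonal_swap]
    rfl

/-- The term `(1/n!) rⁿ l` of the exponential of the action of `r` on a constant series `l`. -/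
def expTerm (act : E → M →ₗ[k] M) (r : ℕ → E) (l : M) (n : ℕ) : ℕ → M :=
  (n.factorial : k)⁻¹ • (seriesAct act r)^[n] (Pi.single 0 l)

theorem expTerm_zero (act : E → M →ₗ[k] M) (r : ℕ → E) (l : M) :
    expTerm act r l 0 = Pi.single 0 l := by
  simp [expTerm]

theorem expTerm_apply (act : E → M →ₗ[k] M) (r : ℕ → E) (l : M) (n N : ℕ) :
    expTerm act r l n N = (n.factorial : k)⁻¹ •
      ∑ ν ∈ Finset.Nat.antidiagonalTuple n N, iter act n (fun i => r (ν i)) l := by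
  rw [expTerm, Pi.smul_apply, seriesAct_iterate_apply,
    sum_antidiagonal_eq_single_right fun _ _ => by simp, Pi.single_eq_same]

theorem seriesAct_expTerm [CharZero k] (act : E → M →ₗ[k] M) (r : ℕ → E) (l : M) (n : ℕ) :
    seriesAct act r (expTerm act r l n) = ((n + 1 : ℕ) : k) • expTerm act r l (n + 1) := by
  rw [expTerm, expTerm, map_smul, ← Function.iterate_succ_apply' (seriesAct act r),
    smul_smul]
  congr 1
  rw [Nat.factorial_succ, Nat.cast_mul, mul_inv, mul_inv_cancel_left₀]
  exact Nat.cast_ne_zero.2 n.succ_ne_zero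

variable {act : E → M →ₗ[k] M} {r : ℕ → E}

theorem expTerm_eq_zero_of_lt (hr0 : act (r 0) = 0) (l : M)
    {n i : ℕ} (hi : i < n) : expTerm act r l n i = 0 := by
  have iterate_eq_zero (n i : ℕ) (hi : i < n) : (seriesAct act r)^[n] (Pi.single 0 l) i = 0 := by
    induction n generalizing i with
    | zero => omega
    | succ n ih =>
      rw [Function.iterate_succ_apply', seriesAct_apply]
      refine Finset.sum_eq_zero fun p hp => ?_
      rw [mem_antidiagonal] at hp
      by_cases h0 : p.1 = 0
      · rw [h0, hr0, LinearMap.zero_apply]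
      · rw [ih p.2 (by omega), map_zero]
  rw [expTerm, Pi.smul_apply, iterate_eq_zero n i hi, smul_zero]

theorem seriesBr_expTerm_eq_zero_of_lt (br : ℤ → ℤ → M →ₗ[k] M →ₗ[k] M) (hr0 : act (r 0) = 0)
    (l : M) {p q N : ℕ} (hpq : N < p + q) :
    seriesBr br (expTerm act r l p) (expTerm act r l q) N = 0 := by
  rw [seriesBr_apply]
  refine Finset.sum_eq_zero fun ij hij => ?_
  rw [mem_antidiagonal] at hij
  by_cases hp : ij.1 < p
  · rw [expTerm_eq_zero_of_lt hr0 l hp, map_zero, LinearMap.zero_apply]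
  · rw [expTerm_eq_zero_of_lt hr0 l (show ij.2 < q by omega), map_zero]

/-- The exponential `eʳ l` of the action of `r` on a constant series `l`. The truncation of the
coefficient of `λᴺ` is the whole sum as soon as `r 0` acts by zero. -/
def expSum (act : E → M →ₗ[k] M) (r : ℕ → E) (l : M) : ℕ → M :=
  fun N => ∑ n ∈ Finset.range (N + 1), expTerm act r l n N

theorem expSum_eq_sum_range (hr0 : act (r 0) = 0) (l : M) {i N : ℕ} (hi : i ≤ N) :
    expSum act r l i = ∑ n ∈ Finset.range (N + 1), expTerm act r l n i := by
  refine Finset.sum_subset (Finset.range_subset_range.2 (by omega)) fun n _ hn => ?_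
  rw [Finset.mem_range, not_lt] at hn
  exact expTerm_eq_zero_of_lt hr0 l hn

theorem seriesBr_expSum_apply (br : ℤ → ℤ → M →ₗ[k] M →ₗ[k] M) (hr0 : act (r 0) = 0) (l : M)
    (N : ℕ) : seriesBr br (expSum act r l) (expSum act r l) N =
      ∑ n ∈ Finset.range (N + 1), ∑ p ∈ antidiagonal n,
        seriesBr br (expTerm act r l p.1) (expTerm act r l p.2) N := by
  calc
    _ = ∑ p ∈ Finset.range (N + 1), ∑ q ∈ Finset.range (N + 1),
        seriesBr br (expTerm act r l p) (expTerm act r l q) N := by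
      simp only [seriesBr_apply]
      rw [Finset.sum_congr rfl fun p _ => Finset.sum_comm, Finset.sum_comm]
      refine Finset.sum_congr rfl fun ij hij => ?_
      rw [mem_antidiagonal] at hij
      rw [expSum_eq_sum_range hr0 l (show ij.1 ≤ N by omega),
        expSum_eq_sum_range hr0 l (show ij.2 ≤ N by omega)]
      simp only [map_sum, LinearMap.sum_apply]
      exact Finset.sum_comm
    _ = ∑ p ∈ Finset.range (N + 1), ∑ q ∈ Finset.range (N + 1 - p),
        seriesBr br (expTerm act r l p) (expTerm act r l q) N := by
      refine Finset.sum_congr rfl fun p hp => (Finset.sum_subset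
        (Finset.range_subset_range.2 (by omega))
        fun q _ hq => seriesBr_expTerm_eq_zero_of_lt br hr0 l ?_).symm
      rw [Finset.mem_range] at hp hq
      omega
    _ = _ := by
      rw [← Finset.sum_range_diag_flip (N + 1) fun p q =>
        seriesBr br (expTerm act r l p) (expTerm act r l q) N]
      refine Finset.sum_congr rfl fun n _ => ?_
      rw [← Finset.Nat.sum_antidiagonal_eq_sum_range_succ fun p q =>
        seriesBr br (expTerm act r l p) (expTerm act r l q) N]

namespace IsDerivedAction

variable [AddCommGroup E] [Module k E] {ℬ : ℤ → Submodule k M}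
  {br : ℤ → ℤ → M →ₗ[k] M →ₗ[k] M} {𝒱 : ℤ → Submodule k E} {emb : E → M}

theorem seriesAct_mem (h : IsDerivedAction ℬ br 𝒱 emb act) (hr : ∀ i, r i ∈ 𝒱 0) {F : ℕ → M}
    (hF : ∀ i, F i ∈ ℬ 1) (N : ℕ) : seriesAct act r F N ∈ ℬ 1 := by
  rw [seriesAct_apply]
  refine Submodule.sum_mem _ fun ij _ => ?_
  simpa using h.act_mem (hF ij.2) (hr ij.1)

theorem seriesAct_seriesBr (h : IsDerivedAction ℬ br 𝒱 emb act) (hr : ∀ i, r i ∈ 𝒱 0)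
    {F G : ℕ → M} (hF : ∀ i, F i ∈ ℬ 1) (hG : ∀ i, G i ∈ ℬ 1) :
    seriesAct act r (seriesBr br F G) =
      seriesBr br (seriesAct act r F) G + seriesBr br F (seriesAct act r G) := by
  funext N
  rw [Pi.add_apply]
  simp only [seriesAct_apply, seriesBr_apply, map_sum, LinearMap.sum_apply]
  rw [← sum_antidiagonal_assoc (fun a b c => br 1 1 (act (r a) (F b)) (G c)),
    sum_antidiagonal_left_comm (fun a b c => br 1 1 (F b) (act (r a) (G c))),
    ← Finset.sum_add_distrib]
  refine Finset.sum_congr rfl fun p _ => ?_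
  rw [← Finset.sum_add_distrib]
  refine Finset.sum_congr rfl fun q _ => ?_
  have hact := h.act_br (hF q.1) (hG q.2) (hr p.1)
  rwa [mul_zero, Int.negOnePow_zero, one_smul, add_zero] at hact

theorem expTerm_mem (h : IsDerivedAction ℬ br 𝒱 emb act) (hr : ∀ i, r i ∈ 𝒱 0) {l : M}
    (hl : l ∈ ℬ 1) (n i : ℕ) : expTerm act r l n i ∈ ℬ 1 := by
  have iterate_mem (n i : ℕ) : (seriesAct act r)^[n] (Pi.single 0 l) i ∈ ℬ 1 := by
    induction n generalizing i with
    | zero =>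
      rcases i with _ | i
      · simpa using hl
      · simp
    | succ n ih =>
      rw [Function.iterate_succ_apply']
      exact h.seriesAct_mem hr ih i
  exact Submodule.smul_mem _ _ (iterate_mem n i)

variable [CharZero k] {l : M}

-- Induction on `n`: the derivation property turns the action of `r` on the sum of weight `n` into
-- `n + 1` times the sum of weight `n + 1`.
theorem sum_seriesBr_expTerm (h : IsDerivedAction ℬ br 𝒱 emb act) (hr : ∀ i, r i ∈ 𝒱 0)
    (hl : l ∈ ℬ 1) (hll : br 1 1 l l = 0) (n : ℕ) :
    ∑ p ∈ antidiagonal n, seriesBr br (expTerm act r l p.1) (expTerm act r l p.2) = 0 := by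
  have hmem := h.expTerm_mem hr hl
  induction n with
  | zero =>
    rw [Finset.Nat.antidiagonal_zero, Finset.sum_singleton]
    funext N
    rw [seriesBr_apply]
    refine Finset.sum_eq_zero fun ij _ => ?_
    rw [expTerm_zero]
    rcases ij with ⟨_ | i, _ | j⟩ <;> simp [hll]
  | succ n ih =>
    have leibniz (p : ℕ × ℕ) :
        seriesAct act r (seriesBr br (expTerm act r l p.1) (expTerm act r l p.2)) =
          ((p.1 + 1 : ℕ) : k) • seriesBr br (expTerm act r l (p.1 + 1)) (expTerm act r l p.2) +
          ((p.2 + 1 : ℕ) : k) • seriesBr br (expTerm act r l p.1) (expTerm act r l (p.2 + 1)) := by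
      rw [h.seriesAct_seriesBr hr (hmem _) (hmem _), seriesAct_expTerm, seriesAct_expTerm,
        map_smul, map_smul, LinearMap.smul_apply]
    have hsum := congrArg (seriesAct act r) ih
    rw [map_zero, map_sum, Finset.sum_congr rfl fun p _ => leibniz p,
      sum_antidiagonal_succ_smul fun p q =>
        seriesBr br (expTerm act r l p) (expTerm act r l q)] at hsum
    exact (smul_eq_zero.1 hsum).resolve_left (Nat.cast_ne_zero.2 n.succ_ne_zero)

theorem seriesBr_expSum (h : IsDerivedAction ℬ br 𝒱 emb act) (hr : ∀ i, r i ∈ 𝒱 0)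
    (hr0 : act (r 0) = 0) (hl : l ∈ ℬ 1) (hll : br 1 1 l l = 0) :
    seriesBr br (expSum act r l) (expSum act r l) = 0 := by
  funext N
  rw [seriesBr_expSum_apply br hr0, Pi.zero_apply]
  refine Finset.sum_eq_zero fun n _ => ?_
  rw [← Finset.sum_apply, h.sum_seriesBr_expTerm hr hl hll, Pi.zero_apply]

end IsDerivedAction

end Exponential

/-! ### Graded Lie algebras -/

section Triangular

open Finset.HasAntidiagonal

variable {k : Type u} [Field k] {g : Type v} [AddCommGroup g] [Module k g]
  {𝒢 : ℤ → Submodule k g}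

theorem bigEmb_zero : bigEmb (0 : ℕ → Sym 𝒢) = 0 := by
  funext m n
  rcases n with _ | n
  · rfl
  · rcases m with _ | m
    · ext
      rfl
    · rfl

theorem mem_hatShift_sub_one {p : ℤ} {x : ℕ → Sym 𝒢} (hx : x ∈ shift (hatDeg 𝒢) 1 p) :
    x ∈ hatShift 𝒢 (p - 1) := by
  change x ∈ hatDeg 𝒢 (1 + (1 + (p - 1)))
  rwa [add_sub_cancel]

variable [DirectSum.Decomposition 𝒢] {l : ∀ n : ℕ, MultilinearMap k (fun _ : Fin n => g) g}

theorem phi_eq_zero_of_lie (h2 : ∀ n, n ≠ 2 → l n = 0) {n : ℕ} (hn : 2 ≤ n) :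
    phi 𝒢 l n = 0 := by
  refine MultilinearMap.ext fun x => funext fun m => funext fun q => ?_
  rcases m with _ | m
  · exact phi_zero_apply l n x q
  · ext y
    rw [phi_apply 𝒢 l n x (m + 1) q (Nat.succ_ne_zero m),
      hatBracket_eq_zero (h2 (n + (m + 1)) (by omega))]
    rfl

theorem bigIns_bigElement_of_lie (h2 : ∀ n, n ≠ 2 → l n = 0) (x : ℕ → Sym 𝒢) :
    bigIns x (bigElement 𝒢 l) = phi 𝒢 l 1 ![x] := by
  have h := iter_bigIns_eq (𝒢 := 𝒢) l 1 ![x]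
  rw [hatBracket_eq_zero (h2 1 (by norm_num)), zero_apply, bigEmb_zero, add_zero] at h
  exact h

theorem map_vec_units_smul {E M : Type*} [AddCommGroup E] [Module k E] [AddCommGroup M]
    [Module k M] (f : MultilinearMap k (fun _ : Fin 1 => E) M) (ε : ℤˣ) (x : E) :
    f ![ε • x] = ε • f ![x] := by
  have hlinear (z : E) : f.toLinearMap ![x] 0 z = f ![z] := by
    refine congrArg f (funext fun i => ?_)
    rw [Subsingleton.elim i 0]
    rfl
  rw [← hlinear, ← hlinear, LinearMap.map_smul_of_tower]

theorem phi_one_mem (hl : IsLInfinity 𝒢 l) {p : ℤ} {x : ℕ → Sym 𝒢}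
    (hx : x ∈ shift (hatDeg 𝒢) 1 p) : phi 𝒢 l 1 ![x] ∈ bigHom p := by
  have h := phi_mem hl (d := ![p - 1]) (x := ![x]) (fun i => by
    fin_cases i
    exact mem_hatShift_sub_one hx)
  simpa using (mem_bigPlus_iff.1 h).1

theorem bigD_phi_of_lie [NeZero (2 : k)] (hl : IsLInfinity 𝒢 l) (h2 : ∀ n, n ≠ 2 → l n = 0) {p : ℤ}
    {x : ℕ → Sym 𝒢} (hx : x ∈ shift (hatDeg 𝒢) 1 p) :
    bigD 𝒢 l p (phi 𝒢 l 1 ![x]) = 0 := by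
  have h := bigIns_isDerivedAction.act_br (bigElement_mem hl) (bigElement_mem hl)
    (mem_hatShift_sub_one hx)
  rw [bigBracket_bigElement hl, map_zero, bigIns_bigElement_of_lie h2, add_sub_cancel,
    bigBracket_antisymm p 1, smul_neg, smul_smul, ← Int.negOnePow_add, ← Units.neg_smul,
    ← Int.negOnePow_succ, Int.negOnePow_even, one_smul, ← two_smul k] at h
  · exact (smul_eq_zero.1 h.symm).resolve_left two_ne_zero
  · simp only [Int.even_add, Int.even_mul, Int.even_sub, Int.not_even_one]
    tauto

theorem bigIns_phi_of_lie (h2 : ∀ n, n ≠ 2 → l n = 0) (x y : ℕ → Sym 𝒢) :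
    bigIns y (phi 𝒢 l 1 ![x]) = bigEmb (hatBracket 𝒢 l 2 ![x, y]) := by
  have h := iter_bigIns_eq (𝒢 := 𝒢) l 2 ![x, y]
  rw [phi_eq_zero_of_lie h2 le_rfl, zero_apply, zero_add] at h
  rw [← h, ← bigIns_bigElement_of_lie h2]
  rfl

theorem hatBracket_two_mem (hl : IsLInfinity 𝒢 l) {p q : ℤ} {x y : ℕ → Sym 𝒢}
    (hx : x ∈ shift (hatDeg 𝒢) 1 p) (hy : y ∈ shift (hatDeg 𝒢) 1 q) :
    hatBracket 𝒢 l 2 ![x, y] ∈ hatShift 𝒢 (p + (q - 1)) := by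
  have hmem := hatBracket_mem hl (d := ![p - 1, q - 1]) (x := ![x, y]) (fun i => by
    fin_cases i
    · exact mem_hatShift_sub_one hx
    · exact mem_hatShift_sub_one hy)
  have hdeg : 1 + ∑ i, (![p - 1, q - 1] : Fin 2 → ℤ) i = p + (q - 1) := by
    rw [Fin.sum_univ_two]
    simp only [Matrix.cons_val_zero, Matrix.cons_val_one]
    ring
  rwa [hdeg] at hmem

theorem bigBracket_phi_of_lie [NeZero (2 : k)] (hl : IsLInfinity 𝒢 l) (h2 : ∀ n, n ≠ 2 → l n = 0)
    {p q : ℤ} {x y : ℕ → Sym 𝒢} (hx : x ∈ shift (hatDeg 𝒢) 1 p)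
    (hy : y ∈ shift (hatDeg 𝒢) 1 q) :
    bigBracket 𝒢 p q (phi 𝒢 l 1 ![x]) (phi 𝒢 l 1 ![y]) =
      phi 𝒢 l 1 ![p.negOnePow • hatBracket 𝒢 l 2 ![x, y]] := by
  have leibniz := bigIns_isDerivedAction.act_br (bigElement_mem hl) (phi_one_mem hl hx)
    (mem_hatShift_sub_one hy)
  have closed : bigBracket 𝒢 1 p (bigElement 𝒢 l) (phi 𝒢 l 1 ![x]) = 0 := bigD_phi_of_lie hl h2 hx
  rw [closed, map_zero, bigIns_phi_of_lie h2,
    ← bigIns_isDerivedAction.act_eq (bigElement_mem hl) (hatBracket_two_mem hl hx hy),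
    bigIns_bigElement_of_lie h2, bigIns_bigElement_of_lie h2, add_sub_cancel,
    bigBracket_antisymm q p, smul_neg, smul_smul, ← Int.negOnePow_add, neg_add_eq_sub, eq_comm,
    sub_eq_zero] at leibniz
  rw [map_vec_units_smul, leibniz, smul_smul, ← Int.negOnePow_add, Int.negOnePow_even, one_smul]
  simp only [Int.even_add, Int.even_mul, Int.even_sub, Int.not_even_one]
  tauto

/-! ### Triangular `L_∞`-bialgebras -/

theorem bigIns_zero : bigIns (0 : ℕ → Sym 𝒢) = 0 := by
  refine LinearMap.ext fun f => big_ext fun n => ?_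
  rcases n with _ | n
  · rfl
  · rw [slice_succ_bigIns, LinearMap.zero_apply, map_zero]
    refine Finset.sum_eq_zero fun ij _ => ?_
    funext m
    exact LinearMap.map_zero₂ (insertArg 𝒢 m) _

theorem transfer_add_single {r : ℕ → ℕ → Sym 𝒢} (hr : IsRInfinityMatrix 𝒢 l r) :
    transfer 𝒢 l r + Pi.single 0 (bigElement 𝒢 l) = expSum bigIns r (bigElement 𝒢 l) := by
  funext N
  have hrange : Finset.range (N + 1) = insert 0 (Finset.Icc 1 N) := by
    ext i
    simp only [Finset.mem_range, Finset.mem_insert, Finset.mem_Icc]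
    omega
  rw [expSum, hrange, Finset.sum_insert (by simp), expTerm_zero, Pi.add_apply, add_comm]
  congr 1
  rw [Finset.sum_congr rfl fun n _ => expTerm_apply bigIns r (bigElement 𝒢 l) n N]
  funext m q
  rcases m with _ | m
  · ext y
    rw [Subsingleton.elim y Fin.elim0]
    change ev0 (slice q (∑ n ∈ Finset.Icc 1 N, _)) = ev0 (slice q (∑ n ∈ Finset.Icc 1 N, _))
    simp only [map_sum, map_smul, ← hatBracket_eq_ev0]
    have h := congrFun (hr.2.2 N) q
    simp only [expSeries, Finset.sum_apply, Pi.smul_apply] at h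
    rw [h]
    refine Finset.sum_eq_zero fun n _ => ?_
    rw [Finset.sum_eq_zero, smul_zero]
    intro ν _
    exact congrArg (fun f => f Fin.elim0) (phi_zero_apply (𝒢 := 𝒢) l n (fun i => r (ν i)) q)
  · simp only [transfer, expSeries, Finset.sum_apply, Pi.smul_apply, phi_succ_apply]

theorem transfer_mem (hl : IsLInfinity 𝒢 l) {r : ℕ → ℕ → Sym 𝒢} (hr : IsRInfinityMatrix 𝒢 l r)
    (N : ℕ) : transfer 𝒢 l r N ∈ bigPlus 𝒢 1 := by
  unfold transfer expSeries
  refine Submodule.sum_mem _ fun n _ => Submodule.smul_mem _ _ (Submodule.sum_mem _ fun ν _ => ?_)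
  simpa using phi_mem hl (d := fun _ => 0) (x := fun i => r (ν i)) (fun i => hr.2.1 (ν i))

theorem bigBracket_one_one_comm (f h : Big 𝒢) : bigBracket 𝒢 1 1 f h = bigBracket 𝒢 1 1 h f := by
  rw [bigBracket_antisymm, mul_one, Int.negOnePow_one, Units.neg_smul, one_smul, neg_neg]

variable [CharZero k]

theorem seriesBr_transfer_add_single (hl : IsLInfinity 𝒢 l) {r : ℕ → ℕ → Sym 𝒢}
    (hr : IsRInfinityMatrix 𝒢 l r) :
    seriesBr (bigBracket 𝒢) (transfer 𝒢 l r + Pi.single 0 (bigElement 𝒢 l))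
      (transfer 𝒢 l r + Pi.single 0 (bigElement 𝒢 l)) = 0 := by
  rw [transfer_add_single hr]
  exact bigIns_isDerivedAction.seriesBr_expSum hr.2.1 (by rw [hr.1, bigIns_zero])
    (bigElement_mem hl) (bigBracket_bigElement hl)

theorem transfer_isLInfinityBialgebra (hl : IsLInfinity 𝒢 l) {r : ℕ → ℕ → Sym 𝒢}
    (hr : IsRInfinityMatrix 𝒢 l r) :
    IsLInfinityBialgebra 𝒢 (transfer 𝒢 l r + Pi.single 0 (bigElement 𝒢 l)) := by
  refine ⟨fun i => ?_, fun N => congrFun (seriesBr_transfer_add_single hl hr) N⟩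
  rw [Pi.add_apply]
  refine add_mem (transfer_mem hl hr i) ?_
  rcases i with _ | i
  · rw [Pi.single_eq_same]
    exact bigElement_mem_bigPlus hl
  · rw [Pi.single_eq_of_ne (Nat.succ_ne_zero i)]
    exact zero_mem _

theorem transfer_maurerCartan (hl : IsLInfinity 𝒢 l) {r : ℕ → ℕ → Sym 𝒢}
    (hr : IsRInfinityMatrix 𝒢 l r) (N : ℕ) :
    bigD 𝒢 l 1 (transfer 𝒢 l r N) + (2⁻¹ : k) • ∑ ij ∈ antidiagonal N,
      bigBracket 𝒢 1 1 (transfer 𝒢 l r ij.1) (transfer 𝒢 l r ij.2) = 0 := by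
  have hconst : bigBracket 𝒢 1 1 (bigElement 𝒢 l)
      ((Pi.single 0 (bigElement 𝒢 l) : ℕ → Big 𝒢) N) = 0 := by
    rcases N with _ | N
    · rw [Pi.single_eq_same, bigBracket_bigElement hl]
    · rw [Pi.single_eq_of_ne (Nat.succ_ne_zero N), map_zero]
  have hexpand := congrFun (seriesBr_transfer_add_single hl hr) N
  rw [map_add, map_add, LinearMap.add_apply, LinearMap.add_apply,
    seriesBr_comm bigBracket_one_one_comm (transfer 𝒢 l r) (Pi.single 0 _), Pi.add_apply,
    Pi.add_apply, Pi.add_apply, seriesBr_single_left, seriesBr_single_left, hconst, add_zero,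
    add_assoc, ← two_smul k, Pi.zero_apply, seriesBr_apply, add_eq_zero_iff_eq_neg] at hexpand
  rw [hexpand, smul_neg, smul_smul, inv_mul_cancel₀ two_ne_zero, one_smul]
  exact add_neg_cancel _

end Triangular

end RInf

end

theorem mainTheorem1 {k : Type*} [Field k] [CharZero k] {g : Type*} [AddCommGroup g] [Module k g]
    (𝒢 : ℤ → Submodule k g) [DirectSum.Decomposition 𝒢]
    (l : ∀ n : ℕ, MultilinearMap k (fun _ : Fin n => g) g) (hl : RInf.IsLInfinity 𝒢 l) :
    -- the brackets on `S (g[-1])` are the multiderivations that extend those of `g`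
    RInf.IsMultiderivationExtension 𝒢 l (RInf.symBracket 𝒢 l) ∧
    -- `φ` is an `L_∞`-morphism from the `L_∞`-algebra `Ŝ (g[-1])[1]` to the dg Lie algebra `ℬ⁺`
    RInf.IsLInfinityMorphism (RInf.shift (RInf.hatDeg 𝒢) 1) (RInf.hatBracket 𝒢 l)
      (RInf.bigPlus 𝒢) (RInf.bigBracket 𝒢) (RInf.bigD 𝒢 l) (RInf.phi 𝒢 l) ∧
    -- the case of a graded Lie algebra: `φ = φ₁` is a morphism of graded Lie algebras, where the
    -- Lie bracket of `Ŝ (g[-1])[1]` is `(-1)^|x| l₂ (x ⊙ y)`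
    ((∀ n, n ≠ 2 → l n = 0) →
      (∀ n, 2 ≤ n → RInf.phi 𝒢 l n = 0) ∧
      (∀ (p : ℤ) (x : ℕ → RInf.Sym 𝒢), x ∈ RInf.shift (RInf.hatDeg 𝒢) 1 p →
        RInf.bigD 𝒢 l p (RInf.phi 𝒢 l 1 ![x]) = 0) ∧
      (∀ (p q : ℤ) (x y : ℕ → RInf.Sym 𝒢), x ∈ RInf.shift (RInf.hatDeg 𝒢) 1 p →
        y ∈ RInf.shift (RInf.hatDeg 𝒢) 1 q →
        RInf.bigBracket 𝒢 p q (RInf.phi 𝒢 l 1 ![x]) (RInf.phi 𝒢 l 1 ![y]) =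
          RInf.phi 𝒢 l 1 ![p.negOnePow • RInf.hatBracket 𝒢 l 2 ![x, y]])) ∧
    -- an `r_∞`-matrix gives a Maurer-Cartan element and an `L_∞`-bialgebra
    (∀ r : ℕ → ℕ → RInf.Sym 𝒢, RInf.IsRInfinityMatrix 𝒢 l r →
      RInf.transfer 𝒢 l r 0 = 0 ∧
      (∀ N, RInf.transfer 𝒢 l r N ∈ RInf.bigPlus 𝒢 1) ∧
      (∀ N, RInf.bigD 𝒢 l 1 (RInf.transfer 𝒢 l r N) +
        (2⁻¹ : k) • ∑ ij ∈ Finset.HasAntidiagonal.antidiagonal N,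
          RInf.bigBracket 𝒢 1 1 (RInf.transfer 𝒢 l r ij.1) (RInf.transfer 𝒢 l r ij.2) = 0) ∧
      RInf.IsLInfinityBialgebra 𝒢
        (RInf.transfer 𝒢 l r + Pi.single 0 (RInf.bigElement 𝒢 l))) := by
  refine ⟨RInf.symBracket_isMultiderivationExtension hl, RInf.phi_isLInfinityMorphism hl,
    fun h2 => ⟨fun n hn => RInf.phi_eq_zero_of_lie h2 hn,
      fun p x hx => RInf.bigD_phi_of_lie hl h2 hx,
      fun p q x y hx hy => RInf.bigBracket_phi_of_lie hl h2 hx hy⟩,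
    fun r hr => ⟨rfl, RInf.transfer_mem hl hr, RInf.transfer_maurerCartan hl hr,
      RInf.transfer_isLInfinityBialgebra hl hr⟩⟩
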